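/- Let $G$ be a finite connected multigraph without loops (parallel edges allowed), with vertex set $V(G)$, $|V(G)|=g$, and edge set $E(G)$, and suppose that $G$ is $d$-regular with $d\ge 3$. A random $n$-lift $L_n(G)$ has vertex set $\bigcup_{i\in V(G)}V_i$ with disjoint sets $V_i$ of size $n$, and for every edge $e=ij$ of $G$, independently, a uniformly random perfect matching between $V_i$ and $V_j$ is placed; let $X_G$ be the number of perfect matchings of $L_n(G)$ (parallel edges being distinguished). Consider vectors $x=(x_{ief})\in\mathbb R^{gd^2}$ indexed by $i\in V(G)$ and edges $e,f\ni i$. Let $V^*$ be the space of those $x$ such that, for every edge $e$ with endpoints $i,j$, $$x_{iee}=x_{jee},\qquad \sum_{f\ni i}x_{ief}=\sum_{f\ni j}x_{jef},\qquad \sum_{f\ni i}x_{ife}=\sum_{f\ni j}x_{jfe},$$ and put $V=\{x\in V^*:\sum_{e,f\ni i}x_{ief}=0\ \forall i\}$, $W=\{x\in V^*:\sum_{e,f\ni i}x_{ief}=1\ \forall i\}$, $K=[0,1]^{gd^2}$, $\mathcal L^{(2)}_G=V\cap\mathbb Z^{gd^2}$. Let $r$ be the rank of the lattice $\mathcal L^{(2)}_G$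 and $\det(\mathcal L^{(2)}_G)$ its determinant, i.e. the $r$-dimensional volume of a unit cell. With $$\sigma_{ie}=\sum_{f\ni i,\,f\ne e}x_{ief},\qquad \tau_{ie}=\sum_{f\ni i,\,f\ne e}x_{ife},\qquad \gamma_{ie}=\sum_{f,f'\ni i;\ f,f'\ne e}x_{iff'},$$ define (with $0\ln 0=0$) $$\phi(x)=\tfrac12\sum_{i\in V(G)}\sum_{e\ni i}\Bigl(\sigma_{ie}\ln\sigma_{ie}+\tau_{ie}\ln\tau_{ie}+\gamma_{ie}\ln\gamma_{ie}-x_{iee}\ln x_{iee}-2\sum_{f\ni i,\,f\ne e}x_{ief}\ln x_{ief}\Bigr).$$ Let $x^0=(1/d^2,\dots,1/d^2)$, let $H=D^2\phi(x^0)$ be the Hessian, and let $\det(-H|_V)$ be the determinant of the bilinear form $-H$ restricted to $V$, computed in an orthonormal basis of $V$. If $\phi$ has a unique maximum on $K\cap W$, attained at $x^0$, and $\det(-H|_V)\ne0$, then $$\mathbb E(X_G^2)\sim\frac{\bigl((d-1)d^{d-2}\bigr)^{dg}}{\det(\mathcal L^{(2)}_G)\,\det(-H|_V)^{1/2}}\,(2\pi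 n)^{r/2+g/2+3dg/4-d^2g/2}\left(\frac{(d-1)^{d-1}}{d^{d-2}}\right)^{gn}$$ as $n\to\infty$ through those $n$ for which there is a function $z:E(G)\to[0,1]$ with $\sum_{e\ni v}z_e=1$ for every vertex $v$ and $nz$ integer-valued (for other $n$, $X_G=0$). In particular, if $d=3$, then $\det(-H|_V)\neq0$ and this asymptotic formula holds, without further assumptions on $G$. -/

import Mathlib

open scoped Graph

/-! ### Multigraphs, fractional perfect matchings, perfect matchings -/

namespace Graph

universe u v

variable {α : Type u} {β : Type v}

/-- A multigraph is connected if its underlying simple graph is (in particular it has a vertex). -/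
def IsConnected (G : Graph α β) : Prop :=
  G.toSimpleGraph.Connected

/-- `d`-regularity of a loopless multigraph: every vertex is incident with exactly `d` edges. -/
def IsRegular (G : Graph α β) (d : ℕ) : Prop :=
  ∀ i ∈ V(G), (G.incidenceSet i).ncard = d

/-- The edges `e ∋ i` at a vertex `i`. -/
abbrev EdgesAt (G : Graph α β) (i : V(G)) : Type v :=
  {e : E(G) // G.Inc e.1 i.1}

open scoped Classical in
noncomputable instance EdgesAt.instFintype (G : Graph α β) [Fintype E(G)] (i : V(G)) :
    Fintype (G.EdgesAt i) :=
  Subtype.fintype _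

/-- The edge `e`, joining `i` and `j`, as an edge at its endpoint `i`. -/
def edgeAtLeft (G : Graph α β) {e : E(G)} {i j : V(G)} (h : G.IsLink e.1 i.1 j.1) :
    G.EdgesAt i :=
  ⟨e, h.inc_left⟩

/-- The edge `e`, joining `i` and `j`, as an edge at its endpoint `j`. -/
def edgeAtRight (G : Graph α β) {e : E(G)} {i j : V(G)} (h : G.IsLink e.1 i.1 j.1) :
    G.EdgesAt j :=
  ⟨e, h.inc_right⟩

/-- Fractional perfect matchings `f : E(G) → [0,1]`. -/
def IsFractionalPerfectMatching (G : Graph α β) [Fintype E(G)] (f : E(G) → ℝ) : Prop :=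
  (∀ e, f e ∈ Set.Icc (0 : ℝ) 1) ∧ ∀ i : V(G), ∑ e : G.EdgesAt i, f e.1 = 1

/-- The `n` for which some fractional perfect matching `f` of `G` has `n f` integral. For all other
`n` no `n`-lift of `G` has a perfect matching. -/
def IsAdmissible (G : Graph α β) [Fintype E(G)] (n : ℕ) : Prop :=
  ∃ f : E(G) → ℝ, G.IsFractionalPerfectMatching f ∧ ∀ e, ∃ m : ℤ, (n : ℝ) * f e = m

/-- A perfect matching of a (loopless) multigraph: a set of edges such that every vertex is
incident with exactly one of them. -/
def IsPerfectMatching (H : Graph α β) (M : Set β) : Prop :=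
  M ⊆ E(H) ∧ ∀ x ∈ V(H), ∃! e, e ∈ M ∧ H.Inc e x

/-- The number of perfect matchings of a multigraph. -/
noncomputable def numPerfectMatchings (H : Graph α β) : ℕ :=
  {M : Set β | H.IsPerfectMatching M}.ncard

/-! ### Random lifts -/

/-- The tail of an edge, in an arbitrary fixed orientation of `G`. -/
noncomputable def tail (G : Graph α β) (e : E(G)) : V(G) :=
  ⟨(G.exists_isLink_of_mem_edgeSet e.2).choose,
    (G.exists_isLink_of_mem_edgeSet e.2).choose_spec.choose_spec.left_mem⟩

/-- The head of an edge, in the same orientation of `G`. -/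
noncomputable def head (G : Graph α β) (e : E(G)) : V(G) :=
  ⟨(G.exists_isLink_of_mem_edgeSet e.2).choose_spec.choose,
    (G.exists_isLink_of_mem_edgeSet e.2).choose_spec.choose_spec.right_mem⟩

/-- The `n`-lift of `G` given by one permutation of `Fin n` for each edge. The vertices above `i`
are the pairs `(i, a)`; the fiber above an edge `e` from `i` to `j` is the perfect matching
consisting of the edges `(e, a)` joining `(i, a)` to `(j, σ e a)`. -/
noncomputable def lift (G : Graph α β) (n : ℕ) (σ : E(G) → Equiv.Perm (Fin n)) :
    Graph (V(G) × Fin n) (E(G) × Fin n) where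
  vertexSet := Set.univ
  IsLink p x y := s(x, y) = s((G.tail p.1, p.2), (G.head p.1, σ p.1 p.2))
  edgeSet := Set.univ
  isLink_symm := fun _ _ => ⟨fun _ _ h => Sym2.eq_swap.trans h⟩
  eq_or_eq_of_isLink_of_isLink := by
    intro e x y v w h h'
    have := h.trans h'.symm
    rw [Sym2.eq_iff] at this
    tauto
  edge_mem_iff_exists_isLink := fun p =>
    ⟨fun _ => ⟨_, _, rfl⟩, fun _ => Set.mem_univ _⟩
  left_mem_of_isLink := fun _ _ _ _ => Set.mem_univ _

open scoped Classical in
/-- `𝔼 (X_G ^ 2)`, where `X_G` is the number of perfect matchings in the random `n`-lift of `G`: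
the permutations of the edges are independent and uniform, so the expectation is the average over
all families of permutations. -/
noncomputable def secondMoment (G : Graph α β) [Fintype E(G)] (n : ℕ) : ℝ :=
  (∑ σ : E(G) → Equiv.Perm (Fin n), ((G.lift n σ).numPerfectMatchings : ℝ) ^ 2) /
    Fintype.card (E(G) → Equiv.Perm (Fin n))

/-! ### The lattice, the polytope and the exponent of the second moment -/

/-- The index set of the vectors `(x_{ief} : i ∈ V(G), e, f ∋ i)`. -/
abbrev PairIndex (G : Graph α β) : Type (max u v) :=
  Σ i : V(G), G.EdgesAt i × G.EdgesAt i

/-- The Euclidean space of the vectors `(x_{ief} : i ∈ V(G), e, f ∋ i)`. -/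
abbrev PairSpace (G : Graph α β) : Type (max u v) :=
  EuclideanSpace ℝ G.PairIndex

section
variable (G : Graph α β) [Fintype E(G)]

/-- The subspace `V*`. -/
def VStar : Submodule ℝ G.PairSpace where
  carrier := {z | ∀ (e : E(G)) (i j : V(G)) (h : G.IsLink e.1 i.1 j.1),
    z ⟨i, G.edgeAtLeft h, G.edgeAtLeft h⟩ = z ⟨j, G.edgeAtRight h, G.edgeAtRight h⟩ ∧
    ∑ f : G.EdgesAt i, z ⟨i, G.edgeAtLeft h, f⟩ = ∑ f : G.EdgesAt j, z ⟨j, G.edgeAtRight h, f⟩ ∧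
    ∑ f : G.EdgesAt i, z ⟨i, f, G.edgeAtLeft h⟩ = ∑ f : G.EdgesAt j, z ⟨j, f, G.edgeAtRight h⟩}
  zero_mem' := by intro e i j h; simp
  add_mem' := by
    intro a b ha hb e i j h
    obtain ⟨a1, a2, a3⟩ := ha e i j h
    obtain ⟨b1, b2, b3⟩ := hb e i j h
    simp only [PiLp.add_apply, Finset.sum_add_distrib]
    exact ⟨by rw [a1, b1], by rw [a2, b2], by rw [a3, b3]⟩
  smul_mem' := by
    intro c a ha e i j h
    obtain ⟨a1, a2, a3⟩ := ha e i j h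
    simp only [PiLp.smul_apply, smul_eq_mul, ← Finset.mul_sum]
    exact ⟨by rw [a1], by rw [a2], by rw [a3]⟩

/-- The subspace `V` of `V*` where all the sums `∑_{e,f ∋ i} x_{ief}` vanish. -/
def pairV : Submodule ℝ G.PairSpace where
  carrier := {x | x ∈ G.VStar ∧ ∀ i : V(G), ∑ e : G.EdgesAt i, ∑ f : G.EdgesAt i, x ⟨i, e, f⟩ = 0}
  zero_mem' := ⟨G.VStar.zero_mem, by simp⟩
  add_mem' := by
    rintro a b ⟨ha, ha'⟩ ⟨hb, hb'⟩
    refine ⟨G.VStar.add_mem ha hb, fun i => ?_⟩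
    simp only [PiLp.add_apply, Finset.sum_add_distrib]
    rw [ha', hb', add_zero]
  smul_mem' := by
    rintro c a ⟨ha, ha'⟩
    refine ⟨G.VStar.smul_mem c ha, fun i => ?_⟩
    simp only [PiLp.smul_apply, smul_eq_mul, ← Finset.mul_sum]
    rw [ha', mul_zero]

/-- The affine space `W`, where all the sums `∑_{e,f ∋ i} x_{ief}` are `1`. -/
def pairW : Set G.PairSpace :=
  {x | x ∈ G.VStar ∧ ∀ i : V(G), ∑ e : G.EdgesAt i, ∑ f : G.EdgesAt i, x ⟨i, e, f⟩ = 1}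

/-- The cube `K = [0,1]^{gd²}`. -/
def pairK : Set G.PairSpace :=
  {x | ∀ t, x t ∈ Set.Icc (0 : ℝ) 1}

/-- The lattice `ℒ⁽²⁾_G` of the integer vectors in `V`. -/
def pairLattice : Submodule ℤ G.PairSpace where
  carrier := {ν | ν ∈ G.pairV ∧ ∀ t, ∃ m : ℤ, ν t = m}
  zero_mem' := ⟨G.pairV.zero_mem, fun _ => ⟨0, by simp⟩⟩
  add_mem' := by
    rintro a b ⟨ha, ha'⟩ ⟨hb, hb'⟩
    refine ⟨G.pairV.add_mem ha hb, fun t => ?_⟩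
    obtain ⟨m, hm⟩ := ha' t
    obtain ⟨k, hk⟩ := hb' t
    exact ⟨m + k, by simp [hm, hk]⟩
  smul_mem' := by
    rintro c a ⟨ha, ha'⟩
    refine ⟨?_, fun t => ?_⟩
    · rw [← Int.cast_smul_eq_zsmul ℝ c a]
      exact G.pairV.smul_mem _ ha
    · obtain ⟨m, hm⟩ := ha' t
      exact ⟨c * m, by rw [← Int.cast_smul_eq_zsmul ℝ c a]; simp [hm]⟩

open scoped Classical in
/-- `σ_{ie} = ∑_{f ∋ i, f ≠ e} x_{ief}`. -/
noncomputable def pairSigma (x : G.PairSpace) (i : V(G)) (e : G.EdgesAt i) : ℝ :=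
  ∑ f : G.EdgesAt i with f ≠ e, x ⟨i, e, f⟩

open scoped Classical in
/-- `τ_{ie} = ∑_{f ∋ i, f ≠ e} x_{ife}`. -/
noncomputable def pairTau (x : G.PairSpace) (i : V(G)) (e : G.EdgesAt i) : ℝ :=
  ∑ f : G.EdgesAt i with f ≠ e, x ⟨i, f, e⟩

open scoped Classical in
/-- `γ_{ie} = ∑_{f, f' ∋ i; f, f' ≠ e} x_{iff'}`. -/
noncomputable def pairGamma (x : G.PairSpace) (i : V(G)) (e : G.EdgesAt i) : ℝ :=
  ∑ f : G.EdgesAt i with f ≠ e, ∑ f' : G.EdgesAt i with f' ≠ e, x ⟨i, f, f'⟩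

end

open scoped Classical in
/-- The exponent `φ` of the second moment (with `0 ln 0 = 0`). -/
noncomputable def pairPhi (G : Graph α β) [Fintype V(G)] [Fintype E(G)] (x : G.PairSpace) : ℝ :=
  (1 / 2 : ℝ) * ∑ i : V(G), ∑ e : G.EdgesAt i,
    (G.pairSigma x i e * Real.log (G.pairSigma x i e)
      + G.pairTau x i e * Real.log (G.pairTau x i e)
      + G.pairGamma x i e * Real.log (G.pairGamma x i e)
      - x ⟨i, e, e⟩ * Real.log (x ⟨i, e, e⟩)
      - 2 * ∑ f : G.EdgesAt i with f ≠ e, x ⟨i, e, f⟩ * Real.log (x ⟨i, e, f⟩))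

/-- The point `x⁰ = (1/d², …, 1/d²)`. -/
noncomputable def pairPoint (G : Graph α β) (d : ℕ) : G.PairSpace :=
  WithLp.toLp 2 fun _ => 1 / (d : ℝ) ^ 2

end Graph

/-! ### Determinants of lattices and of bilinear forms on subspaces, unique maxima -/

/-- `f` has a unique maximum on `S`, attained at `x₀`. -/
def HasUniqueMaxOnAt {X : Type*} (f : X → ℝ) (S : Set X) (x₀ : X) : Prop :=
  x₀ ∈ S ∧ ∀ x ∈ S, x ≠ x₀ → f x < f x₀

section
variable {F : Type*} [NormedAddCommGroup F] [InnerProductSpace ℝ F] [FiniteDimensional ℝ F]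

/-- The determinant (covolume) of a lattice `L`: its covolume in the real subspace spanned by `L`,
with respect to the Euclidean (Lebesgue) measure of that subspace, i.e. the Haar measure that gives
measure `1` to the unit cube on an orthonormal basis. -/
noncomputable def latticeDet (L : Submodule ℤ F) : ℝ :=
  letI : MeasurableSpace (Submodule.span ℝ (L : Set F)) := borel _
  haveI : BorelSpace (Submodule.span ℝ (L : Set F)) := ⟨rfl⟩
  ZLattice.covolume (ZLattice.comap ℝ L (Submodule.span ℝ (L : Set F)).subtype)
    (stdOrthonormalBasis ℝ (Submodule.span ℝ (L : Set F))).toBasis.addHaar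

/-- The determinant of a bilinear form restricted to a subspace `S`: the determinant of its matrix
in an orthonormal basis of `S` (it does not depend on the choice of that basis). -/
noncomputable def bilinDetOn (B : F →L[ℝ] F →L[ℝ] ℝ) (S : Submodule ℝ F) : ℝ :=
  (Matrix.of fun i j =>
    B (stdOrthonormalBasis ℝ S i : F) (stdOrthonormalBasis ℝ S j : F)).det

/-- The Hessian `D²φ(x)`, as a bilinear form. -/
noncomputable def hessian (φ : F → ℝ) (x : F) : F →L[ℝ] F →L[ℝ] ℝ :=
  fderiv ℝ (fderiv ℝ φ) x

end

namespace Graph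

/-- `det(-H|_V)` with `H = D²φ(x⁰)`. -/
noncomputable def detNegHessian {α β : Type*} (G : Graph α β) [Fintype V(G)] [Fintype E(G)]
    (d : ℕ) : ℝ :=
  bilinDetOn (-hessian G.pairPhi (G.pairPoint d)) G.pairV

/-- The asymptotic expression for `𝔼 (X_G ^ 2)`: here `g` is the number of vertices and `r` the
rank of the lattice `ℒ⁽²⁾_G`. -/
noncomputable def secondMomentMainTerm {α β : Type*} (G : Graph α β) [Fintype V(G)]
    [Fintype E(G)] (d n : ℕ) : ℝ :=
  let g : ℕ := Fintype.card V(G)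
  let r : ℕ := Module.finrank ℤ G.pairLattice
  (((d : ℝ) - 1) * (d : ℝ) ^ (d - 2)) ^ (d * g)
      / (latticeDet G.pairLattice * Real.sqrt (G.detNegHessian d))
    * (2 * Real.pi * (n : ℝ)) ^
        ((r : ℝ) / 2 + (g : ℝ) / 2 + 3 * (d : ℝ) * (g : ℝ) / 4 - (d : ℝ) ^ 2 * (g : ℝ) / 2)
    * (((d : ℝ) - 1) ^ (d - 1) / (d : ℝ) ^ (d - 2)) ^ (g * n)

end Graph

/-! A perfect matching of the lift is the same as a choice, at every vertex above `i`, of an edge of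
`G` at `i`, with choices at the two ends of each lifted edge agreeing. A pair of matchings thus
gives each vertex of the lift a type `(e, f)`; let `z` count the types in each layer. For fixed
types the permutations of different edges are constrained independently. The permutation of `e` must
respect four colors (in both matchings, only in the first, only in the second, in neither), so there
are as many of them as the product of the factorials of the color counts, provided the counts agree
at both ends, and none otherwise. This writes the second moment as a finite sum over balanced type
vectors (`secondMoment_eq_sum`). Sharing every edge factor equally between its two ends makes each
term a product of real powers of factorials of linear forms in `z`, times a power of `n!`
(`typeVector_term_eq`). The balanced vectors of total `n` per layer are the nonnegative points of a
translate of the lattice in `V` (`secondMoment_eq_tsum`).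

The rest of the general case is Laplace's method, `tendsto_factorialTerm_sum`. By Stirling a term is
`exp (n φ(z / n))`, a power of `2πn`, and a factor converging near the maximum. A nondegenerate
unique maximum gives `φ(y) ≤ φ(x⁰) - c ‖y - x⁰‖²` on the whole polytope
(`exists_entropySum_quadratic_decay`). This dominates the terms by a Gaussian at scale `√n`,
including those near the boundary, where Stirling is only crude (`exists_logStirlingRatio_sum_le`).
A lattice sum is the integral of a step function, so dominated convergence yields a Gaussian
integral divided by the covolume (`tendsto_lattice_sum`). Evaluating the weights and forms at `x⁰`
produces the constants.

For `d = 3` the function `φ` is a sum of vertex contributions, each of the form `∑ x_ef (log p_ef -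
log x_ef)` with `p_ef` a product of three square roots of linear forms. Gibbs' inequality bounds it
by the logarithm of `Z = ∑ p_ef`. Here `Z` is a symmetric trilinear form evaluated at three unit
vectors of `ℝ⁴`, one per edge, with entries `√γ, √σ, √τ, √x_ee`. Polarization, Cauchy–Schwarz and an
explicit quartic inequality give `Z ≤ 4/3` (`triForm_le`), and tracking equality leaves only the
uniform point (`entropy_three_le`). Definiteness of the Hessian is a sum-of-squares identity
(`hessian_three_eq`). -/

section

open Filter Topology MeasureTheory Module

/-! ### Gaussian integrals of quadratic forms -/

section GaussianIntegral

variable {E : Type*} [NormedAddCommGroup E] [InnerProductSpace ℝ E] [FiniteDimensional ℝ E]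
  [MeasurableSpace E] [BorelSpace E]

open scoped MatrixOrder in
/-- The Gaussian integral of a positive definite bilinear form. -/
theorem integral_exp_neg_half_bilin (B : E → E → ℝ) {ι : Type*} [Fintype ι] [DecidableEq ι]
    (b : OrthonormalBasis ι ℝ E) (A : Matrix ι ι ℝ) (hA : A.PosDef)
    (hB : ∀ v, B v v = b.repr v ⬝ᵥ A.mulVec (b.repr v)) :
    ∫ v, Real.exp (-(1 / 2) * B v v) =
      (2 * Real.pi) ^ (finrank ℝ E / 2 : ℝ) / Real.sqrt A.det := by
  -- With `A = Sᵀ S` the form is the pullback of the squared norm along the map of matrix `S`; the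
  -- change of variables costs `|det S| = √(det A)`.
  obtain ⟨S, hS⟩ := CStarAlgebra.nonneg_iff_eq_star_mul_self.mp hA.posSemidef.nonneg
  have hStr : star S = S.transpose := by
    ext i j; simp [Matrix.star_apply]
  rw [hStr] at hS
  have hdet : A.det = S.det ^ 2 := by rw [hS, Matrix.det_mul, Matrix.det_transpose, sq]
  have hS0 : S.det ≠ 0 := by
    intro h
    have := hA.det_pos
    rw [hdet, h] at this
    simp at this
  let f : E →ₗ[ℝ] E := Matrix.toLin b.toBasis b.toBasis S
  have hf : LinearMap.det f = S.det := by
    simp [f, LinearMap.det_toLin]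
  have hnorm : ∀ v, B v v = ‖f v‖ ^ 2 := by
    intro v
    have h1 : ∀ i, b.repr (f v) i = S.mulVec (b.repr v) i := by
      intro i
      have := congrFun (LinearMap.toMatrix_mulVec_repr b.toBasis b.toBasis f v) i
      simp only [f, LinearMap.toMatrix_toLin] at this
      rw [← OrthonormalBasis.coe_toBasis_repr_apply, ← this]
      congr 2
    rw [hB, hS, ← b.repr.norm_map (f v), EuclideanSpace.norm_sq_eq, ← Matrix.mulVec_mulVec,
      Matrix.dotProduct_mulVec, Matrix.vecMul_transpose]
    simp only [dotProduct, h1, Real.norm_eq_abs, sq_abs]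
    exact Finset.sum_congr rfl fun _ _ => (sq _).symm
  have hmap := Measure.map_linearMap_addHaar_eq_smul_addHaar (μ := (volume : Measure E))
    (f := f) (by rw [hf]; exact hS0)
  have hfc : Measurable f := (LinearMap.continuous_of_finiteDimensional f).measurable
  have key : ∫ v, Real.exp (-(1 / 2) * B v v) =
      |S.det|⁻¹ * ∫ v : E, Real.exp (-(1 / 2) * ‖v‖ ^ 2) := by
    simp_rw [hnorm]
    have h2 := integral_map (μ := (volume : Measure E)) (φ := f) hfc.aemeasurable
      (f := fun v => Real.exp (-(1 / 2) * ‖v‖ ^ 2)) (by fun_prop)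
    rw [← h2, hmap, integral_smul_measure, hf]
    rw [ENNReal.toReal_ofReal (abs_nonneg _), abs_inv, smul_eq_mul]
  rw [key, GaussianFourier.integral_rexp_neg_mul_sq_norm (by norm_num), hdet, Real.sqrt_sq_eq_abs]
  rw [show Real.pi / (1 / 2) = 2 * Real.pi by ring]
  exact (mul_comm _ _).trans (div_eq_mul_inv _ _).symm

end GaussianIntegral

/-! ### Riemann sums over translated lattices -/

section LatticeSum

variable {E : Type*} [NormedAddCommGroup E] [InnerProductSpace ℝ E] [FiniteDimensional ℝ E]
  [MeasurableSpace E] [BorelSpace E]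

theorem ZSpan.measurable_floor {ι : Type*} [Fintype ι] (b : Basis ι ℝ E) :
    Measurable fun x => (ZSpan.floor b x : E) := by
  have : (fun x => (ZSpan.floor b x : E)) =
      fun x => ∑ i, ((⌊b.repr x i⌋ : ℤ) : ℝ) • b i := by
    funext x
    simp [ZSpan.floor, Basis.restrictScalars_apply, Int.cast_smul_eq_zsmul]
  rw [this]
  refine Finset.measurable_sum _ fun i _ => ?_
  have h1 : Measurable fun x => b.repr x i := by
    have : Continuous (b.coord i) := LinearMap.continuous_of_finiteDimensional _
    exact this.measurable
  have h2 : Measurable fun x => ((⌊b.repr x i⌋ : ℤ) : ℝ) :=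
    (measurable_from_top (f := fun k : ℤ => (k : ℝ))).comp (Int.measurable_floor.comp h1)
  exact h2.smul_const _

/-- A sum over a lattice is the integral of a step function. -/
theorem integral_comp_floor_eq_tsum (Λ : Submodule ℤ E) [DiscreteTopology Λ] [IsZLattice ℝ Λ]
    {ι : Type*} [Fintype ι] (b : Basis ι ℤ Λ) (F : E → ℝ)
    (hF : Integrable fun x => F (ZSpan.floor (b.ofZLatticeBasis ℝ) x)) :
    ∫ x, F (ZSpan.floor (b.ofZLatticeBasis ℝ) x) =
      ZLattice.covolume Λ * ∑' v : Λ, F v := by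
  have hD := ZLattice.isAddFundamentalDomain b (volume : Measure E)
  have : MeasurableVAdd Λ E := (inferInstance : MeasurableVAdd Λ.toAddSubgroup E)
  have : VAddInvariantMeasure Λ E volume :=
    (inferInstance : VAddInvariantMeasure Λ.toAddSubgroup E volume)
  -- The space is tiled by lattice translates of the fundamental domain, and on the translate by `v`
  -- the floor is constantly `v`.
  rw [hD.integral_eq_tsum'' _ hF, ZLattice.covolume_eq_measure_fundamentalDomain Λ volume hD,
    ← tsum_mul_left]
  refine tsum_congr fun v => ?_
  have hmeas : MeasurableSet (ZSpan.fundamentalDomain (b.ofZLatticeBasis ℝ)) :=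
    ZSpan.fundamentalDomain_measurableSet _
  rw [setIntegral_congr_fun (g := fun _ => F v) hmeas]
  · simp
  · intro x hx
    have hx0 := (ZSpan.fract_eq_self (b := b.ofZLatticeBasis ℝ)).2 hx
    have hv : (v : E) ∈ Submodule.span ℤ (Set.range (b.ofZLatticeBasis ℝ)) := by
      rw [b.ofZLatticeBasis_span ℝ]; exact v.2
    have h1 := ZSpan.fract_zSpan_add (b.ofZLatticeBasis ℝ) x hv
    rw [hx0, ZSpan.fract_apply] at h1
    have h2 : (ZSpan.floor (b.ofZLatticeBasis ℝ) (v + x) : E) = v := by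
      rw [sub_eq_iff_eq_add] at h1
      exact add_right_cancel (a := (_ : E)) (b := x) (by rw [add_comm, ← h1])
    show F (ZSpan.floor (b.ofZLatticeBasis ℝ) (v +ᵥ x)) = F v
    rw [show v +ᵥ x = (v : E) + x from rfl, h2]

theorem integrable_exp_neg_mul_sq_norm {c : ℝ} (hc : 0 < c) :
    Integrable fun v : E => Real.exp (-c * ‖v‖ ^ 2) := by
  have h := GaussianFourier.integrable_cexp_neg_mul_sq_norm_add (V := E) (b := (c : ℂ))
    (by simpa using hc) 0 0
  have h2 := h.re
  refine h2.congr (Filter.Eventually.of_forall fun v => ?_)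
  simp only [zero_mul, add_zero]
  rw [show (-(c : ℂ) * (‖v‖ : ℂ) ^ 2) = ((-c * ‖v‖ ^ 2 : ℝ) : ℂ) by push_cast; ring]
  exact Complex.exp_ofReal_re _

/-- Laplace's method for sums over translates of a lattice. -/
theorem tendsto_lattice_sum (Λ : Submodule ℤ E) [DiscreteTopology Λ] [IsZLattice ℝ Λ]
    (l : Filter ℕ) [l.IsCountablyGenerated] (hl : l ≤ atTop) (p : ℕ → E) (f : ℕ → E → ℝ) (q : E → ℝ)
    {C c : ℝ} (hc : 0 < c)
    (hdom : ∀ᶠ n in l, ∀ v ∈ Λ, |f n (p n + v)| ≤ C * Real.exp (-c * (‖p n + v‖ ^ 2 / n)))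
    (hlim : ∀ (y : E) (v : ℕ → E), (∀ n, v n - p n ∈ Λ) →
      Tendsto (fun n : ℕ => (Real.sqrt n)⁻¹ • v n) l (𝓝 y) →
      Tendsto (fun n => f n (v n)) l (𝓝 (q y))) :
    Tendsto (fun n : ℕ => (n : ℝ) ^ (-(finrank ℝ E / 2 : ℝ)) * ∑' v : Λ, f n (p n + v)) l
      (𝓝 ((∫ y, q y) / ZLattice.covolume Λ)) := by
  let b := Free.chooseBasis ℤ Λ
  let b' := b.ofZLatticeBasis ℝ
  let D : ℝ := ∑ i, ‖b' i‖
  have hD : ∀ x, ‖ZSpan.fract b' x‖ ≤ D := ZSpan.norm_fract_le b'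
  have hD0 : 0 ≤ D := Finset.sum_nonneg fun _ _ => norm_nonneg _
  -- `w n y` rounds `√n y` to a point of the coset `p n + Λ`, with error at most `D`. The integral
  -- of `f n (w n y)` over `y` is the normalized sum.
  let w : ℕ → E → E := fun n y => p n + (ZSpan.floor b' (Real.sqrt n • y - p n) : E)
  have hfl : ∀ x, (ZSpan.floor b' x : E) ∈ Λ := by
    intro x
    exact (b.ofZLatticeBasis_span ℝ).le (ZSpan.floor b' x).2
  have hw : ∀ n y, w n y = Real.sqrt n • y - ZSpan.fract b' (Real.sqrt n • y - p n) := by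
    intro n y
    simp only [w, ZSpan.fract_apply]
    abel
  have hpos : ∀ᶠ n in l, 0 < n := hl (eventually_gt_atTop 0)
  have hC : ∀ᶠ n in l, 0 ≤ C := by
    filter_upwards [hdom] with n hn
    have := (abs_nonneg _).trans (hn 0 Λ.zero_mem)
    exact nonneg_of_mul_nonneg_left this (Real.exp_pos _)
  -- the dominating function
  have hbound : ∀ n, 0 < n → ∀ y, Real.exp (-c * (‖w n y‖ ^ 2 / n)) ≤
      Real.exp (c * D ^ 2) * Real.exp (-(c / 2) * ‖y‖ ^ 2) := by
    intro n hn y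
    have hn' : (1 : ℝ) ≤ n := by exact_mod_cast hn
    rw [← Real.exp_add, Real.exp_le_exp]
    have h1 : Real.sqrt n * ‖y‖ ≤ ‖w n y‖ + D := by
      have : Real.sqrt n • y = w n y + ZSpan.fract b' (Real.sqrt n • y - p n) := by rw [hw]; abel
      calc Real.sqrt n * ‖y‖ = ‖Real.sqrt n • y‖ := by
            rw [norm_smul, Real.norm_of_nonneg (Real.sqrt_nonneg _)]
        _ ≤ _ := by rw [this]; exact (norm_add_le _ _).trans (by gcongr; exact hD _)
    -- Squaring the triangle inequality costs a factor 2, which is why the Gaussian rate drops from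
    -- `c` to `c / 2`; the rounding error goes into the constant `exp (c D²)`.
    have h2 : n * ‖y‖ ^ 2 ≤ 2 * ‖w n y‖ ^ 2 + 2 * D ^ 2 := by
      have h3 : (Real.sqrt n * ‖y‖) ^ 2 ≤ (‖w n y‖ + D) ^ 2 := by gcongr
      rw [mul_pow, Real.sq_sqrt (by positivity)] at h3
      nlinarith [sq_nonneg (‖w n y‖ - D)]
    have h4 : ‖y‖ ^ 2 ≤ 2 * (‖w n y‖ ^ 2 / n) + 2 * D ^ 2 := by
      have : ‖y‖ ^ 2 ≤ (2 * ‖w n y‖ ^ 2 + 2 * D ^ 2) / n := by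
        rw [le_div_iff₀ (by positivity)]; linarith
      calc _ ≤ _ := this
        _ = 2 * (‖w n y‖ ^ 2 / n) + 2 * D ^ 2 / n := by ring
        _ ≤ _ := by gcongr; exact div_le_self (by positivity) hn'
    nlinarith
  have hGmeas : ∀ n, Measurable fun y => f n (w n y) := by
    intro n
    have h1 : Measurable fun y => (ZSpan.floor b' (Real.sqrt n • y - p n)) := by
      have h0 : Measurable fun x => (ZSpan.floor b' x) :=
        Measurable.subtype_mk (ZSpan.measurable_floor b')
      exact h0.comp (by fun_prop)
    -- Nothing is assumed about the regularity of `f n`: the composite is measurable because it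
    -- factors through a countable lattice.
    have : Countable (Submodule.span ℤ (Set.range b')) := by
      rw [b.ofZLatticeBasis_span ℝ]; infer_instance
    have h2 : Measurable fun v : Submodule.span ℤ (Set.range b') => f n (p n + v) :=
      measurable_of_countable _
    exact h2.comp h1
  have hdom' : ∀ᶠ n in l, ∀ y, ‖f n (w n y)‖ ≤
      C * Real.exp (c * D ^ 2) * Real.exp (-(c / 2) * ‖y‖ ^ 2) := by
    filter_upwards [hdom, hpos, hC] with n h1 h2 h3 y
    rw [mul_assoc]
    exact (h1 _ (hfl _)).trans (mul_le_mul_of_nonneg_left (hbound n h2 y) h3)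
  have h_int : Integrable fun y : E =>
      C * Real.exp (c * D ^ 2) * Real.exp (-(c / 2) * ‖y‖ ^ 2) :=
    (integrable_exp_neg_mul_sq_norm (by positivity)).const_mul _
  have hconv : Tendsto (fun n => ∫ y, f n (w n y)) l (𝓝 (∫ y, q y)) := by
    refine tendsto_integral_filter_of_dominated_convergence _
      (Eventually.of_forall fun n => (hGmeas n).aestronglyMeasurable)
      (hdom'.mono fun n hn => Eventually.of_forall hn) h_int (Eventually.of_forall fun y => ?_)
    refine hlim y (fun n => w n y) (fun n => ?_) ?_
    · simp only [w, add_sub_cancel_left]; exact hfl _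
    · have hsq : Tendsto (fun n : ℕ => (Real.sqrt n)⁻¹) l (𝓝 0) :=
        (tendsto_inv_atTop_zero.comp
          (Real.tendsto_sqrt_atTop.comp tendsto_natCast_atTop_atTop)).mono_left hl
      have h0 : Tendsto (fun n : ℕ =>
          (Real.sqrt n)⁻¹ • ZSpan.fract b' (Real.sqrt n • y - p n)) l (𝓝 0) := by
        rw [tendsto_zero_iff_norm_tendsto_zero]
        refine squeeze_zero (g := fun n : ℕ => (Real.sqrt n)⁻¹ * D) (fun _ => norm_nonneg _)
          (fun n => ?_) (by simpa using hsq.mul_const D)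
        rw [norm_smul, Real.norm_of_nonneg (by positivity)]
        gcongr
        exact hD _
      have h1 : Tendsto (fun n : ℕ =>
          y - (Real.sqrt n)⁻¹ • ZSpan.fract b' (Real.sqrt n • y - p n)) l (𝓝 (y - 0)) :=
        tendsto_const_nhds.sub h0
      rw [sub_zero] at h1
      refine h1.congr' ?_
      filter_upwards [hpos] with n hn
      have : Real.sqrt n ≠ 0 := by positivity
      rw [hw, smul_sub, smul_smul, inv_mul_cancel₀ this, one_smul]
  refine (hconv.div_const (ZLattice.covolume Λ)).congr' ?_
  filter_upwards [hpos, hdom'] with n hn hb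
  have hs : Real.sqrt n ≠ 0 := by positivity
  have hi : Integrable fun y => f n (w n y) :=
    h_int.mono' (hGmeas n).aestronglyMeasurable (Eventually.of_forall hb)
  have hcomp : (fun y => f n (w n y)) =
      fun y => (fun x => f n (p n + (ZSpan.floor b' (x - p n) : E))) (Real.sqrt n • y) := rfl
  rw [hcomp] at hi
  have hi2 : Integrable fun x => f n (p n + (ZSpan.floor b' (x - p n) : E)) :=
    (integrable_comp_smul_iff volume _ hs).1 hi
  have hi3 : Integrable fun x => f n (p n + (ZSpan.floor b' x : E)) := by
    have := hi2.comp_add_right (p n)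
    simpa using this
  -- Dilating by `√n` produces the power `n ^ (-dim / 2)`, and translation invariance removes the
  -- offset `p n` inside the floor.
  have e1 : ∫ y, f n (w n y) =
      ((Real.sqrt n) ^ finrank ℝ E)⁻¹ * ∫ x, f n (p n + (ZSpan.floor b' x : E)) := by
    have h := Measure.integral_comp_smul_of_nonneg volume
      (fun x => f n (p n + (ZSpan.floor b' (x - p n) : E))) (Real.sqrt n) (hR := Real.sqrt_nonneg _)
    refine h.trans ?_
    rw [smul_eq_mul]
    congr 1
    exact integral_sub_right_eq_self (fun x => f n (p n + (ZSpan.floor b' x : E))) (p n)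
  rw [e1, integral_comp_floor_eq_tsum Λ b (fun v => f n (p n + v)) hi3]
  have hcov := ZLattice.covolume_ne_zero Λ volume
  have e2 : ((Real.sqrt n) ^ finrank ℝ E)⁻¹ = (n : ℝ) ^ (-(finrank ℝ E / 2 : ℝ)) := by
    rw [Real.rpow_neg (by positivity), Real.sqrt_eq_rpow, ← Real.rpow_natCast,
      ← Real.rpow_mul (by positivity)]
    congr 2; ring
  rw [e2]
  field_simp

end LatticeSum

/-! ### Stirling's formula on a logarithmic scale, with uniform bounds -/

section Stirling

open Nat in
/-- The ratio of `m!` to `(m / e) ^ m`, on a logarithmic scale. -/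
noncomputable def logStirlingRatio (m : ℕ) : ℝ :=
  Real.log (m ! : ℝ) - (m * Real.log m - m)

open Nat in
theorem log_factorial_eq (m : ℕ) :
    Real.log (m ! : ℝ) = m * Real.log m - m + logStirlingRatio m := by
  rw [logStirlingRatio]; ring

theorem logStirlingRatio_eq {m : ℕ} (hm : m ≠ 0) :
    logStirlingRatio m = Real.log (Stirling.stirlingSeq m) + 1 / 2 * Real.log (2 * m) := by
  have hm' : (m : ℝ) ≠ 0 := by exact_mod_cast hm
  rw [Stirling.log_stirlingSeq_formula, logStirlingRatio, Real.log_div hm' (Real.exp_ne_zero _),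
    Real.log_exp]
  ring

/-- The Stirling sequence decreases to its limit `√π`, so the asymptotic value is a lower bound. -/
theorem log_le_logStirlingRatio {m : ℕ} (hm : m ≠ 0) :
    1 / 2 * Real.log (2 * Real.pi * m) ≤ logStirlingRatio m := by
  have hm' : (0 : ℝ) < m := by exact_mod_cast Nat.pos_of_ne_zero hm
  rw [logStirlingRatio_eq hm]
  have h := Real.log_le_log (by positivity) (Stirling.sqrt_pi_le_stirlingSeq hm)
  rw [Real.log_sqrt (by positivity)] at h
  rw [show 2 * Real.pi * (m : ℝ) = Real.pi * (2 * m) by ring,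
    Real.log_mul (by positivity) (by positivity)]
  linarith

theorem logStirlingRatio_nonneg (m : ℕ) : 0 ≤ logStirlingRatio m := by
  rcases eq_or_ne m 0 with rfl | hm
  · simp [logStirlingRatio]
  · refine le_trans ?_ (log_le_logStirlingRatio hm)
    have hm' : (1 : ℝ) ≤ m := by exact_mod_cast Nat.one_le_iff_ne_zero.2 hm
    have := Real.pi_gt_three
    have : 0 ≤ Real.log (2 * Real.pi * m) := Real.log_nonneg (by nlinarith)
    linarith

/-- The Stirling sequence is largest at its first value `e / √2`, whose logarithm is below 1. The
bound is in terms of `n` rather than `m` so that it also covers `m = 0`, where the ratio is 0. -/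
theorem logStirlingRatio_le {m n : ℕ} (hmn : m ≤ n) (hn : 0 < n) :
    logStirlingRatio m ≤ 1 + 1 / 2 * Real.log (2 * Real.pi * n) := by
  have hn' : (1 : ℝ) ≤ n := by exact_mod_cast hn
  have hpi := Real.pi_gt_three
  have h0 : 0 ≤ Real.log (2 * Real.pi * n) := Real.log_nonneg (by nlinarith)
  rcases eq_or_ne m 0 with rfl | hm
  · simp only [logStirlingRatio, Nat.factorial_zero, Nat.cast_one, Real.log_one, Nat.cast_zero]
    linarith
  · have hm' : (1 : ℝ) ≤ m := by exact_mod_cast Nat.one_le_iff_ne_zero.2 hm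
    rw [logStirlingRatio_eq hm]
    have h1 : Stirling.stirlingSeq m ≤ Stirling.stirlingSeq 1 := by
      have := Stirling.stirlingSeq'_antitone (Nat.zero_le (m - 1))
      simpa [Nat.succ_eq_add_one, Nat.sub_add_cancel (Nat.one_le_iff_ne_zero.2 hm)] using this
    have hpos : 0 < Stirling.stirlingSeq m :=
      lt_of_lt_of_le (by positivity) (Stirling.sqrt_pi_le_stirlingSeq hm)
    have h2 := Real.log_le_log hpos h1
    rw [Stirling.stirlingSeq_one, Real.log_div (Real.exp_ne_zero _) (by positivity), Real.log_exp]
      at h2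
    have h3 : 0 ≤ Real.log (Real.sqrt 2) := Real.log_nonneg (by
      rw [Real.one_le_sqrt]; norm_num)
    have h4 : Real.log (2 * m) ≤ Real.log (2 * Real.pi * n) := by
      apply Real.log_le_log (by positivity)
      have : (m : ℝ) ≤ n := by exact_mod_cast hmn
      nlinarith
    linarith

/-- Stirling's formula for `m` comparable to `n`. -/
theorem tendsto_logStirlingRatio_sub {l : Filter ℕ} (hl : l ≤ atTop) {m : ℕ → ℕ} {t : ℝ}
    (ht : 0 < t) (hm : Tendsto (fun n => (m n : ℝ) / n) l (𝓝 t)) :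
    Tendsto (fun n : ℕ => logStirlingRatio (m n) - 1 / 2 * Real.log (2 * Real.pi * n)) l
      (𝓝 (1 / 2 * Real.log t)) := by
  have hnat : Tendsto (fun n : ℕ => (n : ℝ)) l atTop := tendsto_natCast_atTop_atTop.mono_left hl
  have hmT : Tendsto m l atTop := by
    have h1 : Tendsto (fun n => (m n : ℝ) / n * n) l atTop := hm.pos_mul_atTop ht hnat
    rw [← tendsto_natCast_atTop_iff (R := ℝ)]
    refine h1.congr' ?_
    filter_upwards [hl (eventually_gt_atTop 0)] with n hn
    have : (n : ℝ) ≠ 0 := by positivity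
    field_simp
  have h1 : Tendsto (fun n => Real.log (Stirling.stirlingSeq (m n))) l
      (𝓝 (Real.log (Real.sqrt Real.pi))) :=
    ((Real.continuousAt_log (by positivity)).tendsto.comp
      (Stirling.tendsto_stirlingSeq_sqrt_pi.comp hmT))
  have h2 : Tendsto (fun n => Real.log ((m n : ℝ) / n)) l (𝓝 (Real.log t)) :=
    (Real.continuousAt_log ht.ne').tendsto.comp hm
  have h3 := (h1.add (h2.const_mul (1 / 2))).sub_const (1 / 2 * Real.log Real.pi)
  rw [Real.log_sqrt (by positivity)] at h3
  rw [show Real.log Real.pi / 2 + 1 / 2 * Real.log t - 1 / 2 * Real.log Real.pi =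
    1 / 2 * Real.log t by ring] at h3
  refine h3.congr' ?_
  filter_upwards [hl (eventually_gt_atTop 0), hmT.eventually_gt_atTop 0] with n hn hmn
  have hn' : (n : ℝ) ≠ 0 := by positivity
  have hm' : (m n : ℝ) ≠ 0 := by positivity
  rw [logStirlingRatio_eq hmn.ne', Real.log_div hm' hn', Real.log_mul (by norm_num) hm',
    Real.log_mul (by positivity) hn', Real.log_mul (by norm_num) (by positivity)]
  ring

/-- Two-sided Stirling bound for `m` comparable to `n`. -/
theorem abs_logStirlingRatio_sub_le {m n : ℕ} {t : ℝ} (ht : 0 < t) (hn : 0 < n) (hmn : m ≤ n)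
    (htm : t * n ≤ m) :
    |logStirlingRatio m - 1 / 2 * Real.log (2 * Real.pi * n)| ≤ 1 + |Real.log t| := by
  have hn' : (0 : ℝ) < n := by exact_mod_cast hn
  have hm : m ≠ 0 := by
    rintro rfl
    have : 0 < t * n := by positivity
    simp at htm; linarith
  have h1 := log_le_logStirlingRatio hm
  have h2 := logStirlingRatio_le hmn hn
  have h3 : Real.log (2 * Real.pi * n) + Real.log t ≤ Real.log (2 * Real.pi * m) := by
    rw [← Real.log_mul (by positivity) (by positivity)]
    apply Real.log_le_log (by positivity)
    have := mul_le_mul_of_nonneg_left htm (show 0 ≤ 2 * Real.pi by positivity)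
    linarith
  have h4 := neg_abs_le (Real.log t)
  have h5 := abs_nonneg (Real.log t)
  rw [abs_le]
  constructor <;> linarith

end Stirling

/-! ### Derivatives and Taylor expansion of sums of `t log t` -/

section EntropySum

variable {F : Type*} [NormedAddCommGroup F] [InnerProductSpace ℝ F]

/-- A weighted sum of terms `t log t` with `t` running over linear functionals. -/
noncomputable def entropySum {κ : Type*} [Fintype κ] (ℓ : κ → F →L[ℝ] ℝ) (w : κ → ℝ) (x : F) : ℝ :=
  ∑ k, w k * (ℓ k x * Real.log (ℓ k x))

variable {κ : Type*} [Fintype κ] (ℓ : κ → F →L[ℝ] ℝ) (w : κ → ℝ)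

theorem continuous_entropySum : Continuous (entropySum ℓ w) := by
  unfold entropySum
  exact continuous_finsetSum _ fun k _ =>
    continuous_const.mul (Real.continuous_mul_log.comp (ℓ k).continuous)

theorem hasFDerivAt_entropySum {x : F} (hx : ∀ k, ℓ k x ≠ 0) :
    HasFDerivAt (entropySum ℓ w) (∑ k, (w k * (Real.log (ℓ k x) + 1)) • ℓ k) x := by
  unfold entropySum
  refine HasFDerivAt.fun_sum fun k _ => ?_
  have h := ((Real.hasDerivAt_mul_log (hx k)).comp_hasFDerivAt x (ℓ k).hasFDerivAt).const_mul (w k)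
  rw [smul_smul] at h
  exact h

theorem hessian_entropySum {x : F} (hx : ∀ k, ℓ k x ≠ 0) (u v : F) :
    hessian (entropySum ℓ w) x u v = ∑ k, w k * (ℓ k u * ℓ k v / ℓ k x) := by
  have hev : fderiv ℝ (entropySum ℓ w) =ᶠ[𝓝 x]
      fun y => ∑ k, (w k * (Real.log (ℓ k y) + 1)) • ℓ k := by
    have : ∀ᶠ y in 𝓝 x, ∀ k, ℓ k y ≠ 0 := by
      rw [eventually_all]
      exact fun k => (ℓ k).continuous.continuousAt.eventually_ne (hx k)
    filter_upwards [this] with y hy using (hasFDerivAt_entropySum ℓ w hy).fderiv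
  have hd : HasFDerivAt (fun y => ∑ k, (w k * (Real.log (ℓ k y) + 1)) • ℓ k)
      (∑ k, (w k • ((ℓ k x)⁻¹ • ℓ k)).smulRight (ℓ k)) x := by
    refine HasFDerivAt.fun_sum fun k _ => ?_
    have h1 : HasFDerivAt (fun y => w k * (Real.log (ℓ k y) + 1)) (w k • ((ℓ k x)⁻¹ • ℓ k)) x :=
      (((ℓ k).hasFDerivAt.log (hx k)).add_const 1).const_mul (w k)
    exact h1.smul_const (ℓ k)
  rw [hessian, hev.fderiv_eq, hd.fderiv]
  simp only [_root_.sum_apply, ContinuousLinearMap.smulRight_apply,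
    _root_.smul_apply, smul_eq_mul]
  exact Finset.sum_congr rfl fun k _ => by ring

/-- Putting `s = t u` reduces this to the cubic remainder of `log (1 + u)`; the restriction `|u| ≤ 1
/ 2` keeps that remainder below `2 |u|³`. -/
theorem abs_mul_log_taylor_le {t s : ℝ} (ht : 0 < t) (hs : |s| ≤ t / 2) :
    |(t + s) * Real.log (t + s) - t * Real.log t - s * (Real.log t + 1) - s ^ 2 / (2 * t)|
      ≤ 4 * |s| ^ 3 / t ^ 2 := by
  set u := s / t with hu
  have hsu : s = t * u := by rw [hu]; field_simp
  have hu1 : |u| ≤ 1 / 2 := by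
    rw [hu, abs_div, abs_of_pos ht, div_le_iff₀ ht]; linarith
  have hu2 := abs_le.1 hu1
  have hR := Real.abs_log_sub_add_sum_range_le (x := -u) (by rw [abs_neg]; linarith) 2
  simp only [Finset.sum_range_succ, Finset.sum_range_zero, sub_neg_eq_add, abs_neg] at hR
  norm_num at hR
  set R := -u + u ^ 2 / 2 + Real.log (1 + u) with hRdef
  have hR3 : |R| ≤ 2 * |u| ^ 3 := by
    refine hR.trans ?_
    rw [div_le_iff₀ (by linarith)]
    have : 0 ≤ |u| ^ 3 := by positivity
    nlinarith
  have hlog : Real.log (t + s) = Real.log t + (u - u ^ 2 / 2 + R) := by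
    rw [hsu, show t + t * u = t * (1 + u) by ring, Real.log_mul ht.ne' (by linarith), hRdef]
    ring
  have e : (t + s) * Real.log (t + s) - t * Real.log t - s * (Real.log t + 1) - s ^ 2 / (2 * t)
      = t * ((1 + u) * R - u ^ 3 / 2) := by
    rw [hlog, hsu]; field_simp; ring
  rw [e, abs_mul, abs_of_pos ht, hsu, abs_mul, abs_of_pos ht,
    show 4 * (t * |u|) ^ 3 / t ^ 2 = t * (4 * |u| ^ 3) by field_simp]
  refine mul_le_mul_of_nonneg_left ?_ ht.le
  calc |(1 + u) * R - u ^ 3 / 2| ≤ |(1 + u) * R| + |u ^ 3 / 2| := abs_sub _ _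
    _ = |1 + u| * |R| + |u| ^ 3 / 2 := by rw [abs_mul, abs_div, abs_pow]; norm_num
    _ ≤ 3 / 2 * (2 * |u| ^ 3) + |u| ^ 3 / 2 := by
      gcongr
      rw [abs_le]; constructor <;> linarith
    _ ≤ 4 * |u| ^ 3 := by nlinarith [show 0 ≤ |u| ^ 3 by positivity]

/-- Second order Taylor expansion of an entropy sum. -/
theorem exists_entropySum_taylor {x : F} (hx : ∀ k, 0 < ℓ k x) :
    ∃ C δ : ℝ, 0 ≤ C ∧ 0 < δ ∧ ∀ v, ‖v‖ ≤ δ →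
      |entropySum ℓ w (x + v) - entropySum ℓ w x - (∑ k, w k * (Real.log (ℓ k x) + 1) * ℓ k v)
        - 1 / 2 * hessian (entropySum ℓ w) x v v| ≤ C * ‖v‖ ^ 3 := by
  -- The one-variable estimate is applied to each functional; `δ` is chosen so that every `ℓ k`
  -- moves by at most half its value at `x`.
  refine ⟨∑ k, |w k| * (4 * ‖ℓ k‖ ^ 3 / ℓ k x ^ 2), ?_⟩
  have hδ : ∃ δ > 0, ∀ k, ‖ℓ k‖ * δ ≤ ℓ k x / 2 := by
    have h : ∀ k, ∀ᶠ δ in 𝓝[>] (0 : ℝ), ‖ℓ k‖ * δ ≤ ℓ k x / 2 := by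
      intro k
      have h1 : Tendsto (fun δ => ‖ℓ k‖ * δ) (𝓝[>] (0 : ℝ)) (𝓝 (‖ℓ k‖ * 0)) :=
        (continuous_const.mul continuous_id).continuousAt.tendsto.mono_left nhdsWithin_le_nhds
      rw [mul_zero] at h1
      exact (h1.eventually_lt_const (half_pos (hx k))).mono fun _ h => h.le
    obtain ⟨δ, h1, h2⟩ := ((eventually_all.2 h).and self_mem_nhdsWithin).exists
    exact ⟨δ, h2, h1⟩
  obtain ⟨δ, hδ0, hδ⟩ := hδ
  refine ⟨δ, Finset.sum_nonneg fun k _ => by have := hx k; positivity, hδ0, fun v hv => ?_⟩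
  rw [hessian_entropySum ℓ w (fun k => (hx k).ne'), entropySum, entropySum, Finset.mul_sum,
    ← Finset.sum_sub_distrib, ← Finset.sum_sub_distrib, ← Finset.sum_sub_distrib, Finset.sum_mul]
  refine (Finset.abs_sum_le_sum_abs _ _).trans (Finset.sum_le_sum fun k _ => ?_)
  have hk := hx k
  have h1 : |ℓ k v| ≤ ‖ℓ k‖ * ‖v‖ := (ℓ k).le_opNorm v
  have h2 : |ℓ k v| ≤ ℓ k x / 2 :=
    h1.trans ((mul_le_mul_of_nonneg_left hv (norm_nonneg _)).trans (hδ k))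
  have h3 := abs_mul_log_taylor_le hk h2
  rw [map_add, show w k * ((ℓ k x + ℓ k v) * Real.log (ℓ k x + ℓ k v)) -
      w k * (ℓ k x * Real.log (ℓ k x)) - w k * (Real.log (ℓ k x) + 1) * ℓ k v -
      1 / 2 * (w k * (ℓ k v * ℓ k v / ℓ k x)) = w k * ((ℓ k x + ℓ k v) * Real.log (ℓ k x + ℓ k v)
      - ℓ k x * Real.log (ℓ k x) - ℓ k v * (Real.log (ℓ k x) + 1) - ℓ k v ^ 2 / (2 * ℓ k x)) by
    field_simp, abs_mul]
  rw [mul_assoc]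
  refine mul_le_mul_of_nonneg_left (h3.trans ?_) (abs_nonneg _)
  rw [div_mul_eq_mul_div, mul_assoc, ← mul_pow]
  gcongr

/-- At an interior maximum relative to `x + U`, the first derivative vanishes on `U`. -/
theorem entropySum_gradient_eq_zero {x : F} (hx : ∀ k, 0 < ℓ k x) (U : Submodule ℝ F)
    (hmax : ∀ᶠ v : U in 𝓝 0, entropySum ℓ w (x + v) ≤ entropySum ℓ w x) {v : F} (hv : v ∈ U) :
    ∑ k, w k * (Real.log (ℓ k x) + 1) * ℓ k v = 0 := by
  have hd : HasDerivAt (fun t : ℝ => entropySum ℓ w (x + t • v))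
      ((∑ k, (w k * (Real.log (ℓ k x) + 1)) • ℓ k) v) 0 := by
    have h1 : HasDerivAt (fun t : ℝ => x + t • v) v 0 := by
      simpa using ((hasDerivAt_id (0 : ℝ)).smul_const v).const_add x
    have h2 := hasFDerivAt_entropySum ℓ w (fun k => (hx k).ne')
    have h3 : x = x + (0 : ℝ) • v := by simp
    exact HasFDerivAt.comp_hasDerivAt (0 : ℝ) (by rwa [← h3]) h1
  have hloc : IsLocalMax (fun t : ℝ => entropySum ℓ w (x + t • v)) 0 := by
    have h1 : Tendsto (fun t : ℝ => t • (⟨v, hv⟩ : U)) (𝓝 0) (𝓝 0) := by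
      have : Continuous fun t : ℝ => t • (⟨v, hv⟩ : U) := by fun_prop
      simpa using this.tendsto 0
    filter_upwards [h1.eventually hmax] with t ht
    simpa using ht
  have := hloc.hasDerivAt_eq_zero hd
  simpa [_root_.sum_apply] using this

/-- Along the ray `t v` the first-order term vanishes, so maximality bounds `t²` times the Hessian
by a multiple of `t³`; divide by `t²` and let `t` tend to 0 from the right. -/
theorem hessian_entropySum_nonpos {x : F} (hx : ∀ k, 0 < ℓ k x) (U : Submodule ℝ F)
    (hmax : ∀ᶠ v : U in 𝓝 0, entropySum ℓ w (x + v) ≤ entropySum ℓ w x) {v : F} (hv : v ∈ U) :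
    hessian (entropySum ℓ w) x v v ≤ 0 := by
  obtain ⟨C, δ, hC, hδ, hT⟩ := exists_entropySum_taylor ℓ w hx
  have h1 : Tendsto (fun t : ℝ => t • (⟨v, hv⟩ : U)) (𝓝[>] 0) (𝓝 0) := by
    have : Continuous fun t : ℝ => t • (⟨v, hv⟩ : U) := by fun_prop
    have h := this.tendsto 0
    rw [zero_smul] at h
    exact h.mono_left nhdsWithin_le_nhds
  have h2 : ∀ᶠ t in 𝓝[>] (0 : ℝ), hessian (entropySum ℓ w) x v v ≤ t * (2 * C * ‖v‖ ^ 3) := by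
    have hsmall : ∀ᶠ t in 𝓝[>] (0 : ℝ), ‖t • (⟨v, hv⟩ : U)‖ < δ := by
      have := h1.norm
      rw [norm_zero] at this
      exact this.eventually_lt_const hδ
    filter_upwards [h1.eventually hmax, hsmall, self_mem_nhdsWithin] with t ht hs ht0
    have ht0' : (0 : ℝ) < t := ht0
    have hs' : ‖t • v‖ ≤ δ := hs.le
    have hT' := hT (t • v) hs'
    rw [entropySum_gradient_eq_zero ℓ w hx U hmax (U.smul_mem t hv)] at hT'
    have ht' : entropySum ℓ w (x + t • v) ≤ entropySum ℓ w x := ht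
    have h4 := (abs_le.1 hT').1
    rw [norm_smul, Real.norm_of_nonneg ht0'.le] at h4
    simp only [map_smul, _root_.smul_apply, smul_eq_mul] at h4
    have h5 : t ^ 2 * hessian (entropySum ℓ w) x v v ≤ t ^ 2 * (t * (2 * C * ‖v‖ ^ 3)) := by
      nlinarith
    exact le_of_mul_le_mul_left h5 (by positivity)
  have h3 : Tendsto (fun t : ℝ => t * (2 * C * ‖v‖ ^ 3)) (𝓝[>] 0) (𝓝 0) := by
    have : Continuous fun t : ℝ => t * (2 * C * ‖v‖ ^ 3) := by fun_prop
    have h := this.tendsto 0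
    rw [zero_mul] at h
    exact h.mono_left nhdsWithin_le_nhds
  exact ge_of_tendsto h3 h2

end EntropySum

/-! ### Quadratic decay away from a nondegenerate maximum -/

section EntropyMaximum

variable {F : Type*} [NormedAddCommGroup F] [InnerProductSpace ℝ F] [FiniteDimensional ℝ F]
  {κ : Type*} [Fintype κ] (ℓ : κ → F →L[ℝ] ℝ) (w : κ → ℝ)

/-- The form attains its maximum on the compact unit sphere of `U`, and homogeneity spreads this
value to all vectors. -/
theorem exists_bilin_le_neg_mul_sq_norm (B : F →L[ℝ] F →L[ℝ] ℝ) (U : Submodule ℝ F)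
    (hB : ∀ v ∈ U, v ≠ 0 → B v v < 0) : ∃ c > 0, ∀ v ∈ U, B v v ≤ -c * ‖v‖ ^ 2 := by
  have hcont : Continuous fun v : F => B v v := by fun_prop
  have hcomp : IsCompact (Metric.sphere (0 : F) 1 ∩ U) :=
    (isCompact_sphere _ _).inter_right U.closed_of_finiteDimensional
  have hscale : ∀ v : F, v ≠ 0 → v ∈ U →
      (‖v‖⁻¹ • v ∈ Metric.sphere (0 : F) 1 ∩ U) ∧ B v v = ‖v‖ ^ 2 * B (‖v‖⁻¹ • v) (‖v‖⁻¹ • v) := by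
    intro v hv hvU
    have hn : ‖v‖ ≠ 0 := norm_ne_zero_iff.2 hv
    refine ⟨⟨by simp [norm_smul, hn], U.smul_mem _ hvU⟩, ?_⟩
    simp only [map_smul, _root_.smul_apply, smul_eq_mul]
    field_simp
  rcases (Metric.sphere (0 : F) 1 ∩ U).eq_empty_or_nonempty with h | h
  · refine ⟨1, one_pos, fun v hv => ?_⟩
    by_cases hv0 : v = 0
    · simp [hv0]
    · have := (hscale v hv0 hv).1
      rw [h] at this
      exact this.elim
  · obtain ⟨u, hu, hmax⟩ := hcomp.exists_isMaxOn h hcont.continuousOn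
    have hu0 : u ≠ 0 := by
      rintro rfl
      simpa using hu.1
    refine ⟨-B u u, neg_pos.2 (hB u hu.2 hu0), fun v hv => ?_⟩
    by_cases hv0 : v = 0
    · simp [hv0]
    · obtain ⟨h1, h2⟩ := hscale v hv0 hv
      have h3 : B (‖v‖⁻¹ • v) (‖v‖⁻¹ • v) ≤ B u u := hmax h1
      rw [h2, neg_neg, mul_comm]
      exact mul_le_mul_of_nonneg_right h3 (by positivity)

/-- A nondegenerate unique maximum of an entropy sum on a compact set has quadratic decay. -/
theorem exists_entropySum_quadratic_decay {x : F} (hx : ∀ k, 0 < ℓ k x) (U : Submodule ℝ F)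
    {P : Set F} (hP : IsCompact P) (hPU : ∀ y ∈ P, y - x ∈ U)
    (hnear : ∀ᶠ v : U in 𝓝 0, x + v ∈ P)
    (hmax : ∀ y ∈ P, y ≠ x → entropySum ℓ w y < entropySum ℓ w x)
    (hneg : ∀ v ∈ U, v ≠ 0 → hessian (entropySum ℓ w) x v v < 0) :
    ∃ c > 0, ∀ y ∈ P, entropySum ℓ w y ≤ entropySum ℓ w x - c * ‖y - x‖ ^ 2 := by
  have hmaxU : ∀ᶠ v : U in 𝓝 0, entropySum ℓ w (x + v) ≤ entropySum ℓ w x := by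
    filter_upwards [hnear] with v hv
    by_cases h : x + (v : F) = x
    · rw [h]
    · exact (hmax _ hv h).le
  obtain ⟨c, hc, hcB⟩ := exists_bilin_le_neg_mul_sq_norm _ U hneg
  obtain ⟨C, δ, hC, hδ, hT⟩ := exists_entropySum_taylor ℓ w hx
  -- Within this radius the cubic error is at most `c / 4` times the squared distance, half of the
  -- quadratic gain `c / 2`.
  set δ' := min δ (c / (4 * (C + 1))) with hδ'
  have hδ'0 : 0 < δ' := lt_min hδ (by positivity)
  have hclose : ∀ y ∈ P, ‖y - x‖ ≤ δ' →
      entropySum ℓ w y ≤ entropySum ℓ w x - c / 4 * ‖y - x‖ ^ 2 := by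
    intro y hy hyd
    have h1 := hT (y - x) (hyd.trans (min_le_left _ _))
    rw [entropySum_gradient_eq_zero ℓ w hx U hmaxU (hPU y hy), add_sub_cancel] at h1
    have h2 := hcB _ (hPU y hy)
    have h3 := (abs_le.1 h1).2
    have h4 : C * ‖y - x‖ ^ 3 ≤ c / 4 * ‖y - x‖ ^ 2 := by
      have h5 : ‖y - x‖ ≤ c / (4 * (C + 1)) := hyd.trans (min_le_right _ _)
      have h6 : C * ‖y - x‖ ≤ c / 4 := by
        calc C * ‖y - x‖ ≤ (C + 1) * (c / (4 * (C + 1))) := by gcongr; linarith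
          _ = c / 4 := by field_simp
      calc C * ‖y - x‖ ^ 3 = C * ‖y - x‖ * ‖y - x‖ ^ 2 := by ring
        _ ≤ _ := by gcongr
    linarith
  -- Away from `x`, compactness gives a positive gap, attained at `u`. Dividing the gap by the
  -- largest squared distance, attained at `u'`, turns it into a quadratic bound.
  have hfar : ∃ c' > 0, ∀ y ∈ P, δ' ≤ ‖y - x‖ →
      entropySum ℓ w y ≤ entropySum ℓ w x - c' * ‖y - x‖ ^ 2 := by
    have hS : IsCompact (P ∩ {y | δ' ≤ ‖y - x‖}) :=
      hP.inter_right (isClosed_le continuous_const (by fun_prop))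
    rcases (P ∩ {y | δ' ≤ ‖y - x‖}).eq_empty_or_nonempty with h | h
    · refine ⟨1, one_pos, fun y hy hyd => ?_⟩
      have : y ∈ P ∩ {y | δ' ≤ ‖y - x‖} := ⟨hy, hyd⟩
      rw [h] at this
      exact this.elim
    · obtain ⟨u, hu, humax⟩ := hS.exists_isMaxOn h (continuous_entropySum ℓ w).continuousOn
      obtain ⟨u', hu', hu'max⟩ := hS.exists_isMaxOn h
        (f := fun y => ‖y - x‖) (by fun_prop)
      have hux : u ≠ x := by
        rintro rfl
        have := hu.2
        simp at this
        linarith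
      have hlt := hmax u hu.1 hux
      have hu'pos : 0 < ‖u' - x‖ := lt_of_lt_of_le hδ'0 hu'.2
      refine ⟨(entropySum ℓ w x - entropySum ℓ w u) / ‖u' - x‖ ^ 2,
        div_pos (by linarith) (by positivity), fun y hy hyd => ?_⟩
      have h1 : entropySum ℓ w y ≤ entropySum ℓ w u := humax ⟨hy, hyd⟩
      have h2 : ‖y - x‖ ≤ ‖u' - x‖ := hu'max ⟨hy, hyd⟩
      have h3 : (entropySum ℓ w x - entropySum ℓ w u) / ‖u' - x‖ ^ 2 * ‖y - x‖ ^ 2 ≤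
          entropySum ℓ w x - entropySum ℓ w u := by
        rw [div_mul_eq_mul_div, div_le_iff₀ (by positivity)]
        have : 0 ≤ entropySum ℓ w x - entropySum ℓ w u := by linarith
        gcongr
      linarith
  obtain ⟨c', hc', hfar⟩ := hfar
  refine ⟨min (c / 4) c', lt_min (by positivity) hc', fun y hy => ?_⟩
  rcases le_total ‖y - x‖ δ' with h | h
  · have h1 := hclose y hy h
    have : min (c / 4) c' * ‖y - x‖ ^ 2 ≤ c / 4 * ‖y - x‖ ^ 2 := by
      gcongr; exact min_le_left _ _
    linarith
  · have h1 := hfar y hy h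
    have : min (c / 4) c' * ‖y - x‖ ^ 2 ≤ c' * ‖y - x‖ ^ 2 := by
      gcongr; exact min_le_right _ _
    linarith

end EntropyMaximum

/-! ### Products of powers of factorials -/

section FactorialProducts

variable {κ : Type*} [Fintype κ]

open Nat in
/-- A product of real powers of factorials, on a logarithmic scale, in terms of Stirling ratios. -/
theorem weighted_log_factorial_eq (w : κ → ℝ) (w₀ : ℝ) {n : ℕ} (hn : 0 < n) (m : κ → ℕ)
    (hw : ∑ k, w k * m k = -w₀ * n) :
    w₀ * Real.log (n ! : ℝ) + ∑ k, w k * Real.log ((m k)! : ℝ) =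
      n * ∑ k, w k * ((m k : ℝ) / n * Real.log ((m k : ℝ) / n)) +
        (w₀ * logStirlingRatio n + ∑ k, w k * logStirlingRatio (m k)) := by
  have hn' : (n : ℝ) ≠ 0 := by positivity
  -- Expressing `m log m` through `m / n` leaves terms `w k * m k * (log n - 1)`; by the balance
  -- `hw` their sum cancels the main term of `n!`.
  have h1 : ∀ k, w k * Real.log ((m k)! : ℝ) =
      n * (w k * ((m k : ℝ) / n * Real.log ((m k : ℝ) / n))) +
        (w k * m k) * (Real.log n - 1) + w k * logStirlingRatio (m k) := by
    intro k
    rw [log_factorial_eq]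
    rcases eq_or_ne (m k) 0 with h | h
    · simp [h]
    · have : (m k : ℝ) ≠ 0 := by exact_mod_cast h
      rw [Real.log_div this hn']
      field_simp
      ring
  simp_rw [h1]
  rw [Finset.sum_add_distrib, Finset.sum_add_distrib, ← Finset.mul_sum, ← Finset.sum_mul, hw,
    log_factorial_eq n]
  ring

/-- This controls the subexponential factor over the whole polytope. When every `m k` is comparable
to `n`, the two-sided Stirling bound gives the correct power of `n` up to a constant. Otherwise some
`m k` may be small or zero and the ratios are only known up to `O(log n)`; a linear term `s * n`
with `s ≥ c`, taken from the exponential decay, absorbs this loss. -/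
theorem exists_logStirlingRatio_sum_le (w : κ → ℝ) (w₀ : ℝ) {t : κ → ℝ} (ht : ∀ k, 0 < t k)
    {c : ℝ} (hc : 0 < c) :
    ∃ C : ℝ, ∀ n : ℕ, 0 < n → ∀ m : κ → ℕ, (∀ k, m k ≤ n) → ∀ s : ℝ, 0 ≤ s →
      ((∀ k, t k * n ≤ m k) ∨ c ≤ s) →
      w₀ * logStirlingRatio n + ∑ k, w k * logStirlingRatio (m k) ≤
        C + (w₀ + ∑ k, w k) / 2 * Real.log (2 * Real.pi * n) + s * n := by
  set A := |w₀| + ∑ k, |w k| with hA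
  have hA0 : 0 ≤ A := by positivity
  obtain ⟨ε, hε, hεc⟩ : ∃ ε > 0, A * ε ≤ c := ⟨c / (A + 1), by positivity, by
    rw [mul_div_assoc', div_le_iff₀ (by positivity)]; nlinarith⟩
  refine ⟨(|w₀| * (1 + |Real.log 1|) + ∑ k, |w k| * (1 + |Real.log (t k)|)) +
    A * (1 + 1 / 2 * |Real.log (ε / Real.pi)|), fun n hn m hm s hs h => ?_⟩
  have hn' : (1 : ℝ) ≤ n := by exact_mod_cast hn
  set L := 1 / 2 * Real.log (2 * Real.pi * n) with hL
  have hL0 : 0 ≤ L := by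
    have : 0 ≤ Real.log (2 * Real.pi * n) := Real.log_nonneg (by nlinarith [Real.pi_gt_three])
    positivity
  have e : w₀ * logStirlingRatio n + ∑ k, w k * logStirlingRatio (m k) =
      (w₀ * (logStirlingRatio n - L) + ∑ k, w k * (logStirlingRatio (m k) - L)) +
      (w₀ + ∑ k, w k) / 2 * Real.log (2 * Real.pi * n) := by
    simp only [mul_sub, Finset.sum_sub_distrib, ← Finset.sum_mul, hL]; ring
  rw [e]
  have key : ∀ (b₀ : ℝ) (b : κ → ℝ), |logStirlingRatio n - L| ≤ b₀ →
      (∀ k, |logStirlingRatio (m k) - L| ≤ b k) →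
      w₀ * (logStirlingRatio n - L) + ∑ k, w k * (logStirlingRatio (m k) - L) ≤
        |w₀| * b₀ + ∑ k, |w k| * b k := by
    intro b₀ b h0 h1
    refine add_le_add ?_ (Finset.sum_le_sum fun k _ => ?_)
    · exact (le_abs_self _).trans ((abs_mul _ _).le.trans (by gcongr))
    · exact (le_abs_self _).trans ((abs_mul _ _).le.trans (by gcongr; exact h1 k))
  have hlast : 0 ≤ A * (1 + 1 / 2 * |Real.log (ε / Real.pi)|) := by positivity
  have hsn : 0 ≤ s * n := by positivity
  have hfirst : 0 ≤ |w₀| * (1 + |Real.log 1|) + ∑ k, |w k| * (1 + |Real.log (t k)|) := by positivity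
  rcases h with h | h
  · have := key (1 + |Real.log 1|) (fun k => 1 + |Real.log (t k)|)
      (abs_logStirlingRatio_sub_le one_pos hn le_rfl (by simp))
      (fun k => abs_logStirlingRatio_sub_le (ht k) hn (hm k) (h k))
    linarith
  · have hb : ∀ j ≤ n, |logStirlingRatio j - L| ≤ 1 + L := by
      intro j hj
      have h1 := logStirlingRatio_nonneg j
      have h2 := logStirlingRatio_le hj hn
      rw [abs_le]
      constructor <;> linarith
    have h1 := key (1 + L) (fun _ => 1 + L) (hb n le_rfl) (fun k => hb _ (hm k))
    rw [← Finset.sum_mul, ← add_mul, ← hA] at h1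
    -- The inequality `log t ≤ t - 1` at `t = 2 ε n` makes the logarithm an arbitrarily small
    -- multiple of `n` plus a constant.
    have h2 : L ≤ ε * n + 1 / 2 * |Real.log (ε / Real.pi)| := by
      have h3 : Real.log (2 * Real.pi * n) = Real.log (2 * ε * n) - Real.log (ε / Real.pi) := by
        rw [← Real.log_div (by positivity) (by positivity)]
        congr 1
        field_simp
      have h4 : Real.log (2 * ε * n) ≤ 2 * ε * n - 1 := Real.log_le_sub_one_of_pos (by positivity)
      have h5 := neg_abs_le (Real.log (ε / Real.pi))
      rw [hL, h3]
      linarith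
    have h3 : A * (1 + L) ≤ A * (1 + 1 / 2 * |Real.log (ε / Real.pi)|) + s * n := by
      calc A * (1 + L) ≤ A * (1 + (ε * n + 1 / 2 * |Real.log (ε / Real.pi)|)) := by gcongr
        _ = A * (1 + 1 / 2 * |Real.log (ε / Real.pi)|) + A * ε * n := by ring
        _ ≤ _ := by gcongr; linarith
    linarith

end FactorialProducts

/-! ### Laplace's method for lattice sums of factorial products -/

section FactorialLatticeSum

variable {F : Type*} [NormedAddCommGroup F] [InnerProductSpace ℝ F] [FiniteDimensional ℝ F]
  {κ : Type*} [Fintype κ]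

open Nat in
/-- The product of `(n!) ^ w₀` and the factorials `(ℓ k z)! ^ w k`, for `z / n` in the set `P`. -/
noncomputable def factorialTerm (ℓ : κ → F →L[ℝ] ℝ) (w : κ → ℝ) (w₀ : ℝ) (P : Set F) (n : ℕ)
    (z : F) : ℝ :=
  {z : F | (n : ℝ)⁻¹ • z ∈ P}.indicator
    (fun z => Real.exp (w₀ * Real.log (n ! : ℝ) + ∑ k, w k * Real.log (⌊ℓ k z⌋₊ ! : ℝ))) z

/-- A positive semidefinite matrix with nonzero determinant is positive definite. At a maximum,
semidefiniteness of the negated Hessian is automatic, so a nonvanishing determinant is all that has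
to be assumed. -/
theorem bilinDetOn_posDef (B : F →L[ℝ] F →L[ℝ] ℝ) (U : Submodule ℝ F)
    (hsymm : ∀ u v, B u v = B v u) (hB : ∀ v ∈ U, 0 ≤ B v v) (hdet : bilinDetOn B U ≠ 0) :
    (Matrix.of fun i j =>
      B (stdOrthonormalBasis ℝ U i : F) (stdOrthonormalBasis ℝ U j : F)).PosDef := by
  have hpsd : (Matrix.of fun i j =>
      B (stdOrthonormalBasis ℝ U i : F) (stdOrthonormalBasis ℝ U j : F)).PosSemidef := by
    refine Matrix.PosSemidef.of_dotProduct_mulVec_nonneg ?_ fun y => ?_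
    · ext i j
      simp [hsymm]
    · have h := hB (∑ i, y i • (stdOrthonormalBasis ℝ U i : F))
        (U.sum_mem fun i _ => U.smul_mem _ (stdOrthonormalBasis ℝ U i).2)
      simp only [map_sum, map_smul, _root_.sum_apply, _root_.smul_apply, smul_eq_mul] at h
      refine h.trans_eq ?_
      simp only [dotProduct, Matrix.mulVec, Matrix.of_apply, star_trivial, Finset.mul_sum]
      rw [Finset.sum_comm]
      exact Finset.sum_congr rfl fun i _ => Finset.sum_congr rfl fun j _ => by ring
  exact hpsd.posDef_iff_det_ne_zero.2 hdet

theorem bilin_eq_dotProduct_mulVec (B : F →L[ℝ] F →L[ℝ] ℝ) (U : Submodule ℝ F) (v : U) :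
    B v v = (stdOrthonormalBasis ℝ U).repr v ⬝ᵥ (Matrix.of fun i j =>
      B (stdOrthonormalBasis ℝ U i : F) (stdOrthonormalBasis ℝ U j : F)).mulVec
        ((stdOrthonormalBasis ℝ U).repr v) := by
  have hv : (v : F) = ∑ i, (stdOrthonormalBasis ℝ U).repr v i • (stdOrthonormalBasis ℝ U i : F) := by
    conv_lhs => rw [← (stdOrthonormalBasis ℝ U).sum_repr v]
    simp
  conv_lhs => rw [hv]
  simp only [map_sum, map_smul, _root_.sum_apply, _root_.smul_apply, smul_eq_mul]
  simp only [dotProduct, Matrix.mulVec, Matrix.of_apply, Finset.mul_sum]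
  rw [Finset.sum_comm]
  exact Finset.sum_congr rfl fun i _ => Finset.sum_congr rfl fun j _ => by ring

/-- Asymptotics of a sum, over the points of a translated lattice, of products of powers of
factorials of linear functionals, when the exponential rate has a nondegenerate unique maximum. -/
theorem tendsto_factorialTerm_sum (U : Submodule ℝ F) [MeasurableSpace U] [BorelSpace U]
    (Λ : Submodule ℤ U) [DiscreteTopology Λ] [IsZLattice ℝ Λ]
    (ℓ : κ → F →L[ℝ] ℝ) (w : κ → ℝ) (w₀ : ℝ) {x : F} (hx : ∀ k, 0 < ℓ k x)
    {P : Set F} (hP : IsCompact P) (hℓP : ∀ y ∈ P, ∀ k, ℓ k y ∈ Set.Icc (0 : ℝ) 1)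
    (hPU : ∀ y ∈ P, y - x ∈ U) (hnear : ∀ᶠ v : U in 𝓝 0, x + v ∈ P)
    (hw : ∀ y ∈ P, ∑ k, w k * ℓ k y = -w₀)
    (hmax : ∀ y ∈ P, y ≠ x → entropySum ℓ w y < entropySum ℓ w x)
    (hdet : bilinDetOn (-hessian (entropySum ℓ w) x) U ≠ 0)
    {l : Filter ℕ} [l.IsCountablyGenerated] (hl : l ≤ atTop) (z : ℕ → F)
    (hz : ∀ n, z n - (n : ℝ) • x ∈ U)
    (h_int : ∀ᶠ n in l, ∀ v ∈ Λ, ∀ k, ∃ m : ℤ, ℓ k (z n + (v : F)) = m) :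
    Tendsto (fun n : ℕ => Real.exp (-(n * entropySum ℓ w x)) *
        (2 * Real.pi * n) ^ (-((w₀ + ∑ k, w k + finrank ℝ U) / 2)) *
        ∑' v : Λ, factorialTerm ℓ w w₀ P n (z n + (v : U))) l
      (𝓝 (Real.exp (∑ k, w k * (1 / 2 * Real.log (ℓ k x))) /
        (ZLattice.covolume Λ * Real.sqrt (bilinDetOn (-hessian (entropySum ℓ w) x) U)))) := by
  classical
  set φ := entropySum ℓ w with hφ
  set H := hessian φ x with hH
  have hmaxU : ∀ᶠ v : U in 𝓝 0, φ (x + v) ≤ φ x := by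
    filter_upwards [hnear] with v hv
    by_cases h : x + (v : F) = x
    · rw [h]
    · exact (hmax _ hv h).le
  have hpd := bilinDetOn_posDef (-H) U (fun u v => by
      simp only [_root_.neg_apply, hH, hφ, hessian_entropySum ℓ w (fun k => (hx k).ne')]
      congr 1
      exact Finset.sum_congr rfl fun k _ => by ring)
    (fun v hv => by simpa using hessian_entropySum_nonpos ℓ w hx U hmaxU hv) hdet
  have hneg : ∀ v ∈ U, v ≠ 0 → H v v < 0 := by
    intro v hv hv0
    have h1 := bilin_eq_dotProduct_mulVec (-H) U ⟨v, hv⟩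
    have h2 := hpd.dotProduct_mulVec_pos
      (x := (stdOrthonormalBasis ℝ U).repr ⟨v, hv⟩) (by
        intro h
        apply hv0
        have h3 : (stdOrthonormalBasis ℝ U).repr ⟨v, hv⟩ = 0 := by
          ext i; exact congrFun h i
        have h4 := (stdOrthonormalBasis ℝ U).repr.map_eq_zero_iff.1 h3
        exact congrArg Subtype.val h4)
    rw [star_trivial, ← h1] at h2
    simpa using h2
  obtain ⟨c, hc, hdecay⟩ := exists_entropySum_quadratic_decay ℓ w hx U hP hPU hnear hmax hneg
  -- a neighbourhood of the maximum where all functionals are bounded below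
  obtain ⟨δ, hδ, hδℓ⟩ : ∃ δ > 0, ∀ y, ‖y - x‖ < δ → ∀ k, ℓ k x / 2 ≤ ℓ k y := by
    have : ∀ᶠ y in 𝓝 x, ∀ k, ℓ k x / 2 ≤ ℓ k y := by
      rw [eventually_all]
      intro k
      exact ((ℓ k).continuous.continuousAt.eventually_const_lt
        (half_lt_self (hx k))).mono fun _ h => h.le
    obtain ⟨δ, hδ, h⟩ := Metric.eventually_nhds_iff.1 this
    exact ⟨δ, hδ, fun y hy => h (by rwa [dist_eq_norm])⟩
  -- Half of the decay rate pays for the Stirling ratios: beyond distance `δ` it supplies at least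
  -- `c / 2 * δ ^ 2` per unit of `n`. The other half remains for the Gaussian domination.
  obtain ⟨C, hC⟩ := exists_logStirlingRatio_sum_le w w₀ (t := fun k => ℓ k x / 2)
    (fun k => half_pos (hx k)) (c := c / 2 * δ ^ 2) (by positivity)
  let p : ℕ → U := fun n => ⟨z n - (n : ℝ) • x, hz n⟩
  let f : ℕ → U → ℝ := fun n v => Real.exp (-(n * φ x)) *
    (2 * Real.pi * n) ^ (-((w₀ + ∑ k, w k) / 2)) * factorialTerm ℓ w w₀ P n ((n : ℝ) • x + v)
  have hzv : ∀ (n : ℕ) (v : U), (n : ℝ) • x + ((p n + v : U) : F) = z n + v := by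
    intro n v
    simp [p, ← add_assoc]
  have hpos : ∀ᶠ n in l, 0 < n := hl (eventually_gt_atTop 0)
  have hlog : ∀ n : ℕ, 0 < n → (2 * Real.pi * n) ^ (-((w₀ + ∑ k, w k) / 2)) =
      Real.exp (-((w₀ + ∑ k, w k) / 2 * Real.log (2 * Real.pi * n))) := by
    intro n hn
    have : (0 : ℝ) < n := by exact_mod_cast hn
    rw [Real.rpow_def_of_pos (by positivity)]
    congr 1; ring
  -- the exact form of a term
  have hterm : ∀ n : ℕ, 0 < n → ∀ v : U, (n : ℝ)⁻¹ • ((n : ℝ) • x + (v : F)) ∈ P →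
      (∀ k, ∃ m : ℤ, ℓ k ((n : ℝ) • x + (v : F)) = m) →
      (∀ k, (⌊ℓ k ((n : ℝ) • x + (v : F))⌋₊ : ℝ) = ℓ k ((n : ℝ) • x + (v : F))) ∧
      f n v = Real.exp (n * (φ (x + (n : ℝ)⁻¹ • (v : F)) - φ x) +
        ((w₀ * logStirlingRatio n +
          ∑ k, w k * logStirlingRatio ⌊ℓ k ((n : ℝ) • x + (v : F))⌋₊) -
          (w₀ + ∑ k, w k) / 2 * Real.log (2 * Real.pi * n))) := by
    intro n hn v hvP hm
    have hn' : (n : ℝ) ≠ 0 := by positivity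
    have hy : (n : ℝ)⁻¹ • ((n : ℝ) • x + (v : F)) = x + (n : ℝ)⁻¹ • (v : F) := by
      rw [smul_add, smul_smul, inv_mul_cancel₀ hn', one_smul]
    have hsc : ∀ k, ℓ k ((n : ℝ) • x + (v : F)) = n * ℓ k (x + (n : ℝ)⁻¹ • (v : F)) := by
      intro k
      rw [← hy, map_smul, smul_eq_mul, mul_inv_cancel_left₀ hn']
    have hfloor : ∀ k, (⌊ℓ k ((n : ℝ) • x + (v : F))⌋₊ : ℝ) = ℓ k ((n : ℝ) • x + (v : F)) := by
      intro k
      obtain ⟨m, hm⟩ := hm k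
      have h0 : 0 ≤ ℓ k ((n : ℝ) • x + (v : F)) := by
        rw [hsc]
        have := (hℓP _ hvP k).1
        rw [hy] at this
        positivity
      rw [hm] at h0 ⊢
      have h0' : 0 ≤ m := by exact_mod_cast h0
      lift m to ℕ using h0'
      simp
    refine ⟨hfloor, ?_⟩
    have hwm : ∑ k, w k * ((⌊ℓ k ((n : ℝ) • x + (v : F))⌋₊ : ℕ) : ℝ) = -w₀ * n := by
      simp_rw [hfloor, hsc]
      rw [← hw _ hvP, hy, Finset.sum_mul]
      exact Finset.sum_congr rfl fun k _ => by ring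
    have hind : factorialTerm ℓ w w₀ P n ((n : ℝ) • x + (v : F)) = _ :=
      Set.indicator_of_mem (s := {z : F | (n : ℝ)⁻¹ • z ∈ P}) hvP _
    simp only [f]
    rw [hind, weighted_log_factorial_eq w w₀ hn _ hwm, hlog n hn, ← Real.exp_add, ← Real.exp_add]
    congr 1
    have hφy : ∑ k, w k * (((⌊ℓ k ((n : ℝ) • x + (v : F))⌋₊ : ℕ) : ℝ) / n *
        Real.log (((⌊ℓ k ((n : ℝ) • x + (v : F))⌋₊ : ℕ) : ℝ) / n)) =
        φ (x + (n : ℝ)⁻¹ • (v : F)) := by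
      simp_rw [hfloor, hsc, mul_div_cancel_left₀ _ hn']
      rfl
    rw [hφy]
    ring
  have hmain := tendsto_lattice_sum Λ l hl p f (fun y => Real.exp (∑ k, w k * (1 / 2 *
      Real.log (ℓ k x))) * Real.exp (-(1 / 2) * (-H) y y)) (C := Real.exp C) (c := c / 2)
    (by positivity) ?_ ?_
  · rw [integral_const_mul, integral_exp_neg_half_bilin (fun u v : U => (-H) u v)
      (stdOrthonormalBasis ℝ U) _ hpd (fun v => bilin_eq_dotProduct_mulVec (-H) U v)] at hmain
    -- The Gaussian integral contributes `(2π) ^ (dim / 2)`; dividing by it turns `n ^ (-dim / 2)`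
    -- into `(2πn) ^ (-dim / 2)`.
    have h2 := hmain.const_mul (((2 * Real.pi) ^ (finrank ℝ U / 2 : ℝ))⁻¹)
    have hpi : (2 * Real.pi) ^ (finrank ℝ U / 2 : ℝ) ≠ 0 := by positivity
    have e : ((2 * Real.pi) ^ (finrank ℝ U / 2 : ℝ))⁻¹ *
        (Real.exp (∑ k, w k * (1 / 2 * Real.log (ℓ k x))) *
        ((2 * Real.pi) ^ (finrank ℝ U / 2 : ℝ) / √(bilinDetOn (-H) U)) / ZLattice.covolume Λ) =
        Real.exp (∑ k, w k * (1 / 2 * Real.log (ℓ k x))) /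
        (ZLattice.covolume Λ * Real.sqrt (bilinDetOn (-H) U)) := by
      field_simp
    rw [← e]
    refine h2.congr' ?_
    filter_upwards [hpos] with n hn
    have hn' : (0 : ℝ) < n := by exact_mod_cast hn
    simp only [f, hzv]
    rw [tsum_mul_left, show -((w₀ + ∑ k, w k + finrank ℝ U) / 2) =
      -((w₀ + ∑ k, w k) / 2) + -(finrank ℝ U / 2 : ℝ) by ring, Real.rpow_add (by positivity),
      Real.mul_rpow (x := 2 * Real.pi) (z := -(finrank ℝ U / 2 : ℝ)) (by positivity) hn'.le,
      Real.rpow_neg (x := 2 * Real.pi) (y := (finrank ℝ U / 2 : ℝ)) (by positivity)]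
    ring
  · filter_upwards [hpos, h_int] with n hn hintn v hv
    have hn' : (0 : ℝ) < n := by exact_mod_cast hn
    by_cases hmem : (n : ℝ)⁻¹ • ((n : ℝ) • x + ((p n + v : U) : F)) ∈ P
    · have hm : ∀ k, ∃ m : ℤ, ℓ k ((n : ℝ) • x + ((p n + v : U) : F)) = m := by
        intro k
        rw [hzv]; exact hintn v hv k
      obtain ⟨hfl, hf⟩ := hterm n hn (p n + v) hmem hm
      rw [hf, abs_of_pos (Real.exp_pos _), ← Real.exp_add, Real.exp_le_exp]
      set y := x + (n : ℝ)⁻¹ • ((p n + v : U) : F) with hy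
      have hyP : y ∈ P := by
        rw [smul_add, smul_smul, inv_mul_cancel₀ hn'.ne', one_smul] at hmem
        exact hmem
      have hsc : ∀ k, ℓ k ((n : ℝ) • x + ((p n + v : U) : F)) = n * ℓ k y := by
        intro k
        rw [hy, map_add, map_add, map_smul, map_smul, smul_eq_mul, smul_eq_mul]
        field_simp
      have hnorm : ‖p n + v‖ ^ 2 / n = n * ‖y - x‖ ^ 2 := by
        rw [hy, add_sub_cancel_left, norm_smul, norm_inv, Real.norm_of_nonneg hn'.le,
          Submodule.coe_norm]
        field_simp
      -- The parameter `s = c / 2 * ‖y - x‖ ^ 2` vanishes at the maximum, so nothing is lost there;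
      -- the two alternatives are the points near `x` and the points at distance at least `δ`.
      have hle := hC n hn (fun k => ⌊ℓ k ((n : ℝ) • x + ((p n + v : U) : F))⌋₊) (fun k => by
          have h1 := (hℓP _ hyP k).2
          have h2 : (⌊ℓ k ((n : ℝ) • x + ((p n + v : U) : F))⌋₊ : ℝ) ≤ n := by
            rw [hfl, hsc]
            nlinarith
          exact_mod_cast h2) (c / 2 * ‖y - x‖ ^ 2) (by positivity) (by
          rcases lt_or_ge ‖y - x‖ δ with h | h
          · left
            intro k
            rw [hfl, hsc]
            have := hδℓ y h k
            nlinarith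
          · right
            gcongr)
      have hd := hdecay y hyP
      rw [hnorm]
      have hd' : n * (φ y - φ x) ≤ n * (-(c * ‖y - x‖ ^ 2)) := by
        refine mul_le_mul_of_nonneg_left ?_ hn'.le
        linarith
      nlinarith
    · have : factorialTerm ℓ w w₀ P n ((n : ℝ) • x + ((p n + v : U) : F)) = 0 :=
        Set.indicator_of_notMem (s := {z : F | (n : ℝ)⁻¹ • z ∈ P}) hmem _
      simp only [f, this, mul_zero, abs_zero]
      positivity
  · intro y v hv hlim
    have hsq0 : Tendsto (fun n : ℕ => (Real.sqrt n)⁻¹) l (𝓝 0) :=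
      (tendsto_inv_atTop_zero.comp
        (Real.tendsto_sqrt_atTop.comp tendsto_natCast_atTop_atTop)).mono_left hl
    have hsmall : Tendsto (fun n : ℕ => (n : ℝ)⁻¹ • v n) l (𝓝 0) := by
      have h1 := hsq0.smul hlim
      rw [zero_smul] at h1
      refine h1.congr fun n => ?_
      rw [smul_smul, ← mul_inv, Real.mul_self_sqrt (by positivity)]
    have hsmallF : Tendsto (fun n : ℕ => (n : ℝ)⁻¹ • (v n : F)) l (𝓝 0) :=
      (continuous_subtype_val.tendsto (0 : U)).comp hsmall
    have hlimF : Tendsto (fun n : ℕ => (Real.sqrt n)⁻¹ • (v n : F)) l (𝓝 (y : F)) :=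
      (continuous_subtype_val.tendsto y).comp hlim
    -- the quadratic part
    have hquad : Tendsto (fun n : ℕ => n * (φ (x + (n : ℝ)⁻¹ • (v n : F)) - φ x)) l
        (𝓝 (1 / 2 * H y y)) := by
      obtain ⟨C₁, δ₁, hC₁, hδ₁, hT⟩ := exists_entropySum_taylor ℓ w hx
      have hB : Tendsto (fun n : ℕ => 1 / 2 * H ((Real.sqrt n)⁻¹ • (v n : F))
          ((Real.sqrt n)⁻¹ • (v n : F))) l (𝓝 (1 / 2 * H y y)) := by
        have hcont : Continuous fun u : F => 1 / 2 * H u u := by fun_prop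
        exact (hcont.tendsto (y : F)).comp hlimF
      -- This is `n` times the cubic Taylor error at `v n / n`: a convergent factor `‖v n / √n‖²`
      -- times a null factor `‖v n / n‖`.
      have herr : Tendsto (fun n : ℕ => C₁ * (‖(Real.sqrt n)⁻¹ • (v n : F)‖ ^ 2 *
          ‖(n : ℝ)⁻¹ • (v n : F)‖)) l (𝓝 0) := by
        have h1 := ((hlimF.norm.pow 2).mul hsmallF.norm).const_mul C₁
        simpa using h1
      have hdiff : Tendsto (fun n : ℕ => n * (φ (x + (n : ℝ)⁻¹ • (v n : F)) - φ x) -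
          1 / 2 * H ((Real.sqrt n)⁻¹ • (v n : F)) ((Real.sqrt n)⁻¹ • (v n : F))) l (𝓝 0) := by
        refine squeeze_zero_norm' ?_ herr
        have hs : ∀ᶠ n : ℕ in l, ‖(n : ℝ)⁻¹ • (v n : F)‖ < δ₁ := by
          have := hsmallF.norm
          rw [norm_zero] at this
          exact this.eventually_lt_const hδ₁
        filter_upwards [hs, hpos] with n hs hn
        have hn' : (0 : ℝ) < n := by exact_mod_cast hn
        have h1 := hT _ hs.le
        rw [entropySum_gradient_eq_zero ℓ w hx U hmaxU (U.smul_mem _ (v n).2)] at h1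
        have e1 : (1 / 2 * H ((Real.sqrt n)⁻¹ • (v n : F)) ((Real.sqrt n)⁻¹ • (v n : F))) =
            n * (1 / 2 * H ((n : ℝ)⁻¹ • (v n : F)) ((n : ℝ)⁻¹ • (v n : F))) := by
          simp only [map_smul, _root_.smul_apply, smul_eq_mul]
          have : (Real.sqrt n)⁻¹ * ((Real.sqrt n)⁻¹ * H (v n) (v n)) = (n : ℝ)⁻¹ * H (v n) (v n) := by
            rw [← mul_assoc, ← mul_inv, Real.mul_self_sqrt hn'.le]
          rw [this]
          field_simp
        have e2 : ‖(Real.sqrt n)⁻¹ • (v n : F)‖ ^ 2 = n * ‖(n : ℝ)⁻¹ • (v n : F)‖ ^ 2 := by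
          rw [norm_smul, norm_smul, mul_pow, mul_pow, norm_inv, norm_inv, inv_pow,
            Real.norm_of_nonneg (Real.sqrt_nonneg _), Real.sq_sqrt hn'.le,
            Real.norm_of_nonneg hn'.le]
          field_simp
        rw [e1, e2, ← mul_sub, Real.norm_eq_abs, abs_mul, abs_of_pos hn']
        have h2 := mul_le_mul_of_nonneg_left h1 hn'.le
        simp only [sub_zero] at h2
        refine h2.trans_eq ?_
        ring
      have := hdiff.add hB
      simpa using this
    -- the Stirling ratios
    have hmem : ∀ᶠ n : ℕ in l, (n : ℝ)⁻¹ • ((n : ℝ) • x + (v n : F)) ∈ P := by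
      filter_upwards [hsmall.eventually hnear, hpos] with n h1 hn
      have hn' : (n : ℝ) ≠ 0 := by positivity
      rw [smul_add, smul_smul, inv_mul_cancel₀ hn', one_smul]
      exact h1
    have hints : ∀ᶠ n : ℕ in l, ∀ k, ∃ m : ℤ, ℓ k ((n : ℝ) • x + (v n : F)) = m := by
      filter_upwards [h_int] with n h k
      have h1 := h (v n - p n) (hv n) k
      rwa [← hzv, add_sub_cancel] at h1
    have hratio : ∀ k, Tendsto (fun n : ℕ =>
        ((⌊ℓ k ((n : ℝ) • x + (v n : F))⌋₊ : ℕ) : ℝ) / n) l (𝓝 (ℓ k x)) := by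
      intro k
      have h1 : Tendsto (fun n : ℕ => ℓ k (x + (n : ℝ)⁻¹ • (v n : F))) l (𝓝 (ℓ k x)) := by
        have : Tendsto (fun n : ℕ => x + (n : ℝ)⁻¹ • (v n : F)) l (𝓝 (x + 0)) :=
          tendsto_const_nhds.add hsmallF
        rw [add_zero] at this
        exact ((ℓ k).continuous.tendsto x).comp this
      refine h1.congr' ?_
      filter_upwards [hmem, hints, hpos] with n h1 h2 hn
      have hn' : (n : ℝ) ≠ 0 := by positivity
      rw [(hterm n hn (v n) h1 h2).1 k, map_add, map_add, map_smul, map_smul, smul_eq_mul,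
        smul_eq_mul]
      field_simp
    have hst : Tendsto (fun n : ℕ => (w₀ * logStirlingRatio n +
          ∑ k, w k * logStirlingRatio ⌊ℓ k ((n : ℝ) • x + (v n : F))⌋₊) -
          (w₀ + ∑ k, w k) / 2 * Real.log (2 * Real.pi * n)) l
        (𝓝 (∑ k, w k * (1 / 2 * Real.log (ℓ k x)))) := by
      have h0 : Tendsto (fun n : ℕ => w₀ * (logStirlingRatio n -
          1 / 2 * Real.log (2 * Real.pi * n))) l (𝓝 (w₀ * (1 / 2 * Real.log 1))) := by
        refine (tendsto_logStirlingRatio_sub hl one_pos ?_).const_mul _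
        refine tendsto_const_nhds.congr' ?_
        filter_upwards [hpos] with n hn
        have hn' : (n : ℝ) ≠ 0 := by positivity
        exact (div_self hn').symm
      have h1 : Tendsto (fun n : ℕ => ∑ k, w k * (logStirlingRatio
          ⌊ℓ k ((n : ℝ) • x + (v n : F))⌋₊ - 1 / 2 * Real.log (2 * Real.pi * n))) l
          (𝓝 (∑ k, w k * (1 / 2 * Real.log (ℓ k x)))) :=
        tendsto_finsetSum _ fun k _ =>
          (tendsto_logStirlingRatio_sub hl (hx k) (hratio k)).const_mul _
      have h2 := h0.add h1
      rw [Real.log_one, mul_zero, mul_zero, zero_add] at h2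
      refine h2.congr fun n => ?_
      simp only [mul_sub, Finset.sum_sub_distrib, ← Finset.sum_mul]
      ring
    have hexp := (Real.continuous_exp.tendsto _).comp (hquad.add hst)
    have e : Real.exp (1 / 2 * H y y + ∑ k, w k * (1 / 2 * Real.log (ℓ k x))) =
        Real.exp (∑ k, w k * (1 / 2 * Real.log (ℓ k x))) *
          Real.exp (-(1 / 2) * (-H) y y) := by
      rw [add_comm, Real.exp_add]
      congr 2
      simp
    rw [e] at hexp
    refine hexp.congr' ?_
    filter_upwards [hmem, hints, hpos] with n h1 h2 hn
    exact ((hterm n hn (v n) h1 h2).2).symm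

end FactorialLatticeSum

/-! ### Permutations carrying one coloring to another -/

section CountingPermutations

open Nat

variable {α ι : Type*} [Fintype α]

open scoped Classical in
/-- The number of `a` with `f a = i`. -/
noncomputable def fiberCard (f : α → ι) (i : ι) : ℕ :=
  (Finset.univ.filter fun a => f a = i).card

theorem sum_fiberCard [Fintype ι] (f : α → ι) : ∑ i, fiberCard f i = Fintype.card α := by
  classical
  have := Finset.card_eq_sum_card_fiberwise (s := (Finset.univ : Finset α)) (t := Finset.univ)
    (f := f) (fun _ _ => Finset.mem_coe.2 (Finset.mem_univ _))
  rw [Finset.card_univ] at this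
  exact this.symm

open scoped Classical in
/-- The number of permutations carrying a function `f` to a function `g`. -/
theorem card_perm_comp_eq [DecidableEq α] [Fintype ι] (f g : α → ι) :
    (Finset.univ.filter fun s : Equiv.Perm α => ∀ a, f a = g (s a)).card =
      if ∀ i, fiberCard f i = fiberCard g i then ∏ i, (fiberCard f i)! else 0 := by
  split_ifs with h
  · -- a permutation with `f = g ∘ s₀`
    have hequiv : ∀ i, Nonempty ({a // f a = i} ≃ {a // g a = i}) := fun i => by
      refine ⟨Fintype.equivOfCardEq ?_⟩
      rw [Fintype.card_subtype, Fintype.card_subtype]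
      exact h i
    let e := fun i => (hequiv i).some
    let s₀ : Equiv.Perm α := (Equiv.sigmaFiberEquiv f).symm.trans
      ((Equiv.sigmaCongrRight e).trans (Equiv.sigmaFiberEquiv g))
    have hs₀ : ∀ a, g (s₀ a) = f a := fun a => (e (f a) ⟨a, rfl⟩).2
    -- Composition with `s₀⁻¹` identifies the solutions with the stabilizer of `f`, whose order is
    -- the product of the factorials of the fiber sizes.
    have h1 : (Finset.univ.filter fun s : Equiv.Perm α => ∀ a, f a = g (s a)).card =
        Fintype.card {s : Equiv.Perm α // f ∘ s = f} := by
      rw [← Fintype.card_subtype]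
      refine Fintype.card_congr ((Equiv.mulLeft s₀⁻¹).subtypeEquiv fun s => ?_)
      have h2 : ∀ b, f (s₀⁻¹ b) = g b := fun b => by rw [← hs₀]; simp
      rw [funext_iff]
      refine forall_congr' fun a => ?_
      simp only [Equiv.coe_mulLeft, Function.comp_apply, Equiv.Perm.coe_mul, h2]
      exact eq_comm
    rw [h1, DomMulAct.stabilizer_card]
    refine Finset.prod_congr rfl fun i _ => ?_
    rw [Fintype.card_subtype]
    rfl
  · rw [Finset.card_eq_zero, Finset.filter_eq_empty_iff]
    intro s _ hs
    refine h fun i => ?_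
    refine Finset.card_bij (fun a _ => s a) ?_ (fun _ _ _ _ h => s.injective h) ?_
    · intro a ha
      simp only [Finset.mem_filter, Finset.mem_univ, true_and] at ha ⊢
      rw [← hs, ha]
    · intro b hb
      simp only [Finset.mem_filter, Finset.mem_univ, true_and] at hb
      exact ⟨s⁻¹ b, by simp [hs, hb], by simp⟩

open scoped Classical in
/-- The number of functions with prescribed sizes of the fibers. -/
theorem card_fiberCard_eq_mul [DecidableEq α] [Fintype ι] (z : ι → ℕ) (hz : ∑ i, z i = Fintype.card α) :
    (Finset.univ.filter fun f : α → ι => fiberCard f = z).card * ∏ i, (z i)! =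
      (Fintype.card α)! := by
  obtain ⟨e⟩ : Nonempty ((Σ i, Fin (z i)) ≃ α) := by
    refine ⟨Fintype.equivOfCardEq ?_⟩
    simp [hz]
  let f₀ : α → ι := fun a => (e.symm a).1
  have hf₀ : fiberCard f₀ = z := by
    funext i
    have : fiberCard f₀ i = (Finset.univ : Finset (Fin (z i))).card := by
      symm
      refine Finset.card_bij (fun k _ => e ⟨i, k⟩) (by simp [f₀]) (by simp) ?_
      intro a ha
      simp only [Finset.mem_filter, Finset.mem_univ, true_and, f₀] at ha
      subst ha
      exact ⟨(e.symm a).2, Finset.mem_univ _, by simp⟩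
    simpa using this
  -- Permutations `s` are sorted by the function `f₀ ∘ s`; each `f` with fiber sizes `z` arises from
  -- exactly `∏ (z i)!` of them.
  rw [← Fintype.card_perm, ← Finset.card_univ (α := Equiv.Perm α)]
  rw [Finset.card_eq_sum_card_fiberwise (s := (Finset.univ : Finset (Equiv.Perm α)))
    (t := Finset.univ.filter fun f : α → ι => fiberCard f = z) (f := fun s a => f₀ (s a))]
  · rw [Finset.sum_const_nat (m := ∏ i, (z i)!)]
    intro f hf
    simp only [Finset.mem_filter, Finset.mem_univ, true_and] at hf
    have h := card_perm_comp_eq f f₀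
    rw [hf, hf₀, if_pos fun _ => rfl] at h
    rw [← h]
    congr 1
    ext s
    simp only [Finset.mem_filter, Finset.mem_univ, true_and, funext_iff]
    exact forall_congr' fun a => eq_comm
  · intro s _
    simp only [Finset.coe_filter, Finset.mem_univ, true_and]
    show fiberCard (fun a => f₀ (s a)) = z
    rw [← hf₀]
    funext i
    exact Finset.card_bij (fun a _ => s a) (by simp) (fun _ _ _ _ h => s.injective h)
      (fun b hb => ⟨s⁻¹ b, by simpa using hb, by simp⟩)

end CountingPermutations

/-! ### Perfect matchings of lifts and the exact second moment -/

namespace Graph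

universe u v

variable {α : Type u} {β : Type v} (G : Graph α β)

theorem isLink_tail_head (e : E(G)) : G.IsLink e.1 (G.tail e).1 (G.head e).1 :=
  (G.exists_isLink_of_mem_edgeSet e.2).choose_spec.choose_spec

/-- An edge, as an edge at its tail. -/
noncomputable def atTail (e : E(G)) : G.EdgesAt (G.tail e) :=
  G.edgeAtLeft (G.isLink_tail_head e)

/-- An edge, as an edge at its head. -/
noncomputable def atHead (e : E(G)) : G.EdgesAt (G.head e) :=
  G.edgeAtRight (G.isLink_tail_head e)

theorem tail_ne_head [G.Loopless] (e : E(G)) : G.tail e ≠ G.head e :=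
  fun h => (G.isLink_tail_head e).ne (congrArg Subtype.val h)

theorem eq_tail_or_eq_head {e : E(G)} {i : V(G)} (h : G.Inc e.1 i.1) :
    i = G.tail e ∨ i = G.head e := by
  rcases h.eq_or_eq_of_isLink (G.isLink_tail_head e) with h | h
  · exact Or.inl (Subtype.ext h)
  · exact Or.inr (Subtype.ext h)

theorem lift_inc_iff {n : ℕ} (σ : E(G) → Equiv.Perm (Fin n)) (p : E(G) × Fin n)
    (x : V(G) × Fin n) :
    (G.lift n σ).Inc p x ↔ x = (G.tail p.1, p.2) ∨ x = (G.head p.1, σ p.1 p.2) := by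
  constructor
  · rintro ⟨y, hy⟩
    have hy' : s(x, y) = s((G.tail p.1, p.2), (G.head p.1, σ p.1 p.2)) := hy
    rw [Sym2.eq_iff] at hy'
    tauto
  · rintro (rfl | rfl)
    · exact ⟨_, rfl⟩
    · exact ⟨_, Sym2.eq_swap⟩

/-- A choice of an edge at every vertex of the lift is compatible with `σ` if it is given by a
perfect matching. -/
def IsCompatible {n : ℕ} (σ : E(G) → Equiv.Perm (Fin n)) (m : ∀ i, Fin n → G.EdgesAt i) : Prop :=
  ∀ e a, m (G.tail e) a = G.atTail e ↔ m (G.head e) (σ e a) = G.atHead e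

variable {G}

theorem IsCompatible.fst_eq_of_inc {n : ℕ} {σ : E(G) → Equiv.Perm (Fin n)}
    {m : ∀ i, Fin n → G.EdgesAt i} (hm : G.IsCompatible σ m) {p : E(G) × Fin n} {i : V(G)}
    {b : Fin n} (hp : m (G.tail p.1) p.2 = G.atTail p.1) (h : (G.lift n σ).Inc p (i, b)) :
    (m i b).1 = p.1 := by
  rcases (G.lift_inc_iff σ p (i, b)).1 h with h | h
  · obtain ⟨rfl, rfl⟩ := Prod.mk.inj h
    rw [hp]; rfl
  · obtain ⟨rfl, rfl⟩ := Prod.mk.inj h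
    rw [(hm _ _).1 hp]; rfl

/-- The edge chosen at `(i, b)` lifts to one edge through `(i, b)`. If `i` is its head, that lift is
indexed by `(σ e)⁻¹ b`, and compatibility transports the choice back to the tail. -/
theorem IsCompatible.exists_inc {n : ℕ} {σ : E(G) → Equiv.Perm (Fin n)}
    {m : ∀ i, Fin n → G.EdgesAt i} (hm : G.IsCompatible σ m) (i : V(G)) (b : Fin n) :
    ∃ p : E(G) × Fin n, m (G.tail p.1) p.2 = G.atTail p.1 ∧ (G.lift n σ).Inc p (i, b) := by
  obtain ⟨e, he⟩ : ∃ e, (m i b).1 = e := ⟨_, rfl⟩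
  have hinc : G.Inc e.1 i.1 := he ▸ (m i b).2
  rcases G.eq_tail_or_eq_head hinc with rfl | rfl
  · exact ⟨(e, b), Subtype.ext he, (G.lift_inc_iff _ _ _).2 (Or.inl rfl)⟩
  · refine ⟨(e, (σ e)⁻¹ b), (hm e _).2 ?_, (G.lift_inc_iff _ _ _).2 (Or.inr (by simp))⟩
    have h : σ e ((σ e)⁻¹ b) = b := by simp
    simp only [h]
    exact Subtype.ext he

/-- Without loops the lifts of one edge form a matching between two different layers, so at most one
of them meets a given vertex. -/
theorem eq_of_lift_inc [G.Loopless] {n : ℕ} {σ : E(G) → Equiv.Perm (Fin n)} {p q : E(G) × Fin n}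
    {x : V(G) × Fin n} (hp : (G.lift n σ).Inc p x) (hq : (G.lift n σ).Inc q x) (h : p.1 = q.1) :
    p = q := by
  obtain ⟨e, a⟩ := p
  obtain ⟨e', a'⟩ := q
  obtain rfl : e = e' := h
  rw [lift_inc_iff] at hp hq
  have hne := G.tail_ne_head e
  rcases hp with rfl | rfl <;> rcases hq with hq | hq <;> rw [Prod.mk.injEq] at hq
  · rw [show a = a' from hq.2]
  · exact absurd hq.1 hne
  · exact absurd hq.1.symm hne
  · rw [show a = a' from (σ e).injective hq.2]

/-- Perfect matchings of the lift correspond to compatible choices of edges. -/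
theorem setOf_isPerfectMatching_lift [G.Loopless] {n : ℕ} (σ : E(G) → Equiv.Perm (Fin n)) :
    {M | (G.lift n σ).IsPerfectMatching M} =
      (fun m : ∀ i, Fin n → G.EdgesAt i =>
        {p : E(G) × Fin n | m (G.tail p.1) p.2 = G.atTail p.1}) '' {m | G.IsCompatible σ m} := by
  ext M
  constructor
  · rintro ⟨-, hM⟩
    choose q hq using fun x : V(G) × Fin n => (hM x (Set.mem_univ x))
    have hinc : ∀ i b, G.Inc (q (i, b)).1.1 i.1 := by
      intro i b
      rcases (G.lift_inc_iff σ _ _).1 (hq (i, b)).1.2 with h | h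
      · have h' := (G.isLink_tail_head (q (i, b)).1).inc_left
        rwa [← (Prod.mk.inj h).1] at h'
      · have h' := (G.isLink_tail_head (q (i, b)).1).inc_right
        rwa [← (Prod.mk.inj h).1] at h'
    let m : ∀ i, Fin n → G.EdgesAt i := fun i b => ⟨(q (i, b)).1, hinc i b⟩
    have key : ∀ (p : E(G) × Fin n) (i : V(G)) (b : Fin n), (G.lift n σ).Inc p (i, b) →
        ((m i b).1 = p.1 ↔ p ∈ M) := by
      intro p i b hp
      constructor
      · intro h
        have := eq_of_lift_inc hp (hq (i, b)).1.2 h.symm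
        rw [this]
        exact (hq (i, b)).1.1
      · intro h
        have := (hq (i, b)).2 p ⟨h, hp⟩
        simp only [m, this]
    have ht : ∀ e a, m (G.tail e) a = G.atTail e ↔ (e, a) ∈ M := fun e a =>
      Subtype.ext_iff.trans (key (e, a) _ _ ((G.lift_inc_iff _ _ _).2 (Or.inl rfl)))
    have hh : ∀ e a, m (G.head e) (σ e a) = G.atHead e ↔ (e, a) ∈ M := fun e a =>
      Subtype.ext_iff.trans (key (e, a) _ _ ((G.lift_inc_iff _ _ _).2 (Or.inr rfl)))
    refine ⟨m, fun e a => (ht e a).trans (hh e a).symm, ?_⟩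
    ext p
    exact ht p.1 p.2
  · rintro ⟨m, hm, rfl⟩
    refine ⟨fun _ _ => Set.mem_univ _, ?_⟩
    rintro ⟨i, b⟩ -
    obtain ⟨p, hp, hpi⟩ := hm.exists_inc i b
    refine ⟨p, ⟨hp, hpi⟩, ?_⟩
    rintro q ⟨hq, hqi⟩
    exact eq_of_lift_inc hqi hpi ((hm.fst_eq_of_inc hq hqi).symm.trans (hm.fst_eq_of_inc hp hpi))

/-- The choice at a vertex is recovered as the base edge of the lifted edge covering it. -/
theorem injOn_matching_of_isCompatible [G.Loopless] {n : ℕ} (σ : E(G) → Equiv.Perm (Fin n)) :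
    Set.InjOn (fun m : ∀ i, Fin n → G.EdgesAt i =>
        {p : E(G) × Fin n | m (G.tail p.1) p.2 = G.atTail p.1}) {m | G.IsCompatible σ m} := by
  intro m hm m' hm' h
  funext i b
  obtain ⟨p, hp, hpi⟩ := IsCompatible.exists_inc hm i b
  have hp' : m' (G.tail p.1) p.2 = G.atTail p.1 := by
    have hp0 : p ∈ {p : E(G) × Fin n | m (G.tail p.1) p.2 = G.atTail p.1} := hp
    exact (Set.ext_iff.1 h p).1 hp0
  exact Subtype.ext ((IsCompatible.fst_eq_of_inc hm hp hpi).trans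
    (IsCompatible.fst_eq_of_inc hm' hp' hpi).symm)

open scoped Classical in
theorem numPerfectMatchings_lift [Fintype V(G)] [Fintype E(G)] [G.Loopless] {n : ℕ}
    (σ : E(G) → Equiv.Perm (Fin n)) :
    (G.lift n σ).numPerfectMatchings =
      (Finset.univ.filter fun m : ∀ i, Fin n → G.EdgesAt i => G.IsCompatible σ m).card := by
  rw [numPerfectMatchings, setOf_isPerfectMatching_lift,
    (injOn_matching_of_isCompatible σ).ncard_image, ← Set.ncard_coe_finset]
  congr 1
  ext m
  simp

variable (G)

open scoped Classical in
/-- For a pair of edges `p` at `i`, which of its components are the edge `e`. -/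
noncomputable def pairColor (i : V(G)) (e : G.EdgesAt i) (p : G.EdgesAt i × G.EdgesAt i) :
    Bool × Bool :=
  (decide (p.1 = e), decide (p.2 = e))

open scoped Classical in
/-- The number of vertices above `i` of each type with respect to the edge `e`. -/
noncomputable def colorCount [Fintype E(G)] (z : G.PairIndex → ℕ) (i : V(G)) (e : G.EdgesAt i)
    (c : Bool × Bool) : ℕ :=
  ∑ p : G.EdgesAt i × G.EdgesAt i with G.pairColor i e p = c, z ⟨i, p⟩

open scoped Classical in
theorem fiberCard_pairColor [Fintype E(G)] {n : ℕ} {z : G.PairIndex → ℕ} {i : V(G)}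
    (ω : Fin n → G.EdgesAt i × G.EdgesAt i) (hω : ∀ p, fiberCard ω p = z ⟨i, p⟩)
    (e : G.EdgesAt i) (c : Bool × Bool) :
    fiberCard (fun a => G.pairColor i e (ω a)) c = G.colorCount z i e c := by
  rw [fiberCard, Finset.card_eq_sum_card_fiberwise (f := ω)
    (t := Finset.univ.filter fun p => G.pairColor i e p = c)]
  · refine Finset.sum_congr rfl fun p hp => ?_
    rw [← hω, fiberCard, Finset.filter_filter]
    congr 1
    ext a
    simp only [Finset.mem_filter, Finset.mem_univ, true_and] at hp ⊢
    constructor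
    · exact fun h => h.2
    · rintro rfl
      exact ⟨hp, rfl⟩
  · intro a ha
    simpa using ha

/-- The vectors of numbers of vertices of each type, in the fibers of size `n`, that are compatible
along all edges. -/
def IsBalanced [Fintype E(G)] (z : G.PairIndex → ℕ) : Prop :=
  ∀ e c, G.colorCount z (G.tail e) (G.atTail e) c = G.colorCount z (G.head e) (G.atHead e) c

open scoped Classical in
/-- The vectors counting the vertices of each type, for all assignments of types to vertices. -/
noncomputable def typeVectors [Fintype V(G)] [Fintype E(G)] (n : ℕ) :
    Finset (G.PairIndex → ℕ) :=
  Finset.univ.image fun (ω : ∀ i, Fin n → G.EdgesAt i × G.EdgesAt i) (t : G.PairIndex) =>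
    fiberCard (ω t.1) t.2

-- The layers are filled independently, so this is one multinomial count per vertex of `G`,
-- multiplied out to avoid division.
open Nat in
open scoped Classical in
theorem card_typeVector_mul [Fintype V(G)] [Fintype E(G)] {n : ℕ} {z : G.PairIndex → ℕ}
    (hz : ∀ i, ∑ p, z ⟨i, p⟩ = n) :
    (Finset.univ.filter fun ω : ∀ i, Fin n → G.EdgesAt i × G.EdgesAt i =>
      (fun t : G.PairIndex => fiberCard (ω t.1) t.2) = z).card * ∏ i, ∏ p, (z ⟨i, p⟩)! =
      n ! ^ Fintype.card V(G) := by
  have h1 : (Finset.univ.filter fun ω : ∀ i, Fin n → G.EdgesAt i × G.EdgesAt i =>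
      (fun t : G.PairIndex => fiberCard (ω t.1) t.2) = z) =
      Fintype.piFinset fun i => Finset.univ.filter fun f : Fin n → G.EdgesAt i × G.EdgesAt i =>
        fiberCard f = fun p => z ⟨i, p⟩ := by
    ext ω
    simp only [Finset.mem_filter, Finset.mem_univ, true_and, Fintype.mem_piFinset, funext_iff]
    exact ⟨fun h i p => h ⟨i, p⟩, fun h t => h t.1 t.2⟩
  rw [h1, Fintype.card_piFinset, ← Finset.prod_mul_distrib]
  rw [Finset.prod_congr rfl fun i _ => card_fiberCard_eq_mul (α := Fin n) (fun p => z ⟨i, p⟩)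
    (by rw [hz, Fintype.card_fin])]
  simp

/-- That every vector with the right layer sums occurs is read off from the multinomial count, which
cannot be zero. -/
theorem mem_typeVectors [Fintype V(G)] [Fintype E(G)] {n : ℕ} {z : G.PairIndex → ℕ} :
    z ∈ G.typeVectors n ↔ ∀ i, ∑ p, z ⟨i, p⟩ = n := by
  classical
  constructor
  · intro h i
    obtain ⟨ω, -, rfl⟩ := Finset.mem_image.1 h
    simp only
    rw [sum_fiberCard, Fintype.card_fin]
  · intro h
    have h1 := G.card_typeVector_mul h
    have h2 : (Finset.univ.filter fun ω : ∀ i, Fin n → G.EdgesAt i × G.EdgesAt i =>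
      (fun t : G.PairIndex => fiberCard (ω t.1) t.2) = z).card ≠ 0 := by
      intro h0
      rw [h0, zero_mul] at h1
      exact (pow_pos (Nat.factorial_pos n) _).ne h1
    obtain ⟨ω, hω⟩ := Finset.card_ne_zero.1 h2
    exact Finset.mem_image.2 ⟨ω, Finset.mem_univ _, (Finset.mem_filter.1 hω).2⟩

-- The square counts pairs of compatible choices, that is, assignments `ω` of pairs of edges. After
-- exchanging the sums over `σ` and `ω`, compatibility of both components means that each `σ e`
-- carries the coloring at the tail of `e` to the coloring at its head; these conditions are
-- independent over `e`.
open Nat in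
open scoped Classical in
theorem sum_numPerfectMatchings_sq [Fintype V(G)] [Fintype E(G)] [G.Loopless] (n : ℕ) :
    ∑ σ : E(G) → Equiv.Perm (Fin n), (G.lift n σ).numPerfectMatchings ^ 2 =
      ∑ ω : ∀ i, Fin n → G.EdgesAt i × G.EdgesAt i, ∏ e,
        if ∀ c, fiberCard (fun a => G.pairColor (G.tail e) (G.atTail e) (ω _ a)) c =
            fiberCard (fun a => G.pairColor (G.head e) (G.atHead e) (ω _ a)) c
        then ∏ c, (fiberCard (fun a => G.pairColor (G.tail e) (G.atTail e) (ω _ a)) c)! else 0 := by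
  have h1 : ∀ ω : ∀ i, Fin n → G.EdgesAt i × G.EdgesAt i, (∏ e,
        if ∀ c, fiberCard (fun a => G.pairColor (G.tail e) (G.atTail e) (ω _ a)) c =
            fiberCard (fun a => G.pairColor (G.head e) (G.atHead e) (ω _ a)) c
        then ∏ c, (fiberCard (fun a => G.pairColor (G.tail e) (G.atTail e) (ω _ a)) c)! else 0) =
      ∑ σ : E(G) → Equiv.Perm (Fin n), if G.IsCompatible σ (fun i a => (ω i a).1) ∧
        G.IsCompatible σ (fun i a => (ω i a).2) then 1 else 0 := by
    intro ω
    have h2 : ∀ e, (if ∀ c, fiberCard (fun a => G.pairColor (G.tail e) (G.atTail e) (ω _ a)) c =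
            fiberCard (fun a => G.pairColor (G.head e) (G.atHead e) (ω _ a)) c
        then ∏ c, (fiberCard (fun a => G.pairColor (G.tail e) (G.atTail e) (ω _ a)) c)! else 0) =
        (Finset.univ.filter fun s : Equiv.Perm (Fin n) => ∀ a,
          G.pairColor (G.tail e) (G.atTail e) (ω _ a) =
          G.pairColor (G.head e) (G.atHead e) (ω _ (s a))).card := fun e => by
      convert (card_perm_comp_eq (fun a => G.pairColor (G.tail e) (G.atTail e) (ω _ a))
        (fun a => G.pairColor (G.head e) (G.atHead e) (ω _ a))).symm
    rw [Finset.prod_congr rfl fun e _ => h2 e, ← Fintype.card_piFinset, ← Finset.card_filter]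
    congr 1
    ext σ
    simp only [Fintype.mem_piFinset, Finset.mem_filter, Finset.mem_univ, true_and]
    simp only [IsCompatible, pairColor, Prod.mk.injEq, decide_eq_decide]
    exact ⟨fun h => ⟨fun e a => (h e a).1, fun e a => (h e a).2⟩,
      fun h e a => ⟨h.1 e a, h.2 e a⟩⟩
  rw [Finset.sum_congr rfl fun ω _ => h1 ω, Finset.sum_comm]
  refine Finset.sum_congr rfl fun σ _ => ?_
  rw [← Finset.card_filter, numPerfectMatchings_lift, sq, ← Finset.card_product]
  refine Finset.card_bij (fun q _ i a => (q.1 i a, q.2 i a)) ?_ ?_ ?_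
  · intro q hq
    simpa using hq
  · intro q _ q' _ h
    refine Prod.ext ?_ ?_ <;> funext i a
    · exact congrArg Prod.fst (congrFun (congrFun h i) a)
    · exact congrArg Prod.snd (congrFun (congrFun h i) a)
  · intro ω hω
    exact ⟨(fun i a => (ω i a).1, fun i a => (ω i a).2), by simpa using hω, rfl⟩

open Nat in
open scoped Classical in
/-- The second moment as a sum over type vectors. -/
theorem secondMoment_eq_sum [Fintype V(G)] [Fintype E(G)] [G.Loopless] (n : ℕ) :
    G.secondMoment n = ∑ z ∈ G.typeVectors n with G.IsBalanced z,
      ((n ! : ℝ) ^ Fintype.card V(G) / ∏ i, ∏ p, ((z ⟨i, p⟩)! : ℝ)) *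
        ((∏ e, ∏ c, ((G.colorCount z (G.tail e) (G.atTail e) c)! : ℝ)) /
          (n ! : ℝ) ^ Fintype.card E(G)) := by
  have hcard : (Fintype.card (E(G) → Equiv.Perm (Fin n)) : ℝ) =
      (n ! : ℝ) ^ Fintype.card E(G) := by
    rw [Fintype.card_fun, Fintype.card_perm, Fintype.card_fin]
    push_cast
    rfl
  have h0 : (∑ σ : E(G) → Equiv.Perm (Fin n), ((G.lift n σ).numPerfectMatchings : ℝ) ^ 2) =
      ((∑ σ : E(G) → Equiv.Perm (Fin n), (G.lift n σ).numPerfectMatchings ^ 2 : ℕ) : ℝ) := by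
    push_cast; rfl
  rw [secondMoment, hcard, h0, sum_numPerfectMatchings_sq]
  have h1 : ∀ ω : ∀ i, Fin n → G.EdgesAt i × G.EdgesAt i, (∏ e,
        if ∀ c, fiberCard (fun a => G.pairColor (G.tail e) (G.atTail e) (ω _ a)) c =
            fiberCard (fun a => G.pairColor (G.head e) (G.atHead e) (ω _ a)) c
        then ∏ c, (fiberCard (fun a => G.pairColor (G.tail e) (G.atTail e) (ω _ a)) c)! else 0) =
      (fun z : G.PairIndex → ℕ => if G.IsBalanced z then
        ∏ e, ∏ c, (G.colorCount z (G.tail e) (G.atTail e) c)! else 0)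
        (fun t => fiberCard (ω t.1) t.2) := by
    intro ω
    have hc : ∀ i e c, fiberCard (fun a => G.pairColor i e (ω i a)) c =
        G.colorCount (fun t => fiberCard (ω t.1) t.2) i e c :=
      fun i e c => G.fiberCard_pairColor (z := fun t => fiberCard (ω t.1) t.2) (ω i)
        (fun _ => rfl) e c
    simp only [hc]
    split_ifs with hb
    · exact Finset.prod_congr rfl fun e _ => if_pos (hb e)
    · simp only [IsBalanced, not_forall] at hb
      obtain ⟨e, c, hec⟩ := hb
      exact Finset.prod_eq_zero (Finset.mem_univ e) (if_neg fun h => hec (h c))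
  -- The summand depends on `ω` only through its type vector, so the sum is grouped by type vectors
  -- with multinomial multiplicities.
  rw [Finset.sum_congr rfl fun ω _ => h1 ω,
    Finset.sum_comp (s := Finset.univ) (fun z : G.PairIndex → ℕ => if G.IsBalanced z then
        ∏ e, ∏ c, (G.colorCount z (G.tail e) (G.atTail e) c)! else 0)
      (fun (ω : ∀ i, Fin n → G.EdgesAt i × G.EdgesAt i) (t : G.PairIndex) =>
        fiberCard (ω t.1) t.2), Finset.sum_filter, Nat.cast_sum, Finset.sum_div]
  refine Finset.sum_congr rfl fun z hz => ?_
  split_ifs with hb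
  · have hz' := G.card_typeVector_mul ((G.mem_typeVectors).1 hz)
    have hz'' : ((Finset.univ.filter fun ω : ∀ i, Fin n → G.EdgesAt i × G.EdgesAt i =>
      (fun t : G.PairIndex => fiberCard (ω t.1) t.2) = z).card : ℝ) * ∏ i, ∏ p, ((z ⟨i, p⟩)! : ℝ) =
      (n ! : ℝ) ^ Fintype.card V(G) := by exact_mod_cast hz'
    have hne : ∏ i, ∏ p, ((z ⟨i, p⟩)! : ℝ) ≠ 0 :=
      Finset.prod_ne_zero_iff.2 fun i _ => Finset.prod_ne_zero_iff.2 fun p _ => by positivity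
    rw [← hz'', mul_div_cancel_right₀ _ hne, smul_eq_mul]
    push_cast
    rw [mul_div_assoc]
  · simp

end Graph

namespace Graph

universe u v

variable {α : Type u} {β : Type v} (G : Graph α β)

/-! ### The integer points of `V` form a full lattice -/

section Lattice

variable [Fintype V(G)] [Fintype E(G)]

/-- Clearing denominators puts a rational vector into the lattice. -/
theorem mem_span_pairLattice_of_rat {x : G.PairSpace} (hx : x ∈ G.pairV) (r : G.PairIndex → ℚ)
    (hr : ∀ t, x t = r t) : x ∈ Submodule.span ℝ (G.pairLattice : Set G.PairSpace) := by
  classical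
  set D : ℕ := ∏ t, (r t).den with hD
  have hD0 : (D : ℝ) ≠ 0 := by
    rw [hD]; exact_mod_cast Finset.prod_ne_zero_iff.2 fun t _ => (r t).den_nz
  have hmem : (D : ℝ) • x ∈ G.pairLattice := by
    refine ⟨G.pairV.smul_mem _ hx, fun t => ?_⟩
    obtain ⟨k, hk⟩ := Finset.dvd_prod_of_mem (fun t => (r t).den) (Finset.mem_univ t)
    refine ⟨k * (r t).num, ?_⟩
    have h1 : ((r t : ℚ) : ℝ) * ((r t).den : ℝ) = ((r t).num : ℝ) := by
      exact_mod_cast congrArg (fun q : ℚ => (q : ℝ)) (Rat.mul_den_eq_num (r t))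
    rw [PiLp.smul_apply, smul_eq_mul, hr, hD, hk]
    push_cast
    rw [← h1]
    ring
  have := Submodule.smul_mem _ (D : ℝ)⁻¹ (Submodule.subset_span (R := ℝ) hmem)
  rwa [smul_smul, inv_mul_cancel₀ hD0, one_smul] at this

/-- The subspace `V` is defined over `ℚ`, hence spanned by its integer points. -/
theorem span_pairLattice : Submodule.span ℝ (G.pairLattice : Set G.PairSpace) = G.pairV := by
  classical
  refine le_antisymm (Submodule.span_le.2 fun x hx => hx.1) fun x hx => ?_
  -- The equations of `V` have rational coefficients, so applying a `ℚ`-linear coordinate functional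
  -- of `ℝ` to all entries of `x` gives a rational vector of `V`; `x` is a finite real combination
  -- of these.
  let b := Basis.ofVectorSpace ℚ ℝ
  let y : Basis.ofVectorSpaceIndex ℚ ℝ → G.PairSpace := fun h =>
    WithLp.toLp 2 fun t => ((b.coord h (x t) : ℚ) : ℝ)
  have hy : ∀ h, y h ∈ G.pairV := by
    intro h
    refine ⟨fun e i j hij => ?_, fun i => ?_⟩
    · obtain ⟨h1, h2, h3⟩ := hx.1 e i j hij
      refine ⟨?_, ?_, ?_⟩
      · simp only [y, h1]
      · have := congrArg (fun s : ℝ => ((b.coord h s : ℚ) : ℝ)) h2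
        simpa only [map_sum, Rat.cast_sum, y] using this
      · have := congrArg (fun s : ℝ => ((b.coord h s : ℚ) : ℝ)) h3
        simpa only [map_sum, Rat.cast_sum, y] using this
    · have := congrArg (fun s : ℝ => ((b.coord h s : ℚ) : ℝ)) (hx.2 i)
      simpa only [map_sum, Rat.cast_sum, y, map_zero, Rat.cast_zero] using this
  let S : Finset (Basis.ofVectorSpaceIndex ℚ ℝ) :=
    Finset.univ.biUnion fun t : G.PairIndex => (b.repr (x t)).support
  have hsum : x = ∑ h ∈ S, (b h : ℝ) • y h := by
    ext t
    have h1 : (b.repr (x t)).support ⊆ S :=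
      Finset.subset_biUnion_of_mem (fun t : G.PairIndex => (b.repr (x t)).support)
        (Finset.mem_univ t)
    have h2 := b.linearCombination_repr (x t)
    rw [Finsupp.linearCombination_apply, Finsupp.sum_of_support_subset _ h1 _ (by simp)] at h2
    rw [← h2]
    simp only [WithLp.ofLp_sum, Finset.sum_apply, PiLp.smul_apply, y, smul_eq_mul]
    refine Finset.sum_congr rfl fun h _ => ?_
    rw [Rat.smul_def, mul_comm]
    rfl
  rw [hsum]
  exact Submodule.sum_mem _ fun h _ => Submodule.smul_mem _ _
    (G.mem_span_pairLattice_of_rat (hy h) (fun t => b.coord h (x t)) fun t => rfl)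

instance discreteTopology_pairLattice : DiscreteTopology G.pairLattice := by
  classical
  let b := (EuclideanSpace.basisFun G.PairIndex ℝ).toBasis
  have hle : (G.pairLattice : Set G.PairSpace) ⊆ Submodule.span ℤ (Set.range b) := by
    intro x hx
    refine (b.mem_span_iff_repr_mem ℤ x).2 fun t => ?_
    obtain ⟨m, hm⟩ := hx.2 t
    refine ⟨m, ?_⟩
    simp [b, hm]
  have : DiscreteTopology (Submodule.span ℤ (Set.range b) : Set G.PairSpace) :=
    inferInstanceAs (DiscreteTopology (Submodule.span ℤ (Set.range b)))
  exact DiscreteTopology.of_subset this hle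

end Lattice

/-! ### The exponent as an entropy sum, and its values at the uniform point -/

section Forms

variable [Fintype E(G)]

/-- The pairs of a vertex and an edge at this vertex. -/
abbrev Dart : Type (max u v) :=
  Σ i : V(G), G.EdgesAt i

/-- The index set of the terms of `φ`. -/
abbrev FactorIndex : Type (max u v) :=
  (G.Dart ⊕ G.Dart ⊕ G.Dart) ⊕ G.PairIndex

open scoped Classical in
/-- The linear functionals `σ`, `τ`, `γ` and the coordinates. -/
noncomputable def pairForm : G.FactorIndex → G.PairSpace →L[ℝ] ℝ
  | Sum.inl (Sum.inl ⟨i, e⟩) =>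
      ∑ f : G.EdgesAt i with f ≠ e, EuclideanSpace.proj (𝕜 := ℝ) (⟨i, e, f⟩ : G.PairIndex)
  | Sum.inl (Sum.inr (Sum.inl ⟨i, e⟩)) =>
      ∑ f : G.EdgesAt i with f ≠ e, EuclideanSpace.proj (𝕜 := ℝ) (⟨i, f, e⟩ : G.PairIndex)
  | Sum.inl (Sum.inr (Sum.inr ⟨i, e⟩)) =>
      ∑ f : G.EdgesAt i with f ≠ e, ∑ f' : G.EdgesAt i with f' ≠ e,
        EuclideanSpace.proj (𝕜 := ℝ) (⟨i, f, f'⟩ : G.PairIndex)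
  | Sum.inr t => EuclideanSpace.proj (𝕜 := ℝ) t

open scoped Classical in
/-- The weights of the terms of `φ`. -/
noncomputable def pairWeight : G.FactorIndex → ℝ
  | Sum.inl _ => 1 / 2
  | Sum.inr t => if t.2.1 = t.2.2 then -(1 / 2) else -1

variable {G}

@[simp] theorem pairForm_sigma (p : G.Dart) (x : G.PairSpace) :
    G.pairForm (Sum.inl (Sum.inl p)) x = G.pairSigma x p.1 p.2 := by
  simp [pairForm, pairSigma, _root_.sum_apply]

@[simp] theorem pairForm_tau (p : G.Dart) (x : G.PairSpace) :
    G.pairForm (Sum.inl (Sum.inr (Sum.inl p))) x = G.pairTau x p.1 p.2 := by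
  simp [pairForm, pairTau, _root_.sum_apply]

@[simp] theorem pairForm_gamma (p : G.Dart) (x : G.PairSpace) :
    G.pairForm (Sum.inl (Sum.inr (Sum.inr p))) x = G.pairGamma x p.1 p.2 := by
  simp [pairForm, pairGamma, _root_.sum_apply]

@[simp] theorem pairForm_coord (t : G.PairIndex) (x : G.PairSpace) :
    G.pairForm (Sum.inr t) x = x t := rfl

omit [Fintype E(G)] in
theorem sum_eq_add_sum_ne {ι : Type*} [Fintype ι] (e : ι) [DecidablePred fun f : ι => f ≠ e]
    (y : ι → ℝ) : ∑ f, y f = y e + ∑ f with f ≠ e, y f := by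
  classical
  rw [← Finset.add_sum_erase _ _ (Finset.mem_univ e), ← Finset.filter_ne']
  congr

theorem sum_row_eq (x : G.PairSpace) (i : V(G)) (e : G.EdgesAt i) :
    ∑ f, x ⟨i, e, f⟩ = x ⟨i, e, e⟩ + G.pairSigma x i e := by
  classical
  exact sum_eq_add_sum_ne e fun f => x ⟨i, e, f⟩

theorem sum_col_eq (x : G.PairSpace) (i : V(G)) (e : G.EdgesAt i) :
    ∑ f, x ⟨i, f, e⟩ = x ⟨i, e, e⟩ + G.pairTau x i e := by
  classical
  exact sum_eq_add_sum_ne e fun f => x ⟨i, f, e⟩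

/-- The pairs at `i` are split by which of their components equal `e`. On `W` the four parts add up
to 1, which bounds the forms and later normalizes the vectors used in degree three. -/
theorem sum_sum_eq (x : G.PairSpace) (i : V(G)) (e : G.EdgesAt i) :
    ∑ e', ∑ f, x ⟨i, e', f⟩ =
      x ⟨i, e, e⟩ + G.pairSigma x i e + G.pairTau x i e + G.pairGamma x i e := by
  classical
  rw [sum_eq_add_sum_ne e, sum_row_eq, Finset.sum_congr rfl fun e' _ =>
    sum_eq_add_sum_ne e fun f => x ⟨i, e', f⟩, Finset.sum_add_distrib, pairTau, pairGamma]
  ring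

open scoped Classical in
/-- Weighted sums over the terms of `φ`. -/
theorem sum_pairWeight [Fintype V(G)] (y : G.FactorIndex → ℝ) :
    ∑ k, G.pairWeight k * y k = ∑ i : V(G), ∑ e : G.EdgesAt i,
      (1 / 2 * (y (Sum.inl (Sum.inl ⟨i, e⟩)) + y (Sum.inl (Sum.inr (Sum.inl ⟨i, e⟩))) +
        y (Sum.inl (Sum.inr (Sum.inr ⟨i, e⟩)))) - 1 / 2 * y (Sum.inr ⟨i, e, e⟩) -
        ∑ f : G.EdgesAt i with f ≠ e, y (Sum.inr ⟨i, e, f⟩)) := by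
  have h1 : ∀ (i : V(G)) (e : G.EdgesAt i), ∑ f, G.pairWeight (Sum.inr ⟨i, e, f⟩) *
      y (Sum.inr ⟨i, e, f⟩) = -(1 / 2 * y (Sum.inr ⟨i, e, e⟩)) -
        ∑ f : G.EdgesAt i with f ≠ e, y (Sum.inr ⟨i, e, f⟩) := by
    intro i e
    rw [sum_eq_add_sum_ne e, sub_eq_add_neg, ← Finset.sum_neg_distrib]
    congr 1
    · simp [pairWeight]
    · refine Finset.sum_congr rfl fun f hf => ?_
      have : e ≠ f := fun h => (Finset.mem_filter.1 hf).2 h.symm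
      simp [pairWeight, this]
  simp only [Fintype.sum_sum_type, Fintype.sum_sigma, Fintype.sum_prod_type, h1,
    ← Finset.sum_add_distrib]
  refine Finset.sum_congr rfl fun i _ => Finset.sum_congr rfl fun e _ => ?_
  simp only [pairWeight]
  ring

theorem pairPhi_eq_entropySum [Fintype V(G)] :
    G.pairPhi = entropySum G.pairForm G.pairWeight := by
  classical
  funext x
  rw [entropySum, sum_pairWeight, pairPhi, Finset.mul_sum]
  refine Finset.sum_congr rfl fun i _ => ?_
  rw [Finset.mul_sum]
  refine Finset.sum_congr rfl fun e _ => ?_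
  simp only [pairForm_sigma, pairForm_tau, pairForm_gamma, pairForm_coord]
  ring

theorem isCompact_pairK_inter_pairW [Fintype V(G)] : IsCompact (G.pairK ∩ G.pairW) := by
  have hK : IsCompact G.pairK := by
    have h1 : IsCompact (Set.pi Set.univ fun _ : G.PairIndex => Set.Icc (0 : ℝ) 1) :=
      isCompact_univ_pi fun _ => isCompact_Icc
    have h2 := (EuclideanSpace.equiv G.PairIndex ℝ).symm.toHomeomorph.isCompact_image.2 h1
    convert h2
    ext x
    constructor
    · intro hx
      exact ⟨x.ofLp, fun t _ => hx t, rfl⟩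
    · rintro ⟨y, hy, rfl⟩ t
      exact hy t (Set.mem_univ t)
  refine hK.inter_right ?_
  have h1 : IsClosed (G.VStar : Set G.PairSpace) := G.VStar.closed_of_finiteDimensional
  have h2 : G.pairW = (G.VStar : Set G.PairSpace) ∩ ⋂ i : V(G),
      {x | ∑ e : G.EdgesAt i, ∑ f : G.EdgesAt i, x ⟨i, e, f⟩ = 1} := by
    ext x
    simp [pairW]
  rw [h2]
  exact h1.inter (isClosed_iInter fun i => isClosed_eq (by fun_prop) continuous_const)

theorem pairForm_mem_Icc {x : G.PairSpace} (hx : x ∈ G.pairK ∩ G.pairW) (k : G.FactorIndex) :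
    G.pairForm k x ∈ Set.Icc (0 : ℝ) 1 := by
  classical
  obtain ⟨hK, -, hW⟩ := hx
  have h0 : ∀ t, 0 ≤ x t := fun t => (hK t).1
  have hσ : ∀ i e, 0 ≤ G.pairSigma x i e := fun i e => Finset.sum_nonneg fun _ _ => h0 _
  have hτ : ∀ i e, 0 ≤ G.pairTau x i e := fun i e => Finset.sum_nonneg fun _ _ => h0 _
  have hγ : ∀ i e, 0 ≤ G.pairGamma x i e := fun i e =>
    Finset.sum_nonneg fun _ _ => Finset.sum_nonneg fun _ _ => h0 _
  have hsum : ∀ i e, x ⟨i, e, e⟩ + G.pairSigma x i e + G.pairTau x i e + G.pairGamma x i e = 1 :=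
    fun i e => (sum_sum_eq x i e).symm.trans (hW i)
  rcases k with (⟨i, e⟩ | ⟨i, e⟩ | ⟨i, e⟩) | t
  · rw [pairForm_sigma]
    exact ⟨hσ i e, by linarith [hsum i e, hτ i e, hγ i e, h0 ⟨i, e, e⟩]⟩
  · rw [pairForm_tau]
    exact ⟨hτ i e, by linarith [hsum i e, hσ i e, hγ i e, h0 ⟨i, e, e⟩]⟩
  · rw [pairForm_gamma]
    exact ⟨hγ i e, by linarith [hsum i e, hσ i e, hτ i e, h0 ⟨i, e, e⟩]⟩
  · exact hK t

theorem card_edgesAt {d : ℕ} (hreg : G.IsRegular d) (i : V(G)) :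
    Fintype.card (G.EdgesAt i) = d := by
  rw [← hreg i.1 i.2, ← Nat.card_eq_fintype_card, ← Nat.card_coe_set_eq]
  refine Nat.card_congr ⟨fun e => ⟨e.1.1, e.2⟩, fun e => ⟨⟨e.1, e.2.edge_mem⟩, e.2⟩,
    fun _ => rfl, fun _ => rfl⟩

open scoped Classical in
theorem sum_ne_const {d : ℕ} (hreg : G.IsRegular d) (hd : 1 ≤ d) (i : V(G)) (e : G.EdgesAt i)
    (c : ℝ) : ∑ _f : G.EdgesAt i with _f ≠ e, c = (d - 1) * c := by
  rw [Finset.sum_const, Finset.filter_ne', Finset.card_erase_of_mem (Finset.mem_univ e),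
    Finset.card_univ, card_edgesAt hreg, nsmul_eq_mul, Nat.cast_sub hd, Nat.cast_one]

omit [Fintype E(G)] in
@[simp] theorem pairPoint_apply (d : ℕ) (t : G.PairIndex) : G.pairPoint d t = 1 / (d : ℝ) ^ 2 := rfl

section Regular

variable {d : ℕ} (hreg : G.IsRegular d) (hd : 3 ≤ d)
include hreg hd

theorem pairSigma_pairPoint (i : V(G)) (e : G.EdgesAt i) :
    G.pairSigma (G.pairPoint d) i e = (d - 1) / (d : ℝ) ^ 2 := by
  simp only [pairSigma, pairPoint_apply]
  rw [sum_ne_const hreg (by omega)]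
  ring

theorem pairTau_pairPoint (i : V(G)) (e : G.EdgesAt i) :
    G.pairTau (G.pairPoint d) i e = (d - 1) / (d : ℝ) ^ 2 := by
  simp only [pairTau, pairPoint_apply]
  rw [sum_ne_const hreg (by omega)]
  ring

theorem pairGamma_pairPoint (i : V(G)) (e : G.EdgesAt i) :
    G.pairGamma (G.pairPoint d) i e = (d - 1) ^ 2 / (d : ℝ) ^ 2 := by
  simp only [pairGamma, pairPoint_apply]
  rw [sum_ne_const hreg (by omega), sum_ne_const hreg (by omega)]
  ring

theorem pairForm_pairPoint_pos (k : G.FactorIndex) : 0 < G.pairForm k (G.pairPoint d) := by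
  have hd' : (3 : ℝ) ≤ d := by exact_mod_cast hd
  have h1 : (0 : ℝ) < d - 1 := by linarith
  rcases k with (⟨i, e⟩ | ⟨i, e⟩ | ⟨i, e⟩) | t
  · rw [pairForm_sigma, pairSigma_pairPoint hreg hd]; positivity
  · rw [pairForm_tau, pairTau_pairPoint hreg hd]; positivity
  · rw [pairForm_gamma, pairGamma_pairPoint hreg hd]; positivity
  · rw [pairForm_coord, pairPoint_apply]; positivity

theorem pairPoint_mem_pairW : G.pairPoint d ∈ G.pairW := by
  have hd' : (3 : ℝ) ≤ d := by exact_mod_cast hd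
  refine ⟨fun e i j h => ?_, fun i => ?_⟩
  · simp [card_edgesAt hreg]
  · simp only [pairPoint_apply, Finset.sum_const, Finset.card_univ, card_edgesAt hreg,
      nsmul_eq_mul]
    field_simp

omit hreg hd in
theorem sub_mem_pairV {x y : G.PairSpace} (hx : x ∈ G.pairW) (hy : y ∈ G.pairW) :
    x - y ∈ G.pairV := by
  refine ⟨G.VStar.sub_mem hx.1 hy.1, fun i => ?_⟩
  simp only [PiLp.sub_apply, Finset.sum_sub_distrib]
  rw [hx.2, hy.2, sub_self]

omit hreg hd in
theorem add_mem_pairW {x v : G.PairSpace} (hx : x ∈ G.pairW) (hv : v ∈ G.pairV) :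
    x + v ∈ G.pairW := by
  refine ⟨G.VStar.add_mem hx.1 hv.1, fun i => ?_⟩
  simp only [PiLp.add_apply, Finset.sum_add_distrib]
  rw [hx.2, hv.2, add_zero]

omit hreg hd in
-- The coordinates at each vertex add up to 1, so the upper bounds of the cube are automatic.
theorem mem_pairK_of_nonneg {x : G.PairSpace} (hx : x ∈ G.pairW) (h0 : ∀ t, 0 ≤ x t) :
    x ∈ G.pairK := by
  rintro ⟨i, e, f⟩
  refine ⟨h0 _, ?_⟩
  rw [← hx.2 i]
  exact (Finset.single_le_sum (f := fun f => x ⟨i, e, f⟩) (fun _ _ => h0 _)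
    (Finset.mem_univ f)).trans (Finset.single_le_sum (f := fun e => ∑ f, x ⟨i, e, f⟩)
      (fun _ _ => Finset.sum_nonneg fun _ _ => h0 _) (Finset.mem_univ e))

/-- All coordinates of the uniform point are positive, so it is interior to the cube relative to
`W`. -/
theorem eventually_pairPoint_add_mem [Fintype V(G)] {U : Submodule ℝ G.PairSpace}
    (hU : U = G.pairV) : ∀ᶠ v : U in 𝓝 0, G.pairPoint d + v ∈ G.pairK ∩ G.pairW := by
  have h1 : ∀ t : G.PairIndex, ∀ᶠ v : U in 𝓝 0, 0 < (G.pairPoint d + (v : G.PairSpace)) t := by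
    intro t
    have hc : Continuous fun v : U => (G.pairPoint d + (v : G.PairSpace)) t := by fun_prop
    refine hc.continuousAt.eventually_const_lt ?_
    have := pairForm_pairPoint_pos hreg hd (Sum.inr t)
    simpa using this
  filter_upwards [eventually_all.2 h1] with v hv
  have hW : G.pairPoint d + (v : G.PairSpace) ∈ G.pairW :=
    add_mem_pairW (pairPoint_mem_pairW hreg hd) (hU ▸ v.2)
  exact ⟨mem_pairK_of_nonneg hW fun t => (hv t).le, hW⟩

-- The value is minus the exponent of `n!` in a term: one `n!` per vertex from the multinomials, and
-- one inverse per edge, with `d g / 2` edges. This balance cancels the factors of order `n log n`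
-- in Stirling's formula.
omit hd in
theorem sum_pairWeight_mul_pairForm [Fintype V(G)] {x : G.PairSpace} (hx : x ∈ G.pairW) :
    ∑ k, G.pairWeight k * G.pairForm k x =
      -((Fintype.card V(G) : ℝ) - d * Fintype.card V(G) / 2) := by
  classical
  rw [sum_pairWeight]
  simp only [pairForm_sigma, pairForm_tau, pairForm_gamma, pairForm_coord]
  have h1 : ∀ (i : V(G)) (e : G.EdgesAt i),
      1 / 2 * (G.pairSigma x i e + G.pairTau x i e + G.pairGamma x i e) - 1 / 2 * x ⟨i, e, e⟩ -
        ∑ f : G.EdgesAt i with f ≠ e, x ⟨i, e, f⟩ = 1 / 2 - ∑ f, x ⟨i, e, f⟩ := by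
    intro i e
    have h2 := sum_sum_eq x i e
    rw [hx.2 i] at h2
    rw [sum_row_eq, pairSigma] at *
    linarith
  simp only [h1, Finset.sum_sub_distrib, hx.2, Finset.sum_const, Finset.card_univ,
    card_edgesAt hreg, nsmul_eq_mul]
  ring

/-- Every factorial of weight `w` contributes `w / 2` to the power of `2πn`, so this sum determines
the polynomial factor. -/
theorem sum_pairWeight_eq [Fintype V(G)] :
    ∑ k, G.pairWeight k = 2 * d * Fintype.card V(G) - (d : ℝ) ^ 2 * Fintype.card V(G) := by
  classical
  have h := sum_pairWeight (G := G) fun _ => 1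
  simp only [mul_one] at h
  rw [h]
  simp only [sum_ne_const hreg (show 1 ≤ d by omega), Finset.sum_const, Finset.card_univ,
    card_edgesAt hreg, nsmul_eq_mul]
  ring

theorem entropySum_pairPoint [Fintype V(G)] :
    entropySum G.pairForm G.pairWeight (G.pairPoint d) =
      Fintype.card V(G) * ((d - 1) * Real.log (d - 1) - (d - 2) * Real.log d) := by
  classical
  have hd' : (3 : ℝ) ≤ d := by exact_mod_cast hd
  have h1 : (d - 1 : ℝ) ≠ 0 := by linarith
  have h2 : (d : ℝ) ≠ 0 := by linarith
  rw [entropySum, sum_pairWeight]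
  simp only [pairForm_sigma, pairForm_tau, pairForm_gamma, pairForm_coord,
    pairSigma_pairPoint hreg hd, pairTau_pairPoint hreg hd, pairGamma_pairPoint hreg hd,
    pairPoint_apply, sum_ne_const hreg (show 1 ≤ d by omega), Finset.sum_const, Finset.card_univ,
    card_edgesAt hreg, nsmul_eq_mul, Real.log_div h1 (pow_ne_zero 2 h2),
    Real.log_div (pow_ne_zero 2 h1) (pow_ne_zero 2 h2), Real.log_div one_ne_zero (pow_ne_zero 2 h2),
    Real.log_pow, Real.log_one]
  push_cast
  field_simp
  ring

theorem sum_pairWeight_mul_log [Fintype V(G)] :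
    ∑ k, G.pairWeight k * (1 / 2 * Real.log (G.pairForm k (G.pairPoint d))) =
      d * Fintype.card V(G) * (Real.log (d - 1) + (d - 2) * Real.log d) := by
  classical
  have hd' : (3 : ℝ) ≤ d := by exact_mod_cast hd
  have h1 : (d - 1 : ℝ) ≠ 0 := by linarith
  have h2 : (d : ℝ) ≠ 0 := by linarith
  rw [sum_pairWeight]
  simp only [pairForm_sigma, pairForm_tau, pairForm_gamma, pairForm_coord,
    pairSigma_pairPoint hreg hd, pairTau_pairPoint hreg hd, pairGamma_pairPoint hreg hd,
    pairPoint_apply, sum_ne_const hreg (show 1 ≤ d by omega), Finset.sum_const, Finset.card_univ,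
    card_edgesAt hreg, nsmul_eq_mul, Real.log_div h1 (pow_ne_zero 2 h2),
    Real.log_div (pow_ne_zero 2 h1) (pow_ne_zero 2 h2), Real.log_div one_ne_zero (pow_ne_zero 2 h2),
    Real.log_pow, Real.log_one]
  push_cast
  ring

end Regular

end Forms

end Graph

namespace Graph

universe u v

variable {α : Type u} {β : Type v} {G : Graph α β}

/-! ### From type vectors to lattice points -/

section TypeVectors

variable [Fintype E(G)]

/-- A vector of natural numbers as a point of the Euclidean space. -/
noncomputable def castVector (z : G.PairIndex → ℕ) : G.PairSpace :=
  WithLp.toLp 2 fun t => (z t : ℝ)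

omit [Fintype E(G)] in
@[simp] theorem castVector_apply (z : G.PairIndex → ℕ) (t : G.PairIndex) :
    castVector z t = z t := rfl

theorem colorCount_true_true (z : G.PairIndex → ℕ) (i : V(G)) (e : G.EdgesAt i) :
    G.colorCount z i e (true, true) = z ⟨i, e, e⟩ := by
  classical
  have : (Finset.univ.filter fun p : G.EdgesAt i × G.EdgesAt i =>
      G.pairColor i e p = (true, true)) = {(e, e)} := by
    ext ⟨a, b⟩
    simp [pairColor]
  rw [colorCount, ← Finset.sum_singleton (fun p => z ⟨i, p⟩) (e, e), ← this]

theorem colorCount_true_false (z : G.PairIndex → ℕ) (i : V(G)) (e : G.EdgesAt i) :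
    (G.colorCount z i e (true, false) : ℝ) = G.pairSigma (castVector z) i e := by
  classical
  rw [colorCount, pairSigma, Nat.cast_sum]
  symm
  refine Finset.sum_bij (fun f _ => (e, f)) ?_ ?_ ?_ ?_
  · intro f hf
    simpa [pairColor] using hf
  · intro f _ f' _ h
    exact (Prod.mk.inj h).2
  · rintro ⟨a, b⟩ h
    simp only [Finset.mem_filter, Finset.mem_univ, true_and, pairColor, Prod.mk.injEq,
      decide_eq_true_eq, decide_eq_false_iff_not] at h
    exact ⟨b, by simpa using h.2, by rw [h.1]⟩
  · intro f _
    rfl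

theorem colorCount_false_true (z : G.PairIndex → ℕ) (i : V(G)) (e : G.EdgesAt i) :
    (G.colorCount z i e (false, true) : ℝ) = G.pairTau (castVector z) i e := by
  classical
  rw [colorCount, pairTau, Nat.cast_sum]
  symm
  refine Finset.sum_bij (fun f _ => (f, e)) ?_ ?_ ?_ ?_
  · intro f hf
    simpa [pairColor] using hf
  · intro f _ f' _ h
    exact (Prod.mk.inj h).1
  · rintro ⟨a, b⟩ h
    simp only [Finset.mem_filter, Finset.mem_univ, true_and, pairColor, Prod.mk.injEq,
      decide_eq_true_eq, decide_eq_false_iff_not] at h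
    exact ⟨a, by simpa using h.1, by rw [h.2]⟩
  · intro f _
    rfl

theorem colorCount_false_false (z : G.PairIndex → ℕ) (i : V(G)) (e : G.EdgesAt i) :
    (G.colorCount z i e (false, false) : ℝ) = G.pairGamma (castVector z) i e := by
  classical
  rw [colorCount, pairGamma, Nat.cast_sum, ← Finset.sum_product']
  refine Finset.sum_congr ?_ fun _ _ => rfl
  ext ⟨a, b⟩
  simp [pairColor]

variable [Fintype V(G)]

/-- The handshake identity: every edge has two ends. -/
theorem sum_darts_eq [G.Loopless] (y : ∀ i : V(G), G.EdgesAt i → ℝ) :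
    ∑ i, ∑ e, y i e = ∑ e, (y (G.tail e) (G.atTail e) + y (G.head e) (G.atHead e)) := by
  let F : E(G) ⊕ E(G) → G.Dart :=
    Sum.elim (fun e => ⟨G.tail e, G.atTail e⟩) (fun e => ⟨G.head e, G.atHead e⟩)
  have hval : ∀ s, (F s).2.1 = Sum.elim id id s := by
    rintro (e | e) <;> rfl
  have hF : Function.Bijective F := by
    constructor
    · intro s s' h
      have h1 : Sum.elim id id s = Sum.elim id id s' := by
        rw [← hval, ← hval, h]
      rcases s with e | e <;> rcases s' with e' | e'
      · exact congrArg Sum.inl h1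
      · obtain rfl : e = e' := h1
        exact absurd (congrArg Sigma.fst h) (G.tail_ne_head e)
      · obtain rfl : e = e' := h1
        exact absurd (congrArg Sigma.fst h).symm (G.tail_ne_head e)
      · exact congrArg Sum.inr h1
    · rintro ⟨i, e, he⟩
      rcases G.eq_tail_or_eq_head he with rfl | rfl
      · exact ⟨Sum.inl e, rfl⟩
      · exact ⟨Sum.inr e, rfl⟩
  have h := hF.sum_comp fun p : G.Dart => y p.1 p.2
  rw [Fintype.sum_sigma, Fintype.sum_sum_type, ← Finset.sum_add_distrib] at h
  exact h.symm

theorem card_edgeSet_eq [G.Loopless] {d : ℕ} (hreg : G.IsRegular d) :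
    (Fintype.card E(G) : ℝ) = d * Fintype.card V(G) / 2 := by
  have h := sum_darts_eq (G := G) fun _ _ => 1
  simp only [Finset.sum_const, Finset.card_univ, card_edgesAt hreg, nsmul_eq_mul] at h
  linarith

-- The three equations of `V*` along an edge fix three of the four color counts; the fourth follows
-- because both layers have `n` vertices.
omit [Fintype V(G)] in
theorem castVector_mem_VStar_iff {n : ℕ} {z : G.PairIndex → ℕ}
    (hz : ∀ i, ∑ p, z ⟨i, p⟩ = n) : castVector z ∈ G.VStar ↔ G.IsBalanced z := by
  have hsum : ∀ i (e : G.EdgesAt i), castVector z ⟨i, e, e⟩ + G.pairSigma (castVector z) i e +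
      G.pairTau (castVector z) i e + G.pairGamma (castVector z) i e = n := by
    intro i e
    rw [← sum_sum_eq, ← hz i, Fintype.sum_prod_type]
    push_cast
    rfl
  -- the three conditions for a pair of darts of an edge
  have key : ∀ (i j : V(G)) (e : G.EdgesAt i) (e' : G.EdgesAt j),
      (castVector z ⟨i, e, e⟩ = castVector z ⟨j, e', e'⟩ ∧
        ∑ f, castVector z ⟨i, e, f⟩ = ∑ f, castVector z ⟨j, e', f⟩ ∧
        ∑ f, castVector z ⟨i, f, e⟩ = ∑ f, castVector z ⟨j, f, e'⟩) ↔
      ∀ c, G.colorCount z i e c = G.colorCount z j e' c := by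
    intro i j e e'
    rw [sum_row_eq, sum_row_eq, sum_col_eq, sum_col_eq]
    have h1 := hsum i e
    have h2 := hsum j e'
    constructor
    · rintro ⟨a1, a2, a3⟩ ⟨b, b'⟩
      have : (G.colorCount z i e (b, b') : ℝ) = G.colorCount z j e' (b, b') := by
        cases b <;> cases b'
        · rw [colorCount_false_false, colorCount_false_false]; linarith
        · rw [colorCount_false_true, colorCount_false_true]; linarith
        · rw [colorCount_true_false, colorCount_true_false]; linarith
        · rw [colorCount_true_true, colorCount_true_true]; simpa using a1
      exact_mod_cast this
    · intro h
      have c1 := h (true, true)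
      rw [colorCount_true_true, colorCount_true_true] at c1
      have c2 := congrArg (fun k : ℕ => (k : ℝ)) (h (true, false))
      have c3 := congrArg (fun k : ℕ => (k : ℝ)) (h (false, true))
      simp only [colorCount_true_false, colorCount_false_true] at c2 c3
      have c1' : castVector z ⟨i, e, e⟩ = castVector z ⟨j, e', e'⟩ := by simp [c1]
      exact ⟨c1', by rw [c1', c2], by rw [c1', c3]⟩
  constructor
  · intro h e
    exact (key _ _ _ _).1 (h e _ _ (G.isLink_tail_head e))
  · intro h e i j hij
    -- `V*` quantifies over both orientations of an edge, balance only over the chosen one.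
    rcases hij.eq_and_eq_or_eq_and_eq (G.isLink_tail_head e) with ⟨h1, h2⟩ | ⟨h1, h2⟩
    · obtain rfl : i = G.tail e := Subtype.ext h1
      obtain rfl : j = G.head e := Subtype.ext h2
      exact (key _ _ _ _).2 (h e)
    · obtain rfl : i = G.head e := Subtype.ext h1
      obtain rfl : j = G.tail e := Subtype.ext h2
      exact (key _ _ _ _).2 fun c => (h e c).symm

-- Balance allows each edge factor to be shared as a square root between its two ends. So `σ`, `τ`
-- and `γ` get weight 1/2, and `x_iee`, which also sits in a multinomial denominator, gets `1/2 -
-- 1`; the other coordinates keep weight -1.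
open Nat in
theorem typeVector_term_eq [G.Loopless] {d n : ℕ} (hreg : G.IsRegular d) {z : G.PairIndex → ℕ}
    (hb : G.IsBalanced z) :
    ((n ! : ℝ) ^ Fintype.card V(G) / ∏ i, ∏ p, ((z ⟨i, p⟩)! : ℝ)) *
        ((∏ e, ∏ c, ((G.colorCount z (G.tail e) (G.atTail e) c)! : ℝ)) /
          (n ! : ℝ) ^ Fintype.card E(G)) =
      Real.exp (((Fintype.card V(G) : ℝ) - d * Fintype.card V(G) / 2) * Real.log (n ! : ℝ) +
        ∑ k, G.pairWeight k * Real.log (⌊G.pairForm k (castVector z)⌋₊ ! : ℝ)) := by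
  classical
  have hfac : ∀ m : ℕ, (m ! : ℝ) ≠ 0 := fun m => by positivity
  have hp1 : ∏ i, ∏ p, ((z ⟨i, p⟩)! : ℝ) ≠ 0 :=
    Finset.prod_ne_zero_iff.2 fun i _ => Finset.prod_ne_zero_iff.2 fun p _ => hfac _
  have hp2 : ∏ e, ∏ c, ((G.colorCount z (G.tail e) (G.atTail e) c)! : ℝ) ≠ 0 :=
    Finset.prod_ne_zero_iff.2 fun i _ => Finset.prod_ne_zero_iff.2 fun p _ => hfac _
  have hpos : 0 < ((n ! : ℝ) ^ Fintype.card V(G) / ∏ i, ∏ p, ((z ⟨i, p⟩)! : ℝ)) *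
        ((∏ e, ∏ c, ((G.colorCount z (G.tail e) (G.atTail e) c)! : ℝ)) /
          (n ! : ℝ) ^ Fintype.card E(G)) := by
    have h1 : 0 < ∏ i, ∏ p, ((z ⟨i, p⟩)! : ℝ) :=
      Finset.prod_pos fun i _ => Finset.prod_pos fun p _ => by positivity
    have h2 : 0 < ∏ e, ∏ c, ((G.colorCount z (G.tail e) (G.atTail e) c)! : ℝ) :=
      Finset.prod_pos fun i _ => Finset.prod_pos fun p _ => by positivity
    positivity
  rw [← Real.exp_log hpos]
  congr 1
  rw [Real.log_mul (div_ne_zero (pow_ne_zero _ (hfac n)) hp1)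
    (div_ne_zero hp2 (pow_ne_zero _ (hfac n))), Real.log_div (pow_ne_zero _ (hfac n)) hp1,
    Real.log_div hp2 (pow_ne_zero _ (hfac n)), Real.log_pow, Real.log_pow, card_edgeSet_eq hreg,
    Real.log_prod (fun i _ => Finset.prod_ne_zero_iff.2 fun p _ => hfac _),
    Real.log_prod (fun i _ => Finset.prod_ne_zero_iff.2 fun p _ => hfac _)]
  have hlog1 : ∀ i, Real.log (∏ p, ((z ⟨i, p⟩)! : ℝ)) = ∑ p, Real.log ((z ⟨i, p⟩)! : ℝ) :=
    fun i => Real.log_prod fun p _ => hfac _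
  have hlog2 : ∀ e, Real.log (∏ c, ((G.colorCount z (G.tail e) (G.atTail e) c)! : ℝ)) =
      ∑ c, Real.log ((G.colorCount z (G.tail e) (G.atTail e) c)! : ℝ) :=
    fun e => Real.log_prod fun c _ => hfac _
  simp only [hlog1, hlog2]
  rw [sum_pairWeight]
  simp only [pairForm_sigma, pairForm_tau, pairForm_gamma, pairForm_coord,
    ← colorCount_true_false, ← colorCount_false_true, ← colorCount_false_false, castVector_apply,
    Nat.floor_natCast]
  let S : ∀ i : V(G), G.EdgesAt i → ℝ := fun i e =>
    ∑ c, Real.log ((G.colorCount z i e c)! : ℝ)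
  have hS : ∀ i e, S i e = Real.log ((G.colorCount z i e (true, false))! : ℝ) +
      Real.log ((G.colorCount z i e (false, true))! : ℝ) +
      Real.log ((G.colorCount z i e (false, false))! : ℝ) + Real.log ((z ⟨i, e, e⟩)! : ℝ) := by
    intro i e
    simp only [S, Fintype.sum_prod_type, Fintype.sum_bool, colorCount_true_true]
    ring
  have hdart : ∑ i, ∑ e, 1 / 2 * S i e = ∑ e, S (G.tail e) (G.atTail e) := by
    rw [sum_darts_eq fun i e => 1 / 2 * S i e]
    refine Finset.sum_congr rfl fun e _ => ?_
    have : S (G.head e) (G.atHead e) = S (G.tail e) (G.atTail e) := by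
      simp only [S, hb e]
    rw [this]; ring
  have hterm : ∀ (i : V(G)) (e : G.EdgesAt i),
      1 / 2 * (Real.log ((G.colorCount z i e (true, false))! : ℝ) +
      Real.log ((G.colorCount z i e (false, true))! : ℝ) +
      Real.log ((G.colorCount z i e (false, false))! : ℝ)) -
      1 / 2 * Real.log ((z ⟨i, e, e⟩)! : ℝ) -
      ∑ f : G.EdgesAt i with f ≠ e, Real.log ((z ⟨i, e, f⟩)! : ℝ) =
      1 / 2 * S i e - ∑ f, Real.log ((z ⟨i, e, f⟩)! : ℝ) := by
    intro i e
    rw [sum_eq_add_sum_ne e, hS]; ring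
  simp only [hterm, Finset.sum_sub_distrib]
  rw [hdart]
  simp only [Fintype.sum_prod_type, S]
  ring

/-- The second moment as a sum over a translate of the lattice. -/
theorem secondMoment_eq_tsum [G.Loopless] {d n : ℕ} (hreg : G.IsRegular d) (hn : 0 < n)
    {U : Submodule ℝ G.PairSpace} (hU : U = G.pairV) {z₀ : G.PairSpace} (hz₀ : z₀ ∈ G.VStar)
    (hsum : ∀ i : V(G), ∑ e : G.EdgesAt i, ∑ f : G.EdgesAt i, z₀ ⟨i, e, f⟩ = n)
    (h_int : ∀ t, ∃ m : ℤ, z₀ t = m) :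
    G.secondMoment n = ∑' v : ZLattice.comap ℝ G.pairLattice U.subtype,
      factorialTerm G.pairForm G.pairWeight
        ((Fintype.card V(G) : ℝ) - d * Fintype.card V(G) / 2) (G.pairK ∩ G.pairW) n
        (z₀ + (v : U)) := by
  classical
  have hn' : (n : ℝ) ≠ 0 := by positivity
  let T : Finset (G.PairIndex → ℕ) := (G.typeVectors n).filter G.IsBalanced
  have hT : ∀ z ∈ T, (∀ i, ∑ p, z ⟨i, p⟩ = n) ∧ G.IsBalanced z := fun z hz =>
    ⟨(G.mem_typeVectors).1 (Finset.mem_filter.1 hz).1, (Finset.mem_filter.1 hz).2⟩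
  have hcs : ∀ z : G.PairIndex → ℕ, (∀ i, ∑ p, z ⟨i, p⟩ = n) → ∀ i,
      ∑ e, ∑ f, castVector z ⟨i, e, f⟩ = n := by
    intro z hz i
    rw [← hz i, Fintype.sum_prod_type]
    push_cast
    rfl
  have hV : ∀ z ∈ T, castVector z - z₀ ∈ G.pairV := by
    intro z hz
    refine ⟨G.VStar.sub_mem ((castVector_mem_VStar_iff (hT z hz).1).2 (hT z hz).2) hz₀,
      fun i => ?_⟩
    simp only [PiLp.sub_apply, Finset.sum_sub_distrib]
    rw [hsum i, hcs z (hT z hz).1 i, sub_self]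
  have hL : ∀ z ∈ T, castVector z - z₀ ∈ G.pairLattice := by
    intro z hz
    refine ⟨hV z hz, fun t => ?_⟩
    obtain ⟨m, hm⟩ := h_int t
    exact ⟨z t - m, by simp [hm]⟩
  -- Balanced type vectors embed as the lattice translates `z - z₀`. Conversely, a nonzero summand
  -- forces `z₀ + v` to be a nonnegative integral point, hence a balanced type vector, so the sum
  -- over the lattice has no further terms.
  let g : T → ZLattice.comap ℝ G.pairLattice U.subtype := fun z =>
    ⟨⟨castVector z.1 - z₀, hU ▸ hV z.1 z.2⟩, hL z.1 z.2⟩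
  have hg : ∀ z : T, z₀ + ((g z : U) : G.PairSpace) = castVector z.1 := fun z =>
    add_sub_cancel z₀ _
  have hginj : Function.Injective g := by
    intro z z' h
    have h1 : castVector z.1 = castVector z'.1 := by rw [← hg, ← hg, h]
    refine Subtype.ext (funext fun t => ?_)
    have h2 : (castVector z.1) t = (castVector z'.1) t := by rw [h1]
    simpa using h2
  rw [← hginj.tsum_eq (f := fun v : ZLattice.comap ℝ G.pairLattice U.subtype =>
    factorialTerm G.pairForm G.pairWeight
        ((Fintype.card V(G) : ℝ) - d * Fintype.card V(G) / 2) (G.pairK ∩ G.pairW) n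
        (z₀ + ((v : U) : G.PairSpace)))]
  · rw [secondMoment_eq_sum, tsum_fintype, ← Finset.sum_coe_sort]
    refine Finset.sum_congr rfl fun z _ => ?_
    rw [hg, typeVector_term_eq hreg (hT z.1 z.2).2, factorialTerm, Set.indicator_of_mem]
    have hW : (n : ℝ)⁻¹ • castVector z.1 ∈ G.pairW := by
      refine ⟨G.VStar.smul_mem _ ((castVector_mem_VStar_iff (hT z.1 z.2).1).2 (hT z.1 z.2).2),
        fun i => ?_⟩
      simp only [PiLp.smul_apply, smul_eq_mul, ← Finset.mul_sum]
      rw [hcs z.1 (hT z.1 z.2).1 i, inv_mul_cancel₀ hn']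
    refine ⟨mem_pairK_of_nonneg hW fun t => ?_, hW⟩
    simp only [PiLp.smul_apply, smul_eq_mul, castVector_apply]
    positivity
  · intro v hv
    have hmem : (n : ℝ)⁻¹ • (z₀ + ((v : U) : G.PairSpace)) ∈ G.pairK ∩ G.pairW := by
      by_contra h
      exact hv (Set.indicator_of_notMem (s := {z | (n : ℝ)⁻¹ • z ∈ G.pairK ∩ G.pairW}) h _)
    set y := z₀ + ((v : U) : G.PairSpace) with hy
    have hyn : y = (n : ℝ) • ((n : ℝ)⁻¹ • y) := by
      rw [smul_smul, mul_inv_cancel₀ hn', one_smul]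
    have hy0 : ∀ t, 0 ≤ y t := by
      intro t
      rw [hyn, PiLp.smul_apply, smul_eq_mul]
      exact mul_nonneg (by positivity) (hmem.1 t).1
    have hyint : ∀ t, ∃ k : ℕ, y t = k := by
      intro t
      obtain ⟨m, hm⟩ := h_int t
      have hvL : ((v : U) : G.PairSpace) ∈ G.pairLattice := v.2
      obtain ⟨m', hm'⟩ := hvL.2 t
      have h1 : y t = ((m + m' : ℤ) : ℝ) := by
        rw [hy, PiLp.add_apply, hm, hm']; push_cast; rfl
      have h2 : 0 ≤ m + m' := by
        have := hy0 t
        rw [h1] at this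
        exact Int.cast_nonneg_iff.1 this
      obtain ⟨k, hk⟩ := Int.eq_ofNat_of_zero_le h2
      exact ⟨k, by rw [h1, hk]; simp⟩
    choose z hz using hyint
    have hzy : castVector z = y := by
      ext t
      rw [hz t, castVector_apply]
    have hzsum : ∀ i, ∑ p, z ⟨i, p⟩ = n := by
      intro i
      have h1 : ∑ e, ∑ f, y ⟨i, e, f⟩ = n := by
        have h2 := hmem.2.2 i
        simp only [PiLp.smul_apply, smul_eq_mul, ← Finset.mul_sum] at h2
        rwa [inv_mul_eq_one₀ hn', eq_comm] at h2
      rw [Fintype.sum_prod_type]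
      simp only [hz] at h1
      exact_mod_cast h1
    have hzV : castVector z ∈ G.VStar := by
      rw [hzy, hyn]
      exact G.VStar.smul_mem _ hmem.2.1
    have hzT : z ∈ T := Finset.mem_filter.2
      ⟨(G.mem_typeVectors).2 hzsum, (castVector_mem_VStar_iff hzsum).1 hzV⟩
    refine ⟨⟨z, hzT⟩, ?_⟩
    refine Subtype.ext (Subtype.ext ?_)
    show castVector z - z₀ = ((v : U) : G.PairSpace)
    rw [hzy, hy, add_sub_cancel_left]

end TypeVectors

end Graph

/-! ### The asymptotic formula for general `d` -/

namespace Graph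

universe u v

variable {α : Type u} {β : Type v} {G : Graph α β} [Fintype V(G)] [Fintype E(G)]

-- Taking the same matching twice puts the values `n f e` on the diagonal `(e, e)` and 0 elsewhere.
-- Such a point fixes the translate of the lattice that carries the type vectors.
omit [Fintype V(G)] in
theorem exists_integral_point {n : ℕ} (h : G.IsAdmissible n) : ∃ z : G.PairSpace, z ∈ G.VStar ∧
    (∀ i : V(G), ∑ e : G.EdgesAt i, ∑ f : G.EdgesAt i, z ⟨i, e, f⟩ = n) ∧
    ∀ t, ∃ m : ℤ, z t = m := by
  classical
  obtain ⟨f, ⟨-, hf⟩, h_int⟩ := h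
  refine ⟨WithLp.toLp 2 fun t => if t.2.1 = t.2.2 then n * f t.2.1.1 else 0, ?_, ?_, ?_⟩
  · intro e i j hij
    simp only [Finset.sum_ite_eq, Finset.sum_ite_eq', Finset.mem_univ, if_true]
    exact ⟨rfl, rfl, rfl⟩
  · intro i
    simp only [Finset.sum_ite_eq, Finset.mem_univ, if_true]
    rw [← Finset.mul_sum, hf i, mul_one]
  · intro t
    simp only
    split_ifs
    · exact h_int _
    · exact ⟨0, by simp⟩

omit [Fintype V(G)] in
theorem exists_pairForm_eq_intCast {x : G.PairSpace} (hx : ∀ t, ∃ m : ℤ, x t = m)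
    (k : G.FactorIndex) : ∃ m : ℤ, G.pairForm k x = m := by
  choose m hm using hx
  rcases k with (⟨i, e⟩ | ⟨i, e⟩ | ⟨i, e⟩) | t
  · rw [pairForm_sigma, pairSigma]
    simp only [hm]
    exact ⟨_, (Int.cast_sum _ _).symm⟩
  · rw [pairForm_tau, pairTau]
    simp only [hm]
    exact ⟨_, (Int.cast_sum _ _).symm⟩
  · rw [pairForm_gamma, pairGamma]
    simp only [hm, ← Int.cast_sum]
    exact ⟨_, rfl⟩
  · exact ⟨m t, hm t⟩

/-- The asymptotic formula for the second moment. -/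
theorem secondMoment_isEquivalent [G.Loopless] {d : ℕ} (hd : 3 ≤ d) (hreg : G.IsRegular d)
    (hmax : HasUniqueMaxOnAt G.pairPhi (G.pairK ∩ G.pairW) (G.pairPoint d))
    (hdet : G.detNegHessian d ≠ 0) :
    Asymptotics.IsEquivalent (atTop ⊓ 𝓟 {n : ℕ | G.IsAdmissible n})
      (fun n => G.secondMoment n) (fun n => G.secondMomentMainTerm d n) := by
  classical
  -- The span of the lattice is used instead of `pairV`, to which it is equal, because `latticeDet`
  -- measures the covolume in the span.
  set U : Submodule ℝ G.PairSpace := Submodule.span ℝ (G.pairLattice : Set G.PairSpace) with hUdef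
  have hU : U = G.pairV := G.span_pairLattice
  let _ : MeasurableSpace U := borel _
  have : BorelSpace U := ⟨rfl⟩
  set Λ : Submodule ℤ U := ZLattice.comap ℝ G.pairLattice U.subtype with hΛ
  have : DiscreteTopology Λ :=
    ZLattice.comap_discreteTopology ℝ G.pairLattice U.subtypeL.continuous Subtype.val_injective
  have : IsZLattice ℝ Λ := ⟨by
    rw [eq_top_iff]
    exact Submodule.span_span_coe_preimage.symm.le⟩
  have hrank : finrank ℝ U = finrank ℤ G.pairLattice := by
    rw [← ZLattice.rank ℝ Λ]
    exact (Submodule.comapSubtypeEquivOfLe (p := G.pairLattice) (q := U.restrictScalars ℤ)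
      Submodule.subset_span).finrank_eq
  have hcov : latticeDet G.pairLattice = ZLattice.covolume Λ := by
    rw [latticeDet, ← (stdOrthonormalBasis ℝ U).addHaar_eq_volume]
  have hdet' : G.detNegHessian d =
      bilinDetOn (-hessian (entropySum G.pairForm G.pairWeight) (G.pairPoint d)) U := by
    rw [detNegHessian, pairPhi_eq_entropySum, hU]
  rw [pairPhi_eq_entropySum] at hmax
  set g : ℝ := (Fintype.card V(G) : ℝ) with hg
  set w₀ : ℝ := g - d * g / 2 with hw₀
  have hx := pairForm_pairPoint_pos hreg hd
  have hmem := pairPoint_mem_pairW hreg hd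
  have hnear := eventually_pairPoint_add_mem hreg hd hU
  -- For inadmissible `n` the value `n x⁰` is a default that keeps `z n - n x⁰` in `U`; the filter
  -- never sees it.
  let z : ℕ → G.PairSpace := fun n =>
    if h : G.IsAdmissible n then (exists_integral_point h).choose else (n : ℝ) • G.pairPoint d
  have hz : ∀ n, z n - (n : ℝ) • G.pairPoint d ∈ U := by
    intro n
    rw [hU]
    by_cases h : G.IsAdmissible n
    · simp only [z, dif_pos h]
      obtain ⟨h1, h2, -⟩ := (exists_integral_point h).choose_spec
      refine ⟨G.VStar.sub_mem h1 (G.VStar.smul_mem _ hmem.1), fun i => ?_⟩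
      simp only [PiLp.sub_apply, PiLp.smul_apply, smul_eq_mul, Finset.sum_sub_distrib,
        ← Finset.mul_sum]
      rw [h2, hmem.2, mul_one, sub_self]
    · simp only [z, dif_neg h, sub_self]
      exact G.pairV.zero_mem
  have hl : atTop ⊓ 𝓟 {n : ℕ | G.IsAdmissible n} ≤ atTop := inf_le_left
  have hadm : ∀ᶠ n in atTop ⊓ 𝓟 {n : ℕ | G.IsAdmissible n}, G.IsAdmissible n :=
    inf_le_right (α := Filter ℕ) (mem_principal_self _)
  have hlim := tendsto_factorialTerm_sum U Λ G.pairForm G.pairWeight w₀ hx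
    isCompact_pairK_inter_pairW (fun y hy => pairForm_mem_Icc hy)
    (fun y hy => hU ▸ sub_mem_pairV hy.2 hmem) hnear
    (fun y hy => sum_pairWeight_mul_pairForm hreg hy.2) hmax.2 (hdet' ▸ hdet) hl z hz (by
      filter_upwards [hadm] with n hn v hv
      refine exists_pairForm_eq_intCast fun t => ?_
      simp only [z, dif_pos hn]
      obtain ⟨m, hm⟩ := (exists_integral_point hn).choose_spec.2.2 t
      have hvL : (v : G.PairSpace) ∈ G.pairLattice := hv
      obtain ⟨m', hm'⟩ := hvL.2 t
      exact ⟨m + m', by rw [PiLp.add_apply, hm, hm']; push_cast; rfl⟩)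
  -- Positivity, not just nonvanishing, is needed for the square root in the constant to be nonzero.
  have hpd : 0 < G.detNegHessian d := by
    have hmaxU : ∀ᶠ v : U in 𝓝 0, entropySum G.pairForm G.pairWeight (G.pairPoint d + v) ≤
        entropySum G.pairForm G.pairWeight (G.pairPoint d) := by
      filter_upwards [hnear] with v hv
      by_cases h : G.pairPoint d + (v : G.PairSpace) = G.pairPoint d
      · rw [h]
      · exact (hmax.2 _ hv h).le
    rw [hdet']
    exact (bilinDetOn_posDef _ U (fun u v => by
      simp only [_root_.neg_apply, hessian_entropySum _ _ (fun k => (hx k).ne')]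
      congr 1
      exact Finset.sum_congr rfl fun k _ => by ring)
      (fun v hv => by simpa using hessian_entropySum_nonpos _ _ hx U hmaxU hv)
      (hdet' ▸ hdet)).det_pos
  have hd' : (3 : ℝ) ≤ d := by exact_mod_cast hd
  have hd1 : (0 : ℝ) < d - 1 := by linarith
  rw [← hdet', ← hcov, sum_pairWeight_mul_log hreg hd, sum_pairWeight_eq hreg hd,
    entropySum_pairPoint hreg hd] at hlim
  have hcov0 : latticeDet G.pairLattice ≠ 0 := by
    rw [hcov]; exact ZLattice.covolume_ne_zero Λ volume
  set A := Real.exp (d * Fintype.card V(G) * (Real.log (d - 1) + (d - 2) * Real.log d)) /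
    (latticeDet G.pairLattice * √(G.detNegHessian d)) with hA
  have hA0 : A ≠ 0 := by
    have : √(G.detNegHessian d) ≠ 0 := by positivity
    exact div_ne_zero (Real.exp_ne_zero _) (mul_ne_zero hcov0 this)
  refine Asymptotics.isEquivalent_of_tendsto_one ?_
  have hlim2 := hlim.div_const A
  rw [div_self hA0] at hlim2
  refine hlim2.congr' ?_
  filter_upwards [hadm, hl (eventually_gt_atTop 0)] with n hn hn0
  have hn' : (0 : ℝ) < n := by exact_mod_cast hn0
  have hS : G.secondMoment n = ∑' v : Λ, factorialTerm G.pairForm G.pairWeight w₀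
      (G.pairK ∩ G.pairW) n (z n + ((v : U) : G.PairSpace)) := by
    obtain ⟨h1, h2, h3⟩ := (exists_integral_point hn).choose_spec
    have := secondMoment_eq_tsum hreg hn0 hU h1 h2 h3
    simp only [z, dif_pos hn]
    exact this
  have hexp1 : Real.exp (d * Fintype.card V(G) * (Real.log (d - 1) + (d - 2) * Real.log d)) =
      (((d : ℝ) - 1) * (d : ℝ) ^ (d - 2)) ^ (d * Fintype.card V(G)) := by
    rw [← Real.exp_log (show 0 < (((d : ℝ) - 1) * (d : ℝ) ^ (d - 2)) ^ (d * Fintype.card V(G)) by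
      positivity), Real.log_pow, Real.log_mul hd1.ne' (by positivity), Real.log_pow,
      Nat.cast_sub (by omega)]
    push_cast
    rfl
  have hexp2 : Real.exp (n * (Fintype.card V(G) * ((d - 1) * Real.log (d - 1) -
      (d - 2) * Real.log d))) =
      (((d : ℝ) - 1) ^ (d - 1) / (d : ℝ) ^ (d - 2)) ^ (Fintype.card V(G) * n) := by
    rw [← Real.exp_log (show 0 < (((d : ℝ) - 1) ^ (d - 1) / (d : ℝ) ^ (d - 2)) ^
      (Fintype.card V(G) * n) by positivity), Real.log_pow, Real.log_div (by positivity)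
      (by positivity), Real.log_pow, Real.log_pow, Nat.cast_sub (by omega), Nat.cast_sub (by omega)]
    congr 1
    push_cast
    ring
  rw [Pi.div_apply, ← hS]
  have hmain : G.secondMomentMainTerm d n = A *
      (2 * Real.pi * n) ^ ((w₀ + (2 * d * g - (d : ℝ) ^ 2 * g) + finrank ℝ U) / 2) *
      Real.exp (n * (Fintype.card V(G) * ((d - 1) * Real.log (d - 1) -
      (d - 2) * Real.log d))) := by
    simp only [secondMomentMainTerm]
    rw [hA, hexp1, hexp2, hrank]
    congr 3
    rw [hw₀, hg]
    ring
  rw [hmain, hg, Real.exp_neg, Real.rpow_neg (by positivity)]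
  field_simp

end Graph

/-! ### The norm of a symmetric trilinear form on `ℝ⁴` -/

section TrilinearForm

/-- The bracket is `16 (a² + s + δ²)² - 9 ((2aδ + s)² + a⁴ + 4a² s)` with `s` in the role of `b² +
c²`. Completing the square in `s` leaves a remainder with a double root at the extremal ratio `a =
2δ`. -/
theorem three_variable_form_eq (a δ s : ℝ) :
    7 * (7 * s ^ 2 + s * (-4 * a ^ 2 - 36 * a * δ + 32 * δ ^ 2) +
      (7 * a ^ 4 - 4 * a ^ 2 * δ ^ 2 + 16 * δ ^ 4)) =
    (7 * s - (2 * a ^ 2 + 18 * a * δ - 16 * δ ^ 2)) ^ 2 +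
      9 * ((a - 2 * δ) ^ 2 * (5 * a ^ 2 + 12 * a * δ - 4 * δ ^ 2)) := by
  ring

/-- Either the quadratic factor of the remainder is positive and the completed square decides, or
`a² ≤ 4/5 δ²`; then the coefficient of `s` and the part free of `s` are both nonnegative. -/
theorem three_variable_form_nonneg {a δ s : ℝ} (ha : 0 ≤ a) (hδ : 0 ≤ δ) (hs : 0 ≤ s) :
    0 ≤ 7 * s ^ 2 + s * (-4 * a ^ 2 - 36 * a * δ + 32 * δ ^ 2) +
      (7 * a ^ 4 - 4 * a ^ 2 * δ ^ 2 + 16 * δ ^ 4) ∧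
    (7 * s ^ 2 + s * (-4 * a ^ 2 - 36 * a * δ + 32 * δ ^ 2) +
      (7 * a ^ 4 - 4 * a ^ 2 * δ ^ 2 + 16 * δ ^ 4) = 0 → a = 2 * δ ∧ s = 4 * δ ^ 2) := by
  have e := three_variable_form_eq a δ s
  rcases lt_or_ge 0 (5 * a ^ 2 + 12 * a * δ - 4 * δ ^ 2) with h | h
  · have h1 : 0 ≤ (a - 2 * δ) ^ 2 * (5 * a ^ 2 + 12 * a * δ - 4 * δ ^ 2) :=
      mul_nonneg (sq_nonneg _) h.le
    have h2 := sq_nonneg (7 * s - (2 * a ^ 2 + 18 * a * δ - 16 * δ ^ 2))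
    refine ⟨by linarith, fun h0 => ?_⟩
    rw [h0] at e
    have h3 : (a - 2 * δ) ^ 2 * (5 * a ^ 2 + 12 * a * δ - 4 * δ ^ 2) = 0 := by linarith
    have h4 : (7 * s - (2 * a ^ 2 + 18 * a * δ - 16 * δ ^ 2)) ^ 2 = 0 := by linarith
    have h5 : a = 2 * δ := by
      rcases mul_eq_zero.1 h3 with h3 | h3
      · linarith [pow_eq_zero_iff (two_ne_zero) |>.1 h3]
      · linarith
    have h6 := pow_eq_zero_iff (two_ne_zero) |>.1 h4
    refine ⟨h5, ?_⟩
    rw [h5] at h6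
    linarith
  · have haδ : 0 ≤ a * δ := mul_nonneg ha hδ
    have ha2 : a ^ 2 ≤ 4 / 5 * δ ^ 2 := by nlinarith
    have h1 : 0 ≤ s * (-4 * a ^ 2 - 36 * a * δ + 32 * δ ^ 2) := by
      refine mul_nonneg hs ?_
      nlinarith [sq_nonneg a, sq_nonneg δ]
    have h2 : 4 * a ^ 2 * δ ^ 2 ≤ 4 * δ ^ 4 := by
      nlinarith [mul_le_mul_of_nonneg_right ha2 (sq_nonneg δ), sq_nonneg (δ ^ 2)]
    have h3 : 0 ≤ a ^ 4 := by positivity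
    have h4 : 0 ≤ δ ^ 4 := by positivity
    have h5 : 0 ≤ s ^ 2 := by positivity
    refine ⟨by linarith, fun h0 => ?_⟩
    have hδ0 : δ = 0 := by
      have : δ ^ 4 = 0 := by linarith
      exact pow_eq_zero_iff (four_ne_zero) |>.1 this
    have hs0 : s = 0 := by
      have : s ^ 2 = 0 := by linarith
      exact pow_eq_zero_iff (two_ne_zero) |>.1 this
    have ha0 : a = 0 := by
      have : a ^ 4 = 0 := by linarith
      exact pow_eq_zero_iff (four_ne_zero) |>.1 this
    simp [hδ0, hs0, ha0]

/-- The squared norm of the vector of partial derivatives of `3 δ a² + 6 a b c`. -/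
theorem quartic_le (a b c δ : ℝ) :
    (2 * a * δ + 2 * b * c) ^ 2 + (a ^ 2) ^ 2 + (2 * a * b) ^ 2 + (2 * a * c) ^ 2 ≤
      16 / 9 * (a ^ 2 + b ^ 2 + c ^ 2 + δ ^ 2) ^ 2 := by
  have h1 := (three_variable_form_nonneg (abs_nonneg a) (abs_nonneg δ)
    (show 0 ≤ b ^ 2 + c ^ 2 by positivity)).1
  have ha : |a| ^ 2 = a ^ 2 := sq_abs a
  have hδ : |δ| ^ 2 = δ ^ 2 := sq_abs δ
  have h2 : (2 * a * δ + 2 * b * c) ^ 2 ≤ (2 * |a| * |δ| + (b ^ 2 + c ^ 2)) ^ 2 := by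
    refine sq_le_sq' ?_ ?_
    · have := neg_abs_le (a * δ)
      rw [abs_mul] at this
      nlinarith [sq_nonneg (b + c)]
    · have := le_abs_self (a * δ)
      rw [abs_mul] at this
      nlinarith [sq_nonneg (b - c)]
  rw [show |a| ^ 4 = (|a| ^ 2) ^ 2 by ring, show |δ| ^ 4 = (|δ| ^ 2) ^ 2 by ring, ha, hδ] at h1
  have h3 : (2 * |a| * |δ| + (b ^ 2 + c ^ 2)) ^ 2 = 4 * (a ^ 2 * δ ^ 2) +
      4 * (|a| * |δ|) * (b ^ 2 + c ^ 2) + (b ^ 2 + c ^ 2) ^ 2 := by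
    rw [← ha, ← hδ]; ring
  nlinarith

/-- Equality must also hold in `2bc ≤ b² + c²`, so `b = c`, and the three-variable case gives `a =
2δ` and `2b² = 4δ²`. -/
theorem eq_of_quartic_eq {a b c δ : ℝ} (ha : 0 ≤ a) (hb : 0 ≤ b) (hc : 0 ≤ c) (hδ : 0 ≤ δ)
    (h : (2 * a * δ + 2 * b * c) ^ 2 + (a ^ 2) ^ 2 + (2 * a * b) ^ 2 + (2 * a * c) ^ 2 =
      16 / 9 * (a ^ 2 + b ^ 2 + c ^ 2 + δ ^ 2) ^ 2) :
    a = 2 * δ ∧ b = √2 * δ ∧ c = √2 * δ := by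
  obtain ⟨h1, h2⟩ := three_variable_form_nonneg ha hδ (show 0 ≤ b ^ 2 + c ^ 2 by positivity)
  have hbc := mul_nonneg hb hc
  have had := mul_nonneg ha hδ
  have hle : 2 * a * δ + 2 * b * c ≤ 2 * a * δ + (b ^ 2 + c ^ 2) := by
    nlinarith [sq_nonneg (b - c)]
  have h3 : (2 * a * δ + 2 * b * c) ^ 2 ≤ (2 * a * δ + (b ^ 2 + c ^ 2)) ^ 2 :=
    pow_le_pow_left₀ (by nlinarith) hle 2
  obtain ⟨h4, h5⟩ := h2 (by nlinarith)
  have h6 : (2 * a * δ + 2 * b * c) ^ 2 = (2 * a * δ + (b ^ 2 + c ^ 2)) ^ 2 := by nlinarith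
  have h7 : 2 * a * δ + 2 * b * c = 2 * a * δ + (b ^ 2 + c ^ 2) :=
    (pow_left_inj₀ (by nlinarith) (by nlinarith) two_ne_zero).1 h6
  have h8 : b = c := by
    have : (b - c) ^ 2 = 0 := by nlinarith
    linarith [pow_eq_zero_iff (two_ne_zero) |>.1 this]
  have h9 : b = √2 * δ := by
    have h10 : b ^ 2 = (√2 * δ) ^ 2 := by
      rw [mul_pow, Real.sq_sqrt (by norm_num)]
      rw [← h8] at h5
      linarith
    exact (pow_left_inj₀ hb (by positivity) two_ne_zero).1 h10
  exact ⟨h4, h9, h8 ▸ h9⟩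

/-- The symmetric trilinear form with diagonal `3 δ a² + 6 a b c`, for `u = (a, b, c, δ)`. -/
def triForm (u v w : Fin 4 → ℝ) : ℝ :=
  (u 3 * v 0 + u 0 * v 3 + u 1 * v 2 + u 2 * v 1) * w 0 + (u 0 * v 2 + u 2 * v 0) * w 1 +
    (u 0 * v 1 + u 1 * v 0) * w 2 + u 0 * v 0 * w 3

/-- The squared Euclidean norm. -/
def normSqFour (u : Fin 4 → ℝ) : ℝ :=
  u 0 ^ 2 + u 1 ^ 2 + u 2 ^ 2 + u 3 ^ 2

/-- For fixed `u` the form is linear in `w`; this is Cauchy–Schwarz against its coefficient vector.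
-/
theorem triForm_sq_le (u w : Fin 4 → ℝ) :
    triForm u u w ^ 2 ≤ ((2 * u 0 * u 3 + 2 * u 1 * u 2) ^ 2 + (u 0 ^ 2) ^ 2 +
      (2 * u 0 * u 1) ^ 2 + (2 * u 0 * u 2) ^ 2) * normSqFour w := by
  have cs : ∀ p q r s p' q' r' s' : ℝ, (p * p' + q * q' + r * r' + s * s') ^ 2 ≤
      (p ^ 2 + q ^ 2 + r ^ 2 + s ^ 2) * (p' ^ 2 + r' ^ 2 + s' ^ 2 + q' ^ 2) := by
    intro p q r s p' q' r' s'
    nlinarith [sq_nonneg (p * q' - q * p'), sq_nonneg (p * r' - r * p'),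
      sq_nonneg (p * s' - s * p'), sq_nonneg (q * r' - r * q'), sq_nonneg (q * s' - s * q'),
      sq_nonneg (r * s' - s * r')]
  have h := cs (2 * u 0 * u 3 + 2 * u 1 * u 2) (u 0 ^ 2) (2 * u 0 * u 2) (2 * u 0 * u 1)
    (w 0) (w 3) (w 1) (w 2)
  have e1 : triForm u u w = (2 * u 0 * u 3 + 2 * u 1 * u 2) * w 0 + u 0 ^ 2 * w 3 +
      2 * u 0 * u 2 * w 1 + 2 * u 0 * u 1 * w 2 := by
    rw [triForm]; ring
  rw [e1, normSqFour]
  refine h.trans_eq ?_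
  ring

theorem abs_triForm_le (u : Fin 4 → ℝ) {w : Fin 4 → ℝ} (hw : normSqFour w = 1) :
    |triForm u u w| ≤ 4 / 3 * normSqFour u := by
  have h1 := triForm_sq_le u w
  have h2 := quartic_le (u 0) (u 1) (u 2) (u 3)
  rw [hw, mul_one] at h1
  refine abs_le_of_sq_le_sq ?_ (by unfold normSqFour; positivity)
  refine h1.trans (h2.trans_eq ?_)
  rw [normSqFour]
  ring

theorem triForm_polarization (u v w : Fin 4 → ℝ) :
    4 * triForm u v w = triForm (u + v) (u + v) w - triForm (u - v) (u - v) w := by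
  simp only [triForm, Pi.add_apply, Pi.sub_apply]
  ring

theorem normSqFour_parallelogram (u v : Fin 4 → ℝ) :
    normSqFour (u + v) + normSqFour (u - v) = 2 * (normSqFour u + normSqFour v) := by
  simp only [normSqFour, Pi.add_apply, Pi.sub_apply]
  ring

/-- Polarization in the first two arguments reduces to the bound for equal arguments, and the
parallelogram law shows that nothing is lost: `4 T(u, v, w) ≤ 4/3 (‖u + v‖² + ‖u - v‖²) = 16/3`. -/
theorem triForm_le {u v w : Fin 4 → ℝ} (hu : normSqFour u = 1) (hv : normSqFour v = 1)
    (hw : normSqFour w = 1) : triForm u v w ≤ 4 / 3 := by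
  have h1 := (abs_le.1 (abs_triForm_le (u + v) hw)).2
  have h2 := (abs_le.1 (abs_triForm_le (u - v) hw)).1
  have h3 := triForm_polarization u v w
  have h4 := normSqFour_parallelogram u v
  rw [hu, hv] at h4
  linarith

/-- Equality in the polarization argument makes `u + v` extremal for the quartic bound, hence
proportional to `(2, √2, √2, 1)`. -/
theorem add_eq_of_triForm_eq {u v w : Fin 4 → ℝ} (hu : normSqFour u = 1) (hv : normSqFour v = 1)
    (hw : normSqFour w = 1) (hu0 : ∀ i, 0 ≤ u i) (hv0 : ∀ i, 0 ≤ v i)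
    (h : triForm u v w = 4 / 3) :
    u 0 + v 0 = 2 * (u 3 + v 3) ∧ u 1 + v 1 = √2 * (u 3 + v 3) ∧
      u 2 + v 2 = √2 * (u 3 + v 3) := by
  have h1 := (abs_le.1 (abs_triForm_le (u + v) hw)).2
  have h2 := (abs_le.1 (abs_triForm_le (u - v) hw)).1
  have h3 := triForm_polarization u v w
  have h4 := normSqFour_parallelogram u v
  rw [hu, hv] at h4
  have h5 : triForm (u + v) (u + v) w = 4 / 3 * normSqFour (u + v) := by linarith
  have h6 := triForm_sq_le (u + v) w
  rw [hw, mul_one, h5] at h6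
  have h7 := quartic_le ((u + v) 0) ((u + v) 1) ((u + v) 2) ((u + v) 3)
  refine eq_of_quartic_eq (add_nonneg (hu0 0) (hv0 0)) (add_nonneg (hu0 1) (hv0 1))
    (add_nonneg (hu0 2) (hv0 2)) (add_nonneg (hu0 3) (hv0 3)) (le_antisymm h7 ?_)
  refine le_trans (le_of_eq ?_) h6
  rw [normSqFour]
  simp only [Pi.add_apply]
  ring

/-- By symmetry all three pairwise sums lie on the line through `(2, √2, √2, 1)`, hence so does `u`,
being half of `(u + v) + (u + w) - (v + w)`. Unit norm and nonnegativity fix the scale. -/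
theorem eq_of_triForm_eq {u v w : Fin 4 → ℝ} (hu : normSqFour u = 1) (hv : normSqFour v = 1)
    (hw : normSqFour w = 1) (hu0 : ∀ i, 0 ≤ u i) (hv0 : ∀ i, 0 ≤ v i) (hw0 : ∀ i, 0 ≤ w i)
    (h : triForm u v w = 4 / 3) :
    u 0 = 2 / 3 ∧ u 1 = √2 / 3 ∧ u 2 = √2 / 3 ∧ u 3 = 1 / 3 := by
  obtain ⟨a1, a2, a3⟩ := add_eq_of_triForm_eq hu hv hw hu0 hv0 h
  obtain ⟨b1, b2, b3⟩ := add_eq_of_triForm_eq hu hw hv hu0 hw0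
    (by rw [← h]; simp only [triForm]; ring)
  obtain ⟨c1, c2, c3⟩ := add_eq_of_triForm_eq hv hw hu hv0 hw0
    (by rw [← h]; simp only [triForm]; ring)
  have e0 : u 0 = 2 * u 3 := by linarith
  have e1 : u 1 = √2 * u 3 := by linarith
  have e2 : u 2 = √2 * u 3 := by linarith
  have h2 : √2 ^ 2 = 2 := Real.sq_sqrt (by norm_num)
  have e3 : u 3 = 1 / 3 := by
    have h3 : u 3 ^ 2 = (1 / 3) ^ 2 := by
      rw [normSqFour, e0, e1, e2, mul_pow, mul_pow, h2] at hu
      linarith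
    exact (pow_left_inj₀ (hu0 3) (by norm_num) two_ne_zero).1 h3
  exact ⟨by rw [e0, e3]; ring, by rw [e1, e3]; ring, by rw [e2, e3]; ring, e3⟩

end TrilinearForm

/-! ### Entropy bound and Hessian at a vertex of degree three -/

section ThreeByThree

/-- The unnormalized Gibbs inequality, for one term. -/
theorem mul_log_sub_le {x p L c : ℝ} (hx : 0 ≤ x) (hp : 0 ≤ p) (hc : 0 < c)
    (hL : 0 < x → 0 < p ∧ L = Real.log p) :
    x * L - x * Real.log x ≤ x * Real.log c + p / c - x ∧
      (x * L - x * Real.log x = x * Real.log c + p / c - x → p = c * x) := by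
  rcases hx.eq_or_lt with rfl | hx
  · simp only [zero_mul, sub_zero, zero_add, mul_zero]
    refine ⟨by positivity, fun h => ?_⟩
    rw [eq_comm, div_eq_zero_iff] at h
    exact h.resolve_right hc.ne'
  · obtain ⟨hp, rfl⟩ := hL hx
    have ht : 0 < p / (x * c) := by positivity
    have e : x * Real.log p - x * Real.log x = x * Real.log c + x * Real.log (p / (x * c)) := by
      rw [Real.log_div hp.ne' (by positivity), Real.log_mul hx.ne' hc.ne']; ring
    have e2 : x * (p / (x * c) - 1) = p / c - x := by field_simp
    rw [e]
    refine ⟨?_, fun h => ?_⟩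
    · have := mul_le_mul_of_nonneg_left (Real.log_le_sub_one_of_pos ht) hx.le
      linarith
    · by_contra hne
      have hne' : p / (x * c) ≠ 1 := by
        intro h1
        rw [div_eq_one_iff_eq (by positivity)] at h1
        exact hne (by linarith)
      have := mul_lt_mul_of_pos_left (Real.log_lt_sub_one_of_pos ht hne') hx
      linarith

theorem log_mul_sqrt_three {p q r : ℝ} (hp : 0 < p) (hq : 0 < q) (hr : 0 < r) :
    0 < √p * √q * √r ∧
      (Real.log p + Real.log q + Real.log r) / 2 = Real.log (√p * √q * √r) := by
  refine ⟨by positivity, ?_⟩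
  rw [Real.log_mul (by positivity) (by positivity), Real.log_mul (by positivity) (by positivity),
    Real.log_sqrt hp.le, Real.log_sqrt hq.le, Real.log_sqrt hr.le]
  ring

set_option maxHeartbeats 2000000 in
/-- The entropy bound at a vertex of degree three, together with the case of equality. -/
theorem entropy_three_le {x₁₁ x₁₂ x₁₃ x₂₁ x₂₂ x₂₃ x₃₁ x₃₂ x₃₃ : ℝ}
    (h₁₁ : 0 ≤ x₁₁) (h₁₂ : 0 ≤ x₁₂) (h₁₃ : 0 ≤ x₁₃) (h₂₁ : 0 ≤ x₂₁) (h₂₂ : 0 ≤ x₂₂)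
    (h₂₃ : 0 ≤ x₂₃) (h₃₁ : 0 ≤ x₃₁) (h₃₂ : 0 ≤ x₃₂) (h₃₃ : 0 ≤ x₃₃)
    (hsum : x₁₁ + x₁₂ + x₁₃ + x₂₁ + x₂₂ + x₂₃ + x₃₁ + x₃₂ + x₃₃ = 1)
    {s₁ s₂ s₃ t₁ t₂ t₃ g₁ g₂ g₃ H : ℝ}
    (hs₁ : s₁ = x₁₂ + x₁₃) (hs₂ : s₂ = x₂₁ + x₂₃) (hs₃ : s₃ = x₃₁ + x₃₂)
    (ht₁ : t₁ = x₂₁ + x₃₁) (ht₂ : t₂ = x₁₂ + x₃₂) (ht₃ : t₃ = x₁₃ + x₂₃)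
    (hg₁ : g₁ = x₂₂ + x₂₃ + x₃₂ + x₃₃) (hg₂ : g₂ = x₁₁ + x₁₃ + x₃₁ + x₃₃)
    (hg₃ : g₃ = x₁₁ + x₁₂ + x₂₁ + x₂₂)
    (hH : H = 1 / 2 * (s₁ * Real.log s₁ + t₁ * Real.log t₁ + g₁ * Real.log g₁ +
      (s₂ * Real.log s₂ + t₂ * Real.log t₂ + g₂ * Real.log g₂) +
      (s₃ * Real.log s₃ + t₃ * Real.log t₃ + g₃ * Real.log g₃)) -
      1 / 2 * (x₁₁ * Real.log x₁₁ + x₂₂ * Real.log x₂₂ + x₃₃ * Real.log x₃₃) -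
      (x₁₂ * Real.log x₁₂ + x₁₃ * Real.log x₁₃ + x₂₁ * Real.log x₂₁ + x₂₃ * Real.log x₂₃ +
        x₃₁ * Real.log x₃₁ + x₃₂ * Real.log x₃₂)) :
    H ≤ Real.log (4 / 3) ∧ (H = Real.log (4 / 3) →
      x₁₁ = 1 / 9 ∧ x₁₂ = 1 / 9 ∧ x₁₃ = 1 / 9 ∧ x₂₁ = 1 / 9 ∧ x₂₂ = 1 / 9 ∧ x₂₃ = 1 / 9 ∧
        x₃₁ = 1 / 9 ∧ x₃₂ = 1 / 9 ∧ x₃₃ = 1 / 9) := by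
  have gs₁ : 0 ≤ s₁ := by linarith
  have gs₂ : 0 ≤ s₂ := by linarith
  have gs₃ : 0 ≤ s₃ := by linarith
  have gt₁ : 0 ≤ t₁ := by linarith
  have gt₂ : 0 ≤ t₂ := by linarith
  have gt₃ : 0 ≤ t₃ := by linarith
  have gg₁ : 0 ≤ g₁ := by linarith
  have gg₂ : 0 ≤ g₂ := by linarith
  have gg₃ : 0 ≤ g₃ := by linarith
  -- Each edge splits the unit mass at the vertex into four parts; their square roots form a unit
  -- vector.
  let u : Fin 4 → ℝ := ![√g₁, √s₁, √t₁, √x₁₁]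
  let v : Fin 4 → ℝ := ![√g₂, √s₂, √t₂, √x₂₂]
  let w : Fin 4 → ℝ := ![√g₃, √s₃, √t₃, √x₃₃]
  have hu : normSqFour u = 1 := by
    simp only [normSqFour, u, Matrix.cons_val]
    rw [Real.sq_sqrt gg₁, Real.sq_sqrt gs₁, Real.sq_sqrt gt₁, Real.sq_sqrt h₁₁]
    linarith
  have hv : normSqFour v = 1 := by
    simp only [normSqFour, v, Matrix.cons_val]
    rw [Real.sq_sqrt gg₂, Real.sq_sqrt gs₂, Real.sq_sqrt gt₂, Real.sq_sqrt h₂₂]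
    linarith
  have hw : normSqFour w = 1 := by
    simp only [normSqFour, w, Matrix.cons_val]
    rw [Real.sq_sqrt gg₃, Real.sq_sqrt gs₃, Real.sq_sqrt gt₃, Real.sq_sqrt h₃₃]
    linarith
  have hZ := triForm_le hu hv hw
  have hZe : triForm u v w = √x₁₁ * √g₂ * √g₃ + √x₂₂ * √g₁ * √g₃ + √x₃₃ * √g₁ * √g₂ +
      √s₁ * √t₂ * √g₃ + √s₂ * √t₁ * √g₃ + √s₁ * √t₃ * √g₂ + √s₃ * √t₁ * √g₂ +
      √s₂ * √t₃ * √g₁ + √s₃ * √t₂ * √g₁ := by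
    simp only [triForm, u, v, w, Matrix.cons_val]
    ring
  -- The constant 4/3 is the common ratio `p_ef / x_ef` at the uniform point, so that all nine Gibbs
  -- inequalities are sharp there.
  obtain ⟨a₁₁, b₁₁⟩ := mul_log_sub_le (p := √x₁₁ * √g₂ * √g₃) h₁₁ (by positivity)
    (c := 4 / 3) (by norm_num) fun h =>
      log_mul_sqrt_three h (show 0 < g₂ by linarith) (show 0 < g₃ by linarith)
  obtain ⟨a₂₂, b₂₂⟩ := mul_log_sub_le (p := √x₂₂ * √g₁ * √g₃) h₂₂ (by positivity)
    (c := 4 / 3) (by norm_num) fun h =>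
      log_mul_sqrt_three h (show 0 < g₁ by linarith) (show 0 < g₃ by linarith)
  obtain ⟨a₃₃, b₃₃⟩ := mul_log_sub_le (p := √x₃₃ * √g₁ * √g₂) h₃₃ (by positivity)
    (c := 4 / 3) (by norm_num) fun h =>
      log_mul_sqrt_three h (show 0 < g₁ by linarith) (show 0 < g₂ by linarith)
  obtain ⟨a₁₂, b₁₂⟩ := mul_log_sub_le (p := √s₁ * √t₂ * √g₃) h₁₂ (by positivity)
    (c := 4 / 3) (by norm_num) fun h => log_mul_sqrt_three (show 0 < s₁ by linarith)
      (show 0 < t₂ by linarith) (show 0 < g₃ by linarith)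
  obtain ⟨a₂₁, b₂₁⟩ := mul_log_sub_le (p := √s₂ * √t₁ * √g₃) h₂₁ (by positivity)
    (c := 4 / 3) (by norm_num) fun h => log_mul_sqrt_three (show 0 < s₂ by linarith)
      (show 0 < t₁ by linarith) (show 0 < g₃ by linarith)
  obtain ⟨a₁₃, b₁₃⟩ := mul_log_sub_le (p := √s₁ * √t₃ * √g₂) h₁₃ (by positivity)
    (c := 4 / 3) (by norm_num) fun h => log_mul_sqrt_three (show 0 < s₁ by linarith)
      (show 0 < t₃ by linarith) (show 0 < g₂ by linarith)
  obtain ⟨a₃₁, b₃₁⟩ := mul_log_sub_le (p := √s₃ * √t₁ * √g₂) h₃₁ (by positivity)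
    (c := 4 / 3) (by norm_num) fun h => log_mul_sqrt_three (show 0 < s₃ by linarith)
      (show 0 < t₁ by linarith) (show 0 < g₂ by linarith)
  obtain ⟨a₂₃, b₂₃⟩ := mul_log_sub_le (p := √s₂ * √t₃ * √g₁) h₂₃ (by positivity)
    (c := 4 / 3) (by norm_num) fun h => log_mul_sqrt_three (show 0 < s₂ by linarith)
      (show 0 < t₃ by linarith) (show 0 < g₁ by linarith)
  obtain ⟨a₃₂, b₃₂⟩ := mul_log_sub_le (p := √s₃ * √t₂ * √g₁) h₃₂ (by positivity)
    (c := 4 / 3) (by norm_num) fun h => log_mul_sqrt_three (show 0 < s₃ by linarith)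
      (show 0 < t₂ by linarith) (show 0 < g₁ by linarith)
  -- Each `σ log σ`, `τ log τ`, `γ log γ` is distributed over the coordinates making up the form, so
  -- that every `x_ef` collects three half logarithms.
  have hHe : H =
      (x₁₁ * ((Real.log x₁₁ + Real.log g₂ + Real.log g₃) / 2) - x₁₁ * Real.log x₁₁) +
      (x₂₂ * ((Real.log x₂₂ + Real.log g₁ + Real.log g₃) / 2) - x₂₂ * Real.log x₂₂) +
      (x₃₃ * ((Real.log x₃₃ + Real.log g₁ + Real.log g₂) / 2) - x₃₃ * Real.log x₃₃) +
      (x₁₂ * ((Real.log s₁ + Real.log t₂ + Real.log g₃) / 2) - x₁₂ * Real.log x₁₂) +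
      (x₂₁ * ((Real.log s₂ + Real.log t₁ + Real.log g₃) / 2) - x₂₁ * Real.log x₂₁) +
      (x₁₃ * ((Real.log s₁ + Real.log t₃ + Real.log g₂) / 2) - x₁₃ * Real.log x₁₃) +
      (x₃₁ * ((Real.log s₃ + Real.log t₁ + Real.log g₂) / 2) - x₃₁ * Real.log x₃₁) +
      (x₂₃ * ((Real.log s₂ + Real.log t₃ + Real.log g₁) / 2) - x₂₃ * Real.log x₂₃) +
      (x₃₂ * ((Real.log s₃ + Real.log t₂ + Real.log g₁) / 2) - x₃₂ * Real.log x₃₂) := by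
    rw [hH]
    linear_combination (1 / 2 * Real.log s₁) * hs₁ + (1 / 2 * Real.log s₂) * hs₂ +
      (1 / 2 * Real.log s₃) * hs₃ + (1 / 2 * Real.log t₁) * ht₁ + (1 / 2 * Real.log t₂) * ht₂ +
      (1 / 2 * Real.log t₃) * ht₃ + (1 / 2 * Real.log g₁) * hg₁ + (1 / 2 * Real.log g₂) * hg₂ +
      (1 / 2 * Real.log g₃) * hg₃
  have hlogsum : (x₁₁ + x₁₂ + x₁₃ + x₂₁ + x₂₂ + x₂₃ + x₃₁ + x₃₂ + x₃₃) * Real.log (4 / 3) =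
      Real.log (4 / 3) := by rw [hsum, one_mul]
  have hbound : H ≤ Real.log (4 / 3) + triForm u v w / (4 / 3) - 1 := by
    rw [hHe, hZe]
    linarith
  refine ⟨by linarith, fun hEq => ?_⟩
  -- Equality saturates the trilinear bound and every Gibbs inequality: the former determines all
  -- `p_ef`, the latter give `p_ef = 4/3 x_ef`.
  have hZeq : triForm u v w = 4 / 3 := by linarith
  rw [hHe] at hEq
  rw [hZe] at hZeq
  have c₁₁ := b₁₁ (by linarith)
  have c₂₂ := b₂₂ (by linarith)
  have c₃₃ := b₃₃ (by linarith)
  have c₁₂ := b₁₂ (by linarith)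
  have c₂₁ := b₂₁ (by linarith)
  have c₁₃ := b₁₃ (by linarith)
  have c₃₁ := b₃₁ (by linarith)
  have c₂₃ := b₂₃ (by linarith)
  have c₃₂ := b₃₂ (by linarith)
  rw [← hZe] at hZeq
  have hu0 : ∀ i, 0 ≤ u i := by
    intro i; fin_cases i <;> exact Real.sqrt_nonneg _
  have hv0 : ∀ i, 0 ≤ v i := by
    intro i; fin_cases i <;> exact Real.sqrt_nonneg _
  have hw0 : ∀ i, 0 ≤ w i := by
    intro i; fin_cases i <;> exact Real.sqrt_nonneg _
  obtain ⟨d1, d2, d3, d4⟩ := eq_of_triForm_eq hu hv hw hu0 hv0 hw0 hZeq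
  obtain ⟨e1, e2, e3, e4⟩ := eq_of_triForm_eq hv hu hw hv0 hu0 hw0
    (by rw [← hZeq]; simp only [triForm]; ring)
  obtain ⟨f1, f2, f3, f4⟩ := eq_of_triForm_eq hw hv hu hw0 hv0 hu0
    (by rw [← hZeq]; simp only [triForm]; ring)
  simp only [u, v, w, Matrix.cons_val] at d1 d2 d3 d4 e1 e2 e3 e4 f1 f2 f3 f4
  have h2 : √2 * √2 = 2 := Real.mul_self_sqrt (by norm_num)
  rw [d4, e1, f1] at c₁₁
  rw [e4, d1, f1] at c₂₂
  rw [f4, d1, e1] at c₃₃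
  rw [d2, e3, f1] at c₁₂
  rw [e2, d3, f1] at c₂₁
  rw [d2, f3, e1] at c₁₃
  rw [f2, d3, e1] at c₃₁
  rw [e2, f3, d1] at c₂₃
  rw [f2, e3, d1] at c₃₂
  refine ⟨?_, ?_, ?_, ?_, ?_, ?_, ?_, ?_, ?_⟩ <;> linarith

/-- The Hessian at the uniform point, for a vertex of degree three. -/
theorem hessian_three_eq {x₁₁ x₁₂ x₁₃ x₂₁ x₂₂ x₂₃ x₃₁ x₃₂ x₃₃ : ℝ}
    (hsum : x₁₁ + x₁₂ + x₁₃ + x₂₁ + x₂₂ + x₂₃ + x₃₁ + x₃₂ + x₃₃ = 0) :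
    4 * (x₁₁ ^ 2 + x₂₂ ^ 2 + x₃₃ ^ 2 +
        2 * (x₁₂ ^ 2 + x₁₃ ^ 2 + x₂₁ ^ 2 + x₂₃ ^ 2 + x₃₁ ^ 2 + x₃₂ ^ 2) -
      (1 / 2 * ((x₁₂ + x₁₃) ^ 2 + (x₂₁ + x₂₃) ^ 2 + (x₃₁ + x₃₂) ^ 2) +
        1 / 2 * ((x₂₁ + x₃₁) ^ 2 + (x₁₂ + x₃₂) ^ 2 + (x₁₃ + x₂₃) ^ 2) +
        1 / 4 * ((x₂₂ + x₂₃ + x₃₂ + x₃₃) ^ 2 + (x₁₁ + x₁₃ + x₃₁ + x₃₃) ^ 2 +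
          (x₁₁ + x₁₂ + x₂₁ + x₂₂) ^ 2))) =
    (x₂₃ + x₃₂ + x₁₁) ^ 2 + (x₁₃ + x₃₁ + x₂₂) ^ 2 + (x₁₂ + x₂₁ + x₃₃) ^ 2 +
      (x₂₃ + x₃₂) ^ 2 + (x₁₃ + x₃₁) ^ 2 + (x₁₂ + x₂₁) ^ 2 +
      2 * (x₁₁ ^ 2 + x₂₂ ^ 2 + x₃₃ ^ 2) +
      ((x₁₂ - x₂₁ + (x₃₁ - x₁₃)) ^ 2 + (x₁₂ - x₂₁ + (x₂₃ - x₃₂)) ^ 2 +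
        (x₂₃ - x₃₂ + (x₃₁ - x₁₃)) ^ 2) := by
  obtain rfl : x₃₃ = -(x₁₁ + x₁₂ + x₁₃ + x₂₁ + x₂₂ + x₂₃ + x₃₁ + x₃₂) := by linarith
  ring

/-- If the sum of squares vanishes, the diagonal is zero and the off-diagonal part antisymmetric;
the last three squares then say that its three entries, suitably signed, have vanishing pairwise
sums. -/
theorem hessian_three_nonneg {x₁₁ x₁₂ x₁₃ x₂₁ x₂₂ x₂₃ x₃₁ x₃₂ x₃₃ : ℝ}
    (hsum : x₁₁ + x₁₂ + x₁₃ + x₂₁ + x₂₂ + x₂₃ + x₃₁ + x₃₂ + x₃₃ = 0) {Q : ℝ}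
    (hQ : Q = x₁₁ ^ 2 + x₂₂ ^ 2 + x₃₃ ^ 2 +
        2 * (x₁₂ ^ 2 + x₁₃ ^ 2 + x₂₁ ^ 2 + x₂₃ ^ 2 + x₃₁ ^ 2 + x₃₂ ^ 2) -
      (1 / 2 * ((x₁₂ + x₁₃) ^ 2 + (x₂₁ + x₂₃) ^ 2 + (x₃₁ + x₃₂) ^ 2) +
        1 / 2 * ((x₂₁ + x₃₁) ^ 2 + (x₁₂ + x₃₂) ^ 2 + (x₁₃ + x₂₃) ^ 2) +
        1 / 4 * ((x₂₂ + x₂₃ + x₃₂ + x₃₃) ^ 2 + (x₁₁ + x₁₃ + x₃₁ + x₃₃) ^ 2 +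
          (x₁₁ + x₁₂ + x₂₁ + x₂₂) ^ 2))) :
    0 ≤ Q ∧ (Q = 0 → x₁₁ = 0 ∧ x₁₂ = 0 ∧ x₁₃ = 0 ∧ x₂₁ = 0 ∧ x₂₂ = 0 ∧ x₂₃ = 0 ∧
      x₃₁ = 0 ∧ x₃₂ = 0 ∧ x₃₃ = 0) := by
  have key := hessian_three_eq hsum
  rw [← hQ] at key
  refine ⟨?_, fun h => ?_⟩
  · have : 0 ≤ 4 * Q := by rw [key]; positivity
    linarith
  · rw [h, mul_zero] at key
    have p₁ := sq_nonneg (x₂₃ + x₃₂ + x₁₁)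
    have p₂ := sq_nonneg (x₁₃ + x₃₁ + x₂₂)
    have p₃ := sq_nonneg (x₁₂ + x₂₁ + x₃₃)
    have p₄ := sq_nonneg (x₂₃ + x₃₂)
    have p₅ := sq_nonneg (x₁₃ + x₃₁)
    have p₆ := sq_nonneg (x₁₂ + x₂₁)
    have p₇ := sq_nonneg x₁₁
    have p₈ := sq_nonneg x₂₂
    have p₉ := sq_nonneg x₃₃
    have q₁ := sq_nonneg (x₁₂ - x₂₁ + (x₃₁ - x₁₃))
    have q₂ := sq_nonneg (x₁₂ - x₂₁ + (x₂₃ - x₃₂))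
    have q₃ := sq_nonneg (x₂₃ - x₃₂ + (x₃₁ - x₁₃))
    have z₁ : x₁₁ = 0 := pow_eq_zero_iff two_ne_zero |>.1 (by linarith)
    have z₂ : x₂₂ = 0 := pow_eq_zero_iff two_ne_zero |>.1 (by linarith)
    have z₃ : x₃₃ = 0 := pow_eq_zero_iff two_ne_zero |>.1 (by linarith)
    have z₄ : x₂₃ + x₃₂ = 0 := pow_eq_zero_iff two_ne_zero |>.1 (by linarith)
    have z₅ : x₁₃ + x₃₁ = 0 := pow_eq_zero_iff two_ne_zero |>.1 (by linarith)
    have z₆ : x₁₂ + x₂₁ = 0 := pow_eq_zero_iff two_ne_zero |>.1 (by linarith)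
    have w₁ : x₁₂ - x₂₁ + (x₃₁ - x₁₃) = 0 := pow_eq_zero_iff two_ne_zero |>.1 (by linarith)
    have w₂ : x₁₂ - x₂₁ + (x₂₃ - x₃₂) = 0 := pow_eq_zero_iff two_ne_zero |>.1 (by linarith)
    have w₃ : x₂₃ - x₃₂ + (x₃₁ - x₁₃) = 0 := pow_eq_zero_iff two_ne_zero |>.1 (by linarith)
    refine ⟨z₁, ?_, ?_, ?_, z₂, ?_, ?_, ?_, z₃⟩ <;> linarith

end ThreeByThree

/-! ### Positivity of determinants of definite forms -/

section Positivity

variable {F : Type*} [NormedAddCommGroup F] [InnerProductSpace ℝ F] [FiniteDimensional ℝ F]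

theorem bilinDetOn_pos (B : F →L[ℝ] F →L[ℝ] ℝ) (U : Submodule ℝ F)
    (hsymm : ∀ u v, B u v = B v u) (hB : ∀ v ∈ U, v ≠ 0 → 0 < B v v) : 0 < bilinDetOn B U := by
  refine (Matrix.PosDef.of_dotProduct_mulVec_pos ?_ fun {y} hy => ?_).det_pos
  · ext i j
    simp [hsymm]
  · have h := bilin_eq_dotProduct_mulVec B U
      ((stdOrthonormalBasis ℝ U).repr.symm (WithLp.toLp 2 y))
    rw [LinearIsometryEquiv.apply_symm_apply] at h
    rw [star_trivial]
    refine lt_of_lt_of_eq (hB _ (Subtype.property _) fun h0 => hy ?_) h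
    rw [Submodule.coe_eq_zero, LinearIsometryEquiv.map_eq_zero_iff] at h0
    exact congrArg WithLp.ofLp h0

end Positivity

/-! ### The maximum and the Hessian for cubic graphs -/

namespace Graph

universe u v

variable {α : Type u} {β : Type v} {G : Graph α β} [Fintype E(G)]

open scoped Classical in
/-- Sums over the edges at a vertex of degree three. -/
theorem exists_sum_edgesAt_eq (hreg : G.IsRegular 3) (i : V(G)) : ∃ a b c : G.EdgesAt i,
    (∀ e, e = a ∨ e = b ∨ e = c) ∧ ∀ y : G.EdgesAt i → ℝ,
      ∑ e, y e = y a + y b + y c ∧ ∑ e with e ≠ a, y e = y b + y c ∧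
        ∑ e with e ≠ b, y e = y a + y c ∧ ∑ e with e ≠ c, y e = y a + y b := by
  obtain ⟨a, b, c, hab, hac, hbc, h⟩ := Finset.card_eq_three.1
    ((Finset.card_univ (α := G.EdgesAt i)).trans (card_edgesAt hreg i))
  have hs : ∀ y : G.EdgesAt i → ℝ, ∑ e, y e = y a + y b + y c := fun y => by
    rw [h, Finset.sum_insert (by simp [hab, hac]), Finset.sum_pair hbc, add_assoc]
  refine ⟨a, b, c, fun e => by simpa [h] using Finset.mem_univ e, fun y => ⟨hs y, ?_, ?_, ?_⟩⟩
  · linarith [hs y, sum_eq_add_sum_ne a y]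
  · linarith [hs y, sum_eq_add_sum_ne b y]
  · linarith [hs y, sum_eq_add_sum_ne c y]

open scoped Classical in
theorem vertex_entropy_le (hreg : G.IsRegular 3) {x : G.PairSpace} (hx : x ∈ G.pairK ∩ G.pairW)
    (i : V(G)) {H : ℝ}
    (hH : H = 1 / 2 * ∑ e : G.EdgesAt i,
      (G.pairSigma x i e * Real.log (G.pairSigma x i e)
        + G.pairTau x i e * Real.log (G.pairTau x i e)
        + G.pairGamma x i e * Real.log (G.pairGamma x i e)
        - x ⟨i, e, e⟩ * Real.log (x ⟨i, e, e⟩)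
        - 2 * ∑ f : G.EdgesAt i with f ≠ e, x ⟨i, e, f⟩ * Real.log (x ⟨i, e, f⟩))) :
    H ≤ Real.log (4 / 3) ∧ (H = Real.log (4 / 3) → ∀ e f, x ⟨i, e, f⟩ = 1 / 9) := by
  obtain ⟨a, b, c, hcov, hsum⟩ := exists_sum_edgesAt_eq hreg i
  have hw := hx.2.2 i
  simp only [fun y => (hsum y).1] at hw
  have h0 : ∀ t, 0 ≤ x t := fun t => (hx.1 t).1
  obtain ⟨h1, h2⟩ := entropy_three_le (h0 ⟨i, a, a⟩) (h0 ⟨i, a, b⟩) (h0 ⟨i, a, c⟩) (h0 ⟨i, b, a⟩)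
    (h0 ⟨i, b, b⟩) (h0 ⟨i, b, c⟩) (h0 ⟨i, c, a⟩) (h0 ⟨i, c, b⟩) (h0 ⟨i, c, c⟩) (by linarith)
    (s₁ := G.pairSigma x i a) (s₂ := G.pairSigma x i b) (s₃ := G.pairSigma x i c)
    (t₁ := G.pairTau x i a) (t₂ := G.pairTau x i b) (t₃ := G.pairTau x i c)
    (g₁ := G.pairGamma x i a) (g₂ := G.pairGamma x i b) (g₃ := G.pairGamma x i c) (H := H)
    (hsum _).2.1 (hsum _).2.2.1 (hsum _).2.2.2 (hsum _).2.1 (hsum _).2.2.1 (hsum _).2.2.2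
    (by simp only [pairGamma, fun y => (hsum y).2.1]; ring)
    (by simp only [pairGamma, fun y => (hsum y).2.2.1]; ring)
    (by simp only [pairGamma, fun y => (hsum y).2.2.2]; ring)
    (by
      rw [hH, (hsum _).1, (hsum _).2.1, (hsum _).2.2.1, (hsum _).2.2.2]
      ring)
  refine ⟨h1, fun h => ?_⟩
  obtain ⟨e1, e2, e3, e4, e5, e6, e7, e8, e9⟩ := h2 h
  intro e f
  rcases hcov e with rfl | rfl | rfl <;> rcases hcov f with rfl | rfl | rfl <;> assumption

/-- The function is a sum over vertices of terms at most `log (4 / 3)`, all attained at the uniform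
point. A point different from it has a nonuniform coordinate at some vertex, where the bound is
strict. -/
theorem hasUniqueMaxOnAt_pairPhi [Fintype V(G)] (hreg : G.IsRegular 3) :
    HasUniqueMaxOnAt G.pairPhi (G.pairK ∩ G.pairW) (G.pairPoint 3) := by
  classical
  have hW : G.pairPoint 3 ∈ G.pairW := pairPoint_mem_pairW hreg le_rfl
  refine ⟨⟨mem_pairK_of_nonneg hW fun t => ?_, hW⟩, fun x hx hne => ?_⟩
  · rw [pairPoint_apply]; positivity
  · have hval : G.pairPhi (G.pairPoint 3) = ∑ _i : V(G), Real.log (4 / 3) := by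
      rw [pairPhi_eq_entropySum, entropySum_pairPoint hreg le_rfl, Finset.sum_const,
        Finset.card_univ, nsmul_eq_mul, Real.log_div (by norm_num) (by norm_num),
        show (4 : ℝ) = 2 ^ 2 by norm_num, Real.log_pow]
      norm_num
    rw [hval, pairPhi, Finset.mul_sum]
    obtain ⟨⟨i, e, f⟩, ht⟩ : ∃ t, x t ≠ 1 / 9 := by
      by_contra! h
      refine hne ?_
      ext t
      rw [h t, pairPoint_apply]
      norm_num
    exact Finset.sum_lt_sum (fun j _ => (vertex_entropy_le hreg hx j rfl).1)
      ⟨i, Finset.mem_univ _, (vertex_entropy_le hreg hx i rfl).1.lt_of_ne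
        fun h => ht ((vertex_entropy_le hreg hx i rfl).2 h e f)⟩

open scoped Classical in
theorem vertex_hessian_nonpos (hreg : G.IsRegular 3) {x : G.PairSpace} (hx : x ∈ G.pairV)
    (i : V(G)) {H : ℝ}
    (hH : H = ∑ e : G.EdgesAt i,
      (1 / 2 * (G.pairSigma x i e * G.pairSigma x i e / (2 / 9) +
        G.pairTau x i e * G.pairTau x i e / (2 / 9) +
        G.pairGamma x i e * G.pairGamma x i e / (4 / 9)) -
        1 / 2 * (x ⟨i, e, e⟩ * x ⟨i, e, e⟩ / (1 / 9)) -
        ∑ f : G.EdgesAt i with f ≠ e, x ⟨i, e, f⟩ * x ⟨i, e, f⟩ / (1 / 9))) :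
    H ≤ 0 ∧ (H = 0 → ∀ e f, x ⟨i, e, f⟩ = 0) := by
  obtain ⟨a, b, c, hcov, hsum⟩ := exists_sum_edgesAt_eq hreg i
  have hw := hx.2 i
  simp only [fun y => (hsum y).1] at hw
  obtain ⟨h1, h2⟩ := hessian_three_nonneg (x₁₁ := x ⟨i, a, a⟩) (x₁₂ := x ⟨i, a, b⟩)
    (x₁₃ := x ⟨i, a, c⟩) (x₂₁ := x ⟨i, b, a⟩) (x₂₂ := x ⟨i, b, b⟩) (x₂₃ := x ⟨i, b, c⟩)
    (x₃₁ := x ⟨i, c, a⟩) (x₃₂ := x ⟨i, c, b⟩) (x₃₃ := x ⟨i, c, c⟩) (by linarith)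
    -- The factor `2 / 9` clears the values `2/9`, `4/9`, `1/9` of the forms at the uniform point.
    (Q := -(2 / 9) * H) (by
      rw [hH, (hsum _).1]
      simp only [pairSigma, pairTau, pairGamma, fun y => (hsum y).2.1, fun y => (hsum y).2.2.1,
        fun y => (hsum y).2.2.2]
      ring)
  refine ⟨by linarith, fun h => ?_⟩
  obtain ⟨e1, e2, e3, e4, e5, e6, e7, e8, e9⟩ := h2 (by rw [h, mul_zero])
  intro e f
  rcases hcov e with rfl | rfl | rfl <;> rcases hcov f with rfl | rfl | rfl <;> assumption

/-- The Hessian splits over the vertices like the function itself, so definiteness on `V` follows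
from the degree-three identity at each vertex. -/
theorem detNegHessian_three_pos [Fintype V(G)] (hreg : G.IsRegular 3) :
    0 < G.detNegHessian 3 := by
  classical
  have hpos := pairForm_pairPoint_pos hreg le_rfl
  rw [detNegHessian, pairPhi_eq_entropySum]
  refine bilinDetOn_pos _ _ (fun x y => ?_) fun x hx hne => ?_
  · simp only [_root_.neg_apply, hessian_entropySum _ _ fun k => (hpos k).ne']
    congr 1
    exact Finset.sum_congr rfl fun k _ => by ring
  · rw [_root_.neg_apply, _root_.neg_apply, hessian_entropySum _ _ fun k => (hpos k).ne',
      sum_pairWeight, neg_pos]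
    simp only [pairForm_sigma, pairForm_tau, pairForm_gamma, pairForm_coord,
      pairSigma_pairPoint hreg le_rfl, pairTau_pairPoint hreg le_rfl,
      pairGamma_pairPoint hreg le_rfl, pairPoint_apply, Nat.cast_ofNat,
      show ((3 : ℝ) - 1) / 3 ^ 2 = 2 / 9 by norm_num,
      show ((3 : ℝ) - 1) ^ 2 / 3 ^ 2 = 4 / 9 by norm_num,
      show (1 : ℝ) / 3 ^ 2 = 1 / 9 by norm_num]
    obtain ⟨⟨i, e, f⟩, ht⟩ : ∃ t, x t ≠ 0 := by
      by_contra! h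
      refine hne ?_
      ext t
      exact h t
    refine lt_of_lt_of_eq (Finset.sum_lt_sum
      (fun j _ => (vertex_hessian_nonpos hreg hx j rfl).1)
      ⟨i, Finset.mem_univ _, (vertex_hessian_nonpos hreg hx i rfl).1.lt_of_ne
        fun h => ht ((vertex_hessian_nonpos hreg hx i rfl).2 h e f)⟩) Finset.sum_const_zero

end Graph

end

theorem theorem4p2 {α β : Type*} (G : Graph α β) [Fintype V(G)] [Fintype E(G)] [G.Loopless]
    (hconn : G.IsConnected) (d : ℕ) (hd : 3 ≤ d) (hreg : G.IsRegular d) :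
    (HasUniqueMaxOnAt G.pairPhi (G.pairK ∩ G.pairW) (G.pairPoint d) →
      G.detNegHessian d ≠ 0 →
      Asymptotics.IsEquivalent (Filter.atTop ⊓ Filter.principal {n : ℕ | G.IsAdmissible n})
        (fun n => G.secondMoment n) (fun n => G.secondMomentMainTerm d n)) ∧
    (d = 3 →
      G.detNegHessian d ≠ 0 ∧
      Asymptotics.IsEquivalent (Filter.atTop ⊓ Filter.principal {n : ℕ | G.IsAdmissible n})
        (fun n => G.secondMoment n) (fun n => G.secondMomentMainTerm d n)) := by
  refine ⟨Graph.secondMoment_isEquivalent hd hreg, ?_⟩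
  rintro rfl
  have hdet := (Graph.detNegHessian_three_pos hreg).ne'
  exact ⟨hdet, Graph.secondMoment_isEquivalent hd hreg (Graph.hasUniqueMaxOnAt_pairPhi hreg) hdet⟩
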